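/- **Setting.** A quantum game has a finite set of players $i$, each with a space $\mathbb{C}^{d_i}$; a finite set $\Omega$ of outcomes with positive semidefinite operators $(P_\omega)_{\omega\in\Omega}$ on $\bigotimes_i\mathbb{C}^{d_i}$ such that $\sum_\omega P_\omega=I$; and payoff observables $U_i:\Omega\to\mathbb{R}$. Let $\mathcal{D}_i$ be the set of positive semidefinite $d_i\times d_i$ matrices of trace one, and $\mathcal{D}=\prod_i\mathcal{D}_i$. The payoff of player $i$ at $X\in\mathcal{D}$ is $u_i(X)=\sum_\omega U_i(\omega)\operatorname{tr}\big(P_\omega\bigotimes_j X_j\big)$, and $V_i(X)=\nabla_{X_i^{\top}}u_i(X)$ is the payoff gradient, so that $u_i(Z_i;X_{-i})=\operatorname{tr}(Z_iV_i(X))$. A state $X^*\in\mathcal{D}$ is a Nash equilibrium if $u_i(X^*)\ge u_i(Z_i;X^*_{-i})$ for all $i$ and all $Z_i\in\mathcal{D}_i$. Each player has a regularizer $h_i(X_i)=\operatorname{tr}\theta_i(X_i)$, where $\theta_i:[0,1]\to\mathbb{R}$ is continuous, twice differentiable on $(0,1]$, with $\theta_i(0)=0$, $\inf_{(0,1]}\theta_i''>0$,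 and is steep: $\lim_{x\to0^+}\theta_i'(x)=-\infty$. The dynamics (FTQL) are $$\dot Y_i(t)=V_i(X(t)),\qquad X_i(t)=Q_i(Y_i(t)):=\arg\max_{Z\in\mathcal{D}_i}\{\operatorname{tr}(Y_i(t)Z)-h_i(Z)\},$$ with $Y_i(t)$ Hermitian. The quantum state dynamics (QD) are the dynamics induced by (FTQL) on $\mathcal{D}$. In an orthonormal eigenbasis of $X_i$ with eigenvalues $x_\alpha$, with $V_{\alpha\beta}$ the entries of $V_i(X)$ in this basis and $\theta=\theta_i$, their right-hand side has the entries $$\frac{V_{\alpha\alpha}}{\theta''(x_\alpha)}-\frac{\sum_\gamma V_{\gamma\gamma}/\theta''(x_\gamma)}{\sum_\gamma\theta''(x_\alpha)/\theta''(x_\gamma)}\quad(\alpha=\beta),\qquad \frac{x_\beta-x_\alpha}{\theta'(x_\beta)-\theta'(x_\alpha)}V_{\alpha\beta}\quad(\alpha\ne\beta),$$ where the last quotient is $1/\theta''(x_\alpha)$ if $x_\alpha=x_\beta$, and an entry is $0$, and a term of the sums is omitted, if it involves a zero eigenvalue. (QD) leaves the kernel of every $X_i$ invariant; accordingly the orbit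 of $X^0\in\mathcal{D}$ is the curve $X(t)$, $t\in\mathbb{R}$, with $X(0)=X^0$ for which there are Hermitian $Y_i(t)$ with $\dot Y_i(t)=V_i(X(t))$ such that $X_i(t)$ maximizes $\operatorname{tr}(Y_i(t)Z)-h_i(Z)$ over all $Z\in\mathcal{D}_i$ with $\ker Z\supseteq\ker X^0_i$ (over all of $\mathcal{D}_i$ if $X^0_i$ has full rank). The flow is denoted by $\Phi_t$. A rest point is a state at which the right-hand side of (QD) vanishes and which is fixed by every $\Phi_t$. A state $X^*\in\mathcal{D}$ is (Lyapunov) stable if for every neighborhood $U$ of $X^*$ in $\mathcal{D}$ there is a neighborhood $U'$ with $\Phi_t(X)\in U$ for all $X\in U'$ and $t\ge0$. It is consistently attracting if it has a neighborhood $U$ in $\mathcal{D}$ such that $\lim_{t\to\infty}\Phi_t(X)=X^*$ for all $X\in U$ with $\ker X_i\subseteq\ker X_i^*$ for all $i$; and consistently asymptotically stable if it is both. It satisfies (VS) if it has a neighborhood $U$ in $\mathcal{D}$ such that $\sum_i\operatorname{tr}\big(V_i(X)(X_i-X^*_i)\big)<0$ for all $X\in U\setminus\{X^*\}$. **Theorem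 (quantum "folk theorem").** In any quantum game with steep regularizers as above, the orbit of every state of $\mathcal{D}$ under (QD) exists and is unique, and for every $X^*\in\mathcal{D}$: 1. If $X^*$ is a Nash equilibrium, it is a rest point of (QD). 2. If $X(t)=Q(Y(t))$, $t\ge0$, is a trajectory of (FTQL) and $X(t)\to X^*$ as $t\to\infty$, then $X^*$ is a Nash equilibrium. 3. If $X^*$ is stable under (QD), it is a Nash equilibrium. 4. If $X^*$ is consistently asymptotically stable, it is pure: every $X^*_i$ has rank one. 5. If $X^*$ satisfies (VS), it is consistently asymptotically stable. -/

import Mathlib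

open Filter Topology
open scoped ComplexOrder

namespace QGame

/-- Square complex matrices acting on `ℂ^m`. -/
abbrev Mat (m : ℕ) : Type := Matrix (Fin m) (Fin m) ℂ

/-- Profiles of matrices, one `d i × d i` matrix for each player `i` (product topology). -/
abbrev Profile {ι : Type*} (d : ι → ℕ) : Type _ := ∀ i, Mat (d i)

/-- The index set of the standard product basis of `⨂ i, ℂ^(d i)`. -/
abbrev JointIdx {ι : Type*} (d : ι → ℕ) : Type _ := ∀ i, Fin (d i)

/-- The density matrices on `ℂ^m`: positive semidefinite, of unit trace. -/
def densities (m : ℕ) : Set (Mat m) := {X | X.PosSemidef ∧ X.trace = 1}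

/-- The state space: profiles of density matrices. -/
def states {ι : Type*} (d : ι → ℕ) : Set (Profile d) := {X | ∀ i, X i ∈ densities (d i)}

/-- A quantum game with players `ι`, state spaces `ℂ^(d i)` and measurement outcomes `Ω`: a positive
operator-valued measure on the tensor product of the players' spaces, written in the product basis,
and one real payoff observable per player. -/
structure QuantumGame (ι : Type*) [Fintype ι] [DecidableEq ι] (d : ι → ℕ)
    (Ω : Type*) [Fintype Ω] where
  povm : Ω → Matrix (JointIdx d) (JointIdx d) ℂ
  povm_posSemidef : ∀ ω, (povm ω).PosSemidef
  povm_sum : ∑ ω, povm ω = 1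
  obs : ι → Ω → ℝ

section Game

variable {ι : Type*} [Fintype ι] [DecidableEq ι] {d : ι → ℕ} {Ω : Type*} [Fintype Ω]

/-- The tensor product `⨂ i, X i`, in the product basis. -/
def tensor (X : Profile d) : Matrix (JointIdx d) (JointIdx d) ℂ :=
  Matrix.of fun k l => ∏ i, X i (k i) (l i)

/-- The expected payoff `∑ ω, o_i(ω) tr(P_ω ⨂ X)`, as a complex multilinear function of arbitrary
matrices. -/
noncomputable def QuantumGame.payoffC (G : QuantumGame ι d Ω) (i : ι) (X : Profile d) : ℂ :=
  ∑ ω, (G.obs i ω : ℂ) * (G.povm ω * tensor X).trace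

/-- The expected payoff of player `i` at a profile of density matrices (Born's rule). -/
noncomputable def QuantumGame.payoff (G : QuantumGame ι d Ω) (i : ι) (X : Profile d) : ℝ :=
  (G.payoffC i X).re

/-- The individual payoff gradient of player `i`: its `(b, a)` entry is the partial derivative of the
payoff in the `(a, b)` entry of `X i`, that is, by linearity in `X i`, the value at the matrix unit
`E_{ab}`. See `trace_mul_grad`. -/
noncomputable def QuantumGame.grad (G : QuantumGame ι d Ω) (X : Profile d) : Profile d :=
  fun i => Matrix.of fun b a => G.payoffC i (Function.update X i (Matrix.single a b 1))

theorem tensor_update (X : Profile d) (i : ι) (Z : Mat (d i)) :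
    tensor (Function.update X i Z) =
      ∑ a, ∑ b, Z a b • tensor (Function.update X i (Matrix.single a b 1)) := by
  have key : ∀ (W : Mat (d i)) (k l : JointIdx d), tensor (Function.update X i W) k l =
      W (k i) (l i) * ∏ j ∈ Finset.univ.erase i, X j (k j) (l j) := by
    intro W k l
    simp only [tensor, Matrix.of_apply]
    rw [← Finset.mul_prod_erase _ _ (Finset.mem_univ i), Function.update_self]
    congr 1
    refine Finset.prod_congr rfl fun j hj => ?_
    rw [Function.update_of_ne (Finset.ne_of_mem_erase hj)]
  ext k l
  simp only [Matrix.sum_apply, Matrix.smul_apply, key, smul_eq_mul, ← mul_assoc, ← Finset.sum_mul]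
  congr 1
  simp [Matrix.single_apply, ite_and]

/-- The gradient represents the payoff: `u_i(Z; X_{-i}) = tr(Z V_i(X))`. -/
theorem QuantumGame.trace_mul_grad (G : QuantumGame ι d Ω) (X : Profile d) (i : ι) (Z : Mat (d i)) :
    (Z * G.grad X i).trace = G.payoffC i (Function.update X i Z) := by
  have hl : (Z * G.grad X i).trace =
      ∑ a, ∑ b, Z a b * G.payoffC i (Function.update X i (Matrix.single a b 1)) := by
    simp [Matrix.trace, Matrix.mul_apply, grad]
  rw [hl]
  simp only [payoffC]
  rw [tensor_update X i Z]
  simp only [Matrix.mul_smul, Matrix.trace_sum, Matrix.trace_smul, Finset.mul_sum,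
    smul_eq_mul]
  symm
  rw [Finset.sum_comm]
  refine Finset.sum_congr rfl fun a _ => ?_
  rw [Finset.sum_comm]
  exact Finset.sum_congr rfl fun b _ => Finset.sum_congr rfl fun ω _ => by ring

/-- `X` is a Nash equilibrium: no player gains by a unilateral deviation. -/
def QuantumGame.IsNash (G : QuantumGame ι d Ω) (X : Profile d) : Prop :=
  ∀ i, ∀ Z ∈ densities (d i), G.payoff i (Function.update X i Z) ≤ G.payoff i X

/-- Local variational stability. -/
def QuantumGame.IsVariationallyStable (G : QuantumGame ι d Ω) (Xs : Profile d) : Prop :=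
  ∃ U ∈ 𝓝 Xs, ∀ X ∈ U ∩ states d, X ≠ Xs →
    (∑ i, (G.grad X i * (X i - Xs i)).trace).re < 0

end Game

/-- A regularizer kernel `θ : [0, 1] → ℝ` (only the values on `[0, 1]` matter), with its first and
second derivatives on `(0, 1]` (one-sided at `1`). -/
structure Kernel where
  toFun : ℝ → ℝ
  d1 : ℝ → ℝ
  d2 : ℝ → ℝ
  continuousOn : ContinuousOn toFun (Set.Icc 0 1)
  hasDeriv1 : ∀ x ∈ Set.Ioc (0 : ℝ) 1, HasDerivWithinAt toFun (d1 x) (Set.Ioc 0 1) x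
  hasDeriv2 : ∀ x ∈ Set.Ioc (0 : ℝ) 1, HasDerivWithinAt d1 (d2 x) (Set.Ioc 0 1) x
  inf_d2_pos : ∃ c > 0, ∀ x ∈ Set.Ioc (0 : ℝ) 1, c ≤ d2 x
  map_zero : toFun 0 = 0

/-- Steepness: `θ'(x) → -∞` as `x → 0⁺`. -/
def Kernel.Steep (θ : Kernel) : Prop := Tendsto θ.d1 (𝓝[>] 0) atBot

/-- The regularizer `h(X) = tr θ(X)`, with `θ(X)` given by the functional calculus. -/
noncomputable def Kernel.reg (θ : Kernel) {m : ℕ} (X : Mat m) : ℝ :=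
  (cfc θ.toFun X).trace.re

/-- `X` maximizes `Z ↦ tr(Y Z) - h(Z)` over `S`. For `S` the set of all density matrices this is the
relation `X = Q(Y)` for the regularized best response map `Q`. -/
def Kernel.IsBestResponse (θ : Kernel) {m : ℕ} (S : Set (Mat m)) (Y X : Mat m) : Prop :=
  X ∈ S ∧ IsMaxOn (fun Z => (Y * Z).trace.re - θ.reg Z) S X

/-- The face of the set of density matrices with `X₀` in its relative interior: the density matrices
whose kernel contains that of `X₀`. It is the set of all density matrices if `X₀` has full rank. -/
def face {m : ℕ} (X₀ : Mat m) : Set (Mat m) :=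
  {X ∈ densities m | ∀ v, X₀.mulVec v = 0 → X.mulVec v = 0}

/-- The entries of the right-hand side of the quantum state dynamics at a state with eigenvalues `x`,
in an orthonormal eigenbasis of that state, where `W` is the payoff gradient in the same basis:
`W_αα/θ''(x_α) - (∑_γ W_γγ/θ''(x_γ)) / (∑_γ θ''(x_α)/θ''(x_γ))` for `α = β`, and
`(x_β - x_α)/(θ'(x_β) - θ'(x_α)) W_αβ` for `α ≠ β` (read as `W_αβ/θ''(x_α)` if `x_α = x_β`).
Zero eigenvalues follow the convention for steep kernels: `θ'(0) = -∞` and `1/θ''(0) = 0`. -/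
noncomputable def Kernel.qdEntry (θ : Kernel) {m : ℕ} (x : Fin m → ℝ) (W : Mat m)
    (α β : Fin m) : ℂ :=
  if x α = 0 ∨ x β = 0 then 0
  else if α = β then
    W α α / (θ.d2 (x α) : ℂ) -
      (∑ γ with x γ ≠ 0, W γ γ / (θ.d2 (x γ) : ℂ)) /
        ((∑ γ with x γ ≠ 0, θ.d2 (x α) / θ.d2 (x γ) : ℝ) : ℂ)
  else if x α = x β then W α β / (θ.d2 (x α) : ℂ)
  else (((x β - x α) / (θ.d1 (x β) - θ.d1 (x α)) : ℝ) : ℂ) * W α β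

section Dynamics

variable {ι : Type*} [Fintype ι] [DecidableEq ι] {d : ι → ℕ} {Ω : Type*} [Fintype Ω]

/-- `(Y, X)` is a forward solution of follow the quantum leader: `Y' = V(X)`, `X = Q(Y)`, `t ≥ 0`. -/
def IsFTQL (G : QuantumGame ι d Ω) (θ : ι → Kernel) (Y X : ℝ → Profile d) : Prop :=
  ∀ t ≥ 0, ∀ i, (Y t i).IsHermitian ∧ (θ i).IsBestResponse (densities (d i)) (Y t i) (X t i) ∧
    ∀ a b, HasDerivWithinAt (fun s => Y s i a b) (G.grad (X t) i a b) (Set.Ici 0) t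

/-- `X` is the orbit of `X₀` under the quantum state dynamics, the dynamics on the state space that
are induced by follow the quantum leader. The kernel of the state is invariant under them, so they
are run on the face that has `X₀` in its relative interior; for `X₀` of full rank the best responses
are those over all density matrices. -/
def IsQDOrbit (G : QuantumGame ι d Ω) (θ : ι → Kernel) (X₀ : Profile d)
    (X : ℝ → Profile d) : Prop :=
  X 0 = X₀ ∧ ∃ Y : ℝ → Profile d, ∀ t i, (Y t i).IsHermitian ∧
    (θ i).IsBestResponse (face (X₀ i)) (Y t i) (X t i) ∧
    ∀ a b, HasDerivAt (fun s => Y s i a b) (G.grad (X t) i a b) t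

/-- `Φ` is the flow of the quantum state dynamics (its values outside the state space are
irrelevant). -/
def IsQDFlow (G : QuantumGame ι d Ω) (θ : ι → Kernel) (Φ : ℝ → Profile d → Profile d) : Prop :=
  ∀ X₀ ∈ states d, IsQDOrbit G θ X₀ fun t => Φ t X₀

/-- The right-hand side of the quantum state dynamics vanishes at `X`, in every unitary
eigendecomposition `X i = U diag(x) Uᴴ`. -/
def QDFieldVanishes (G : QuantumGame ι d Ω) (θ : ι → Kernel) (X : Profile d) : Prop :=
  ∀ i, ∀ U ∈ Matrix.unitaryGroup (Fin (d i)) ℂ, ∀ x : Fin (d i) → ℝ,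
    X i = U * Matrix.diagonal (fun α => (x α : ℂ)) * U.conjTranspose →
      ∀ α β, (θ i).qdEntry x (U.conjTranspose * G.grad X i * U) α β = 0

/-- `X` is a rest point of the quantum state dynamics: the right-hand side vanishes there and the
flow leaves it fixed. -/
def IsRestPoint (G : QuantumGame ι d Ω) (θ : ι → Kernel) (Φ : ℝ → Profile d → Profile d)
    (X : Profile d) : Prop :=
  QDFieldVanishes G θ X ∧ ∀ t, Φ t X = X

end Dynamics

section Stability

variable {ι : Type*} {d : ι → ℕ}

/-- `X` belongs to the domain of consistency of `P`: `ker X ≤ ker P`. -/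
def Consistent (P X : Profile d) : Prop :=
  X ∈ states d ∧ ∀ i, ∀ v, (X i).mulVec v = 0 → (P i).mulVec v = 0

/-- Lyapunov stability, for a flow on the state space. -/
def LyapunovStable (Φ : ℝ → Profile d → Profile d) (P : Profile d) : Prop :=
  ∀ U ∈ 𝓝 P, ∃ U' ∈ 𝓝 P, ∀ X ∈ U' ∩ states d, ∀ t ≥ 0, Φ t X ∈ U

def ConsistentlyAttracting (Φ : ℝ → Profile d → Profile d) (P : Profile d) : Prop :=
  ∃ U ∈ 𝓝 P, ∀ X ∈ U, Consistent P X → Tendsto (fun t => Φ t X) atTop (𝓝 P)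

def ConsistentlyAsymptoticallyStable (Φ : ℝ → Profile d → Profile d) (P : Profile d) : Prop :=
  LyapunovStable Φ P ∧ ConsistentlyAttracting Φ P

/-- A pure state: every component has rank one. -/
def IsPure (P : Profile d) : Prop := ∀ i, (P i).rank = 1

end Stability

end QGame

/-!
The argument rests on two properties of regularized best responses over a face of the set of density
matrices. By Klein's inequality the regularizer is strongly convex in the Frobenius norm
(`Kernel.klein_le`), so that best responses are unique and Lipschitz in the payoff matrix. By
steepness a best response has the full support of the face, and on the face `Y` agrees with
`θ'(X)` up to a constant (`Kernel.IsBestResponse.firstOrder`); conversely each Hermitian `Y` has such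
a best response. Hence the dynamics are an ordinary differential equation for the payoff matrices
with a bounded Lipschitz right-hand side, which gives existence and uniqueness of orbits, and they
depend on the payoff matrices only modulo functionals that are constant on the face.

*Nash equilibria are rest points*: at an equilibrium `V_i` is constant on the face of the state, since
a linear functional that is maximal at a relatively interior point is constant. *Limits and stable
states are equilibria*: near a state that is not one, some deviation gains at a positive rate, and
the accumulated gain would outgrow the bounded regularizers
(`QuantumGame.exists_nhds_not_trapped`); for stable states one starts at states of full rank.

*Attracting states are pure*: write the dynamics on the face of `P` in terms of payoff matrices modulo
constants on the face. A player's gradient does not depend on the player's own state, so the field is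
a sum of shear fields, one for each player. Shears preserve Lebesgue measure, and the flow is a
uniform limit of compositions of shears (`exists_measurePreserving_approx`), so it cannot contract a
ball to a point (`not_tendsto_of_shear_fields`). Attraction of the states near `P` with the
support of `P` is therefore impossible unless the face of `P` is a single point.

*Variationally stable states*: such a state `P` is a strict equilibrium, hence pure, and `V_i(P)`
prefers it by a gap to all orthogonal pure states. For attraction, the Fenchel coupling with `P` is a
Lyapunov function along consistent orbits. It is of no use for stability, as `P` need not lie in the
face of the initial state `X₀`; the coupling with `X₀` itself is used instead. It grows at a rate of
the order of the distance from `X₀` to `P`, which by strong convexity suffices for bounded times;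
for long times the payoff matrices have acquired a spectral gap proportional to the time elapsed, and
near-optimality for a matrix with a gap forces closeness to its top eigenprojection
(`Kernel.IsBestResponse.norm_sub_sq_le_of_gap`).
-/

open scoped Matrix.Norms.Frobenius

set_option linter.unusedSectionVars false

namespace QGame

/-! ### Spectral calculus for Hermitian matrices -/

section Spectral

variable {m : ℕ}

/-- The trace pairing `re tr(A B)`. It is the real inner product belonging to the Frobenius norm on
Hermitian matrices. -/
noncomputable def pair (A B : Mat m) : ℝ := (A * B).trace.re

theorem pair_comm (A B : Mat m) : pair A B = pair B A := by
  rw [pair, Matrix.trace_mul_comm, pair]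

theorem pair_add_left (A B C : Mat m) : pair (A + B) C = pair A C + pair B C := by
  simp [pair, add_mul, Matrix.trace_add]

theorem pair_sub_left (A B C : Mat m) : pair (A - B) C = pair A C - pair B C := by
  simp [pair, sub_mul, Matrix.trace_sub]

theorem pair_add_right (A B C : Mat m) : pair A (B + C) = pair A B + pair A C := by
  simp [pair, mul_add, Matrix.trace_add]

theorem pair_sub_right (A B C : Mat m) : pair A (B - C) = pair A B - pair A C := by
  simp [pair, mul_sub, Matrix.trace_sub]

theorem pair_smul_left (r : ℝ) (A B : Mat m) : pair (r • A) B = r * pair A B := by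
  simp [pair, Matrix.trace_smul]

theorem pair_smul_right (r : ℝ) (A B : Mat m) : pair A (r • B) = r * pair A B := by
  simp [pair, Matrix.trace_smul]

theorem pair_one_left (A : Mat m) : pair 1 A = A.trace.re := by simp [pair]

theorem norm_sq_eq_sum (A : Mat m) : ‖A‖ ^ 2 = ∑ i, ∑ j, ‖A i j‖ ^ 2 := by
  have h : 0 ≤ ∑ i, ∑ j, ‖A i j‖ ^ 2 := by positivity
  rw [Matrix.frobenius_norm_def, ← Real.sqrt_eq_rpow]
  simpa using Real.sq_sqrt h

theorem norm_sq_eq_pair (A : Mat m) : ‖A‖ ^ 2 = pair A.conjTranspose A := by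
  rw [norm_sq_eq_sum, pair, Matrix.trace, Complex.re_sum, Finset.sum_comm]
  refine Finset.sum_congr rfl fun j _ => ?_
  rw [Matrix.diag_apply, Matrix.mul_apply, Complex.re_sum]
  refine Finset.sum_congr rfl fun i _ => ?_
  rw [Matrix.conjTranspose_apply, Complex.star_def, ← Complex.normSq_eq_conj_mul_self,
    Complex.ofReal_re, Complex.normSq_eq_norm_sq]

theorem norm_sq_of_isHermitian {A : Mat m} (hA : A.IsHermitian) : ‖A‖ ^ 2 = pair A A := by
  rw [norm_sq_eq_pair, hA.eq]

theorem abs_pair_le (A B : Mat m) : |pair A B| ≤ ‖A‖ * ‖B‖ := by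
  have h1 : |pair A B| ≤ ∑ i, ∑ j, ‖A i j‖ * ‖B j i‖ := by
    refine (Complex.abs_re_le_norm _).trans ?_
    rw [Matrix.trace]
    refine (norm_sum_le _ _).trans (Finset.sum_le_sum fun i _ => ?_)
    rw [Matrix.diag_apply, Matrix.mul_apply]
    refine (norm_sum_le _ _).trans (Finset.sum_le_sum fun j _ => ?_)
    rw [norm_mul]
  refine h1.trans ?_
  rw [← Finset.sum_product']
  refine abs_le_of_sq_le_sq' ?_ (by positivity) |>.2
  refine (Finset.sum_mul_sq_le_sq_mul_sq _ _ _).trans ?_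
  rw [mul_pow, norm_sq_eq_sum, norm_sq_eq_sum, ← Finset.sum_product']
  rw [Finset.sum_comm (f := fun i j => ‖B i j‖ ^ 2), ← Finset.sum_product']

/-- The matrix with eigenvalues `x` and with the columns of `U` as eigenvectors. -/
noncomputable def conjDiag (U : Mat m) (x : Fin m → ℝ) : Mat m :=
  U * Matrix.diagonal (fun j => (x j : ℂ)) * U.conjTranspose

/-- The squared overlaps of the columns of `W` and `U`. -/
noncomputable def overlap (W U : Mat m) (k j : Fin m) : ℝ := ‖(W.conjTranspose * U) k j‖ ^ 2

theorem conjTranspose_mul_self_of_unitary {U : Mat m} (hU : U ∈ Matrix.unitaryGroup (Fin m) ℂ) :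
    U.conjTranspose * U = 1 := Matrix.mem_unitaryGroup_iff'.1 hU

theorem self_mul_conjTranspose_of_unitary {U : Mat m} (hU : U ∈ Matrix.unitaryGroup (Fin m) ℂ) :
    U * U.conjTranspose = 1 := Matrix.mem_unitaryGroup_iff.1 hU

theorem conjTranspose_mem_unitaryGroup {U : Mat m} (hU : U ∈ Matrix.unitaryGroup (Fin m) ℂ) :
    U.conjTranspose ∈ Matrix.unitaryGroup (Fin m) ℂ := by
  rw [Matrix.mem_unitaryGroup_iff, Matrix.star_eq_conjTranspose,
    Matrix.conjTranspose_conjTranspose]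
  exact conjTranspose_mul_self_of_unitary hU

theorem isHermitian_conjDiag (U : Mat m) (x : Fin m → ℝ) : (conjDiag U x).IsHermitian := by
  have h : (Matrix.diagonal (fun j => (x j : ℂ))).IsHermitian := by
    rw [Matrix.isHermitian_diagonal_iff]
    intro i
    simp [isSelfAdjoint_iff]
  rw [Matrix.IsHermitian, conjDiag, Matrix.conjTranspose_mul, Matrix.conjTranspose_mul,
    Matrix.conjTranspose_conjTranspose, h.eq, mul_assoc]

theorem exists_conjDiag {A : Mat m} (hA : A.IsHermitian) :
    ∃ U ∈ Matrix.unitaryGroup (Fin m) ℂ, ∃ x : Fin m → ℝ, A = conjDiag U x := by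
  refine ⟨hA.eigenvectorUnitary, hA.eigenvectorUnitary.2, hA.eigenvalues, ?_⟩
  conv_lhs => rw [hA.spectral_theorem]
  rfl

theorem conjDiag_apply (U : Mat m) (x : Fin m → ℝ) (a b : Fin m) :
    conjDiag U x a b = ∑ j, (x j : ℂ) * (U a j * star (U b j)) := by
  rw [conjDiag, Matrix.mul_apply]
  refine Finset.sum_congr rfl fun j _ => ?_
  rw [Matrix.mul_diagonal, Matrix.conjTranspose_apply]
  ring

theorem conjDiag_add (U : Mat m) (x y : Fin m → ℝ) :
    conjDiag U (x + y) = conjDiag U x + conjDiag U y := by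
  ext a b
  simp only [Matrix.add_apply, conjDiag_apply, ← Finset.sum_add_distrib, Pi.add_apply]
  exact Finset.sum_congr rfl fun j _ => by push_cast; ring

theorem conjDiag_mul {U : Mat m} (hU : U ∈ Matrix.unitaryGroup (Fin m) ℂ) (x y : Fin m → ℝ) :
    conjDiag U x * conjDiag U y = conjDiag U (x * y) := by
  have h : (conjDiag U x * conjDiag U y) =
      U * (Matrix.diagonal (fun j => (x j : ℂ)) * (U.conjTranspose * U) *
        Matrix.diagonal (fun j => (y j : ℂ))) * U.conjTranspose := by
    simp only [conjDiag, mul_assoc]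
  rw [h, conjTranspose_mul_self_of_unitary hU, mul_one, Matrix.diagonal_mul_diagonal, conjDiag]
  congr 3
  ext j
  simp

theorem conjDiag_one {U : Mat m} (hU : U ∈ Matrix.unitaryGroup (Fin m) ℂ) :
    conjDiag U (fun _ => 1) = 1 := by
  simp [conjDiag, self_mul_conjTranspose_of_unitary hU]

theorem pair_conjDiag (U : Mat m) (a : Fin m → ℝ) (Z : Mat m) :
    pair (conjDiag U a) Z = ∑ j, a j * ((U.conjTranspose * Z * U) j j).re := by
  rw [pair, conjDiag, mul_assoc, mul_assoc, Matrix.trace_mul_comm, mul_assoc, Matrix.trace,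
    Complex.re_sum]
  refine Finset.sum_congr rfl fun j _ => ?_
  rw [Matrix.diag_apply, Matrix.diagonal_mul, Complex.re_ofReal_mul]

theorem diag_conjDiag (U W : Mat m) (z : Fin m → ℝ) (j : Fin m) :
    ((U.conjTranspose * conjDiag W z * U) j j) = ((∑ k, z k * overlap W U k j : ℝ) : ℂ) := by
  have h : U.conjTranspose * conjDiag W z * U =
      (W.conjTranspose * U).conjTranspose * Matrix.diagonal (fun j => (z j : ℂ)) *
        (W.conjTranspose * U) := by
    simp only [conjDiag, Matrix.conjTranspose_mul, Matrix.conjTranspose_conjTranspose, mul_assoc]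
  rw [h, Matrix.mul_apply, Complex.ofReal_sum]
  refine Finset.sum_congr rfl fun k _ => ?_
  rw [Matrix.mul_diagonal, Matrix.conjTranspose_apply, overlap, ← Complex.normSq_eq_norm_sq,
    Complex.ofReal_mul, Complex.normSq_eq_conj_mul_self, Complex.star_def]
  ring

theorem pair_conjDiag_conjDiag (U W : Mat m) (a z : Fin m → ℝ) :
    pair (conjDiag U a) (conjDiag W z) = ∑ j, ∑ k, overlap W U k j * (a j * z k) := by
  rw [pair_conjDiag]
  refine Finset.sum_congr rfl fun j _ => ?_
  rw [diag_conjDiag, Complex.ofReal_re, Finset.mul_sum]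
  exact Finset.sum_congr rfl fun k _ => by ring

theorem overlap_nonneg (W U : Mat m) (k j : Fin m) : 0 ≤ overlap W U k j := by
  unfold overlap; positivity

theorem sum_norm_sq_col {U : Mat m} (hU : U ∈ Matrix.unitaryGroup (Fin m) ℂ) (j : Fin m) :
    ∑ k, ‖U k j‖ ^ 2 = 1 := by
  have h := congrFun (congrFun (conjTranspose_mul_self_of_unitary hU) j) j
  rw [Matrix.mul_apply, Matrix.one_apply_eq] at h
  have h' := congrArg Complex.re h
  rw [Complex.re_sum, Complex.one_re] at h'
  rw [← h']
  refine Finset.sum_congr rfl fun i _ => ?_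
  rw [Matrix.conjTranspose_apply, Complex.star_def, ← Complex.normSq_eq_conj_mul_self,
    Complex.ofReal_re, Complex.normSq_eq_norm_sq]

theorem sum_overlap_left {W U : Mat m} (hW : W ∈ Matrix.unitaryGroup (Fin m) ℂ)
    (hU : U ∈ Matrix.unitaryGroup (Fin m) ℂ) (j : Fin m) : ∑ k, overlap W U k j = 1 :=
  sum_norm_sq_col (mul_mem (conjTranspose_mem_unitaryGroup hW) hU) j

theorem overlap_comm (W U : Mat m) (k j : Fin m) : overlap W U k j = overlap U W j k := by
  have h : (W.conjTranspose * U) k j = star ((U.conjTranspose * W) j k) := by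
    rw [← Matrix.conjTranspose_apply, Matrix.conjTranspose_mul, Matrix.conjTranspose_conjTranspose]
  rw [overlap, h, norm_star, overlap]

theorem sum_overlap_right {W U : Mat m} (hW : W ∈ Matrix.unitaryGroup (Fin m) ℂ)
    (hU : U ∈ Matrix.unitaryGroup (Fin m) ℂ) (k : Fin m) : ∑ j, overlap W U k j = 1 := by
  simp only [overlap_comm W U k]
  exact sum_overlap_left hU hW k

theorem trace_conjDiag {U : Mat m} (hU : U ∈ Matrix.unitaryGroup (Fin m) ℂ) (x : Fin m → ℝ) :
    (conjDiag U x).trace = ((∑ j, x j : ℝ) : ℂ) := by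
  rw [conjDiag, Matrix.trace_mul_comm, ← mul_assoc, conjTranspose_mul_self_of_unitary hU, one_mul,
    Matrix.trace_diagonal, Complex.ofReal_sum]

theorem conjDiag_diag_self {U : Mat m} (hU : U ∈ Matrix.unitaryGroup (Fin m) ℂ) (x : Fin m → ℝ) :
    U.conjTranspose * conjDiag U x * U = Matrix.diagonal (fun j => (x j : ℂ)) := by
  have h : U.conjTranspose * conjDiag U x * U =
      (U.conjTranspose * U) * Matrix.diagonal (fun j => (x j : ℂ)) * (U.conjTranspose * U) := by
    simp only [conjDiag, mul_assoc]
  rw [h, conjTranspose_mul_self_of_unitary hU, one_mul, mul_one]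

theorem posSemidef_conjDiag_iff {U : Mat m} (hU : U ∈ Matrix.unitaryGroup (Fin m) ℂ)
    (x : Fin m → ℝ) : (conjDiag U x).PosSemidef ↔ ∀ j, 0 ≤ x j := by
  constructor
  · intro h j
    have h1 := h.conjTranspose_mul_mul_same U
    rw [conjDiag_diag_self hU, Matrix.posSemidef_diagonal_iff] at h1
    exact_mod_cast h1 j
  · intro h
    refine Matrix.PosSemidef.mul_mul_conjTranspose_same ?_ U
    rw [Matrix.posSemidef_diagonal_iff]
    exact fun j => by exact_mod_cast h j

theorem conjDiag_mulVec_eq_zero_iff {U : Mat m} (hU : U ∈ Matrix.unitaryGroup (Fin m) ℂ)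
    (x : Fin m → ℝ) (v : Fin m → ℂ) :
    (conjDiag U x).mulVec v = 0 ↔ ∀ j, x j = 0 ∨ U.conjTranspose.mulVec v j = 0 := by
  have h : (conjDiag U x).mulVec v =
      U.mulVec ((Matrix.diagonal (fun j => (x j : ℂ))).mulVec (U.conjTranspose.mulVec v)) := by
    simp only [conjDiag, Matrix.mulVec_mulVec, mul_assoc]
  rw [h]
  constructor
  · intro h0 j
    have h1 := congrArg U.conjTranspose.mulVec h0
    rw [Matrix.mulVec_mulVec, conjTranspose_mul_self_of_unitary hU, Matrix.one_mulVec,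
      Matrix.mulVec_zero] at h1
    have h2 := congrFun h1 j
    rw [Matrix.mulVec_diagonal] at h2
    simpa using h2
  · intro h0
    have : (Matrix.diagonal (fun j => (x j : ℂ))).mulVec (U.conjTranspose.mulVec v) = 0 := by
      ext j
      rw [Matrix.mulVec_diagonal]
      rcases h0 j with h1 | h1 <;> simp [h1]
    rw [this, Matrix.mulVec_zero]

/-- If two diagonalizations present the same matrix, then a nonzero overlap forces equal
eigenvalues, so any function of the eigenvalues gives the same matrix again. -/
theorem conjDiag_comp_eq {U W : Mat m} (hU : U ∈ Matrix.unitaryGroup (Fin m) ℂ)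
    (hW : W ∈ Matrix.unitaryGroup (Fin m) ℂ) {x z : Fin m → ℝ}
    (h : conjDiag W z = conjDiag U x) (f : ℝ → ℝ) : conjDiag W (f ∘ z) = conjDiag U (f ∘ x) := by
  have key : ∀ a b : Fin m → ℝ, conjDiag W a = conjDiag U b ↔
      Matrix.diagonal (fun j => (a j : ℂ)) * (W.conjTranspose * U) =
        (W.conjTranspose * U) * Matrix.diagonal (fun j => (b j : ℂ)) := by
    intro a b
    constructor
    · intro h
      have h1 : W.conjTranspose * conjDiag W a * U = W.conjTranspose * conjDiag U b * U := by rw [h]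
      have e1 : W.conjTranspose * conjDiag W a * U = (W.conjTranspose * W) *
          Matrix.diagonal (fun j => (a j : ℂ)) * (W.conjTranspose * U) := by
        simp only [conjDiag, mul_assoc]
      have e2 : W.conjTranspose * conjDiag U b * U = (W.conjTranspose * U) *
          Matrix.diagonal (fun j => (b j : ℂ)) * (U.conjTranspose * U) := by
        simp only [conjDiag, mul_assoc]
      rw [e1, e2, conjTranspose_mul_self_of_unitary hW, conjTranspose_mul_self_of_unitary hU,
        one_mul, mul_one] at h1
      exact h1
    · intro h
      have e1 : conjDiag W a = W * (Matrix.diagonal (fun j => (a j : ℂ)) *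
          (W.conjTranspose * U)) * U.conjTranspose := by
        simp only [conjDiag, mul_assoc, self_mul_conjTranspose_of_unitary hU, mul_one]
      rw [e1, h]
      simp only [conjDiag, ← mul_assoc, self_mul_conjTranspose_of_unitary hW, one_mul]
  rw [key] at h ⊢
  ext k j
  have h1 := congrFun (congrFun h k) j
  rw [Matrix.diagonal_mul, Matrix.mul_diagonal] at h1 ⊢
  by_cases h0 : (W.conjTranspose * U) k j = 0
  · simp [h0]
  · have h2 : (z k : ℂ) = x j := by
      rw [mul_comm] at h1
      exact mul_left_cancel₀ h0 h1
    have h3 : z k = x j := by exact_mod_cast h2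
    simp [h3, mul_comm]

theorem cfc_conjDiag {U : Mat m} (hU : U ∈ Matrix.unitaryGroup (Fin m) ℂ) (x : Fin m → ℝ)
    (f : ℝ → ℝ) : cfc f (conjDiag U x) = conjDiag U (f ∘ x) := by
  have hA := isHermitian_conjDiag U x
  have e : conjDiag hA.eigenvectorUnitary hA.eigenvalues = conjDiag U x := by
    conv_rhs => rw [hA.spectral_theorem]
    rfl
  rw [hA.cfc_eq, ← conjDiag_comp_eq hU hA.eigenvectorUnitary.2 e f]
  rfl

end Spectral

/-! ### Regularizer kernels -/

namespace Kernel

variable (θ : Kernel)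

/-- A positive lower bound of `θ''`. -/
noncomputable def modulus : ℝ := θ.inf_d2_pos.choose

theorem modulus_pos : 0 < θ.modulus := θ.inf_d2_pos.choose_spec.1

theorem modulus_le {x : ℝ} (hx : x ∈ Set.Ioc (0 : ℝ) 1) : θ.modulus ≤ θ.d2 x :=
  θ.inf_d2_pos.choose_spec.2 x hx

theorem d1_continuousOn : ContinuousOn θ.d1 (Set.Ioc 0 1) := fun x hx =>
  (θ.hasDeriv2 x hx).continuousWithinAt

theorem modulus_mul_le_d1_sub {a b : ℝ} (ha : 0 < a) (hab : a ≤ b) (hb : b ≤ 1) :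
    θ.modulus * (b - a) ≤ θ.d1 b - θ.d1 a := by
  have hmono : MonotoneOn (fun x => θ.d1 x - θ.modulus * x) (Set.Ioc 0 1) := by
    refine monotoneOn_of_hasDerivWithinAt_nonneg (f' := fun x => θ.d2 x - θ.modulus)
      (convex_Ioc 0 1) (θ.d1_continuousOn.sub (by fun_prop)) ?_ ?_
    · intro x hx
      have hx' := interior_subset hx
      have := ((θ.hasDeriv2 x hx').sub ((hasDerivWithinAt_id x _).const_mul θ.modulus)).mono
        (interior_subset (s := Set.Ioc (0 : ℝ) 1))
      exact this.congr_deriv (by rw [mul_one])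
    · intro x hx
      exact sub_nonneg.2 (θ.modulus_le (interior_subset hx))
  have := hmono ⟨ha, hab.trans hb⟩ ⟨ha.trans_le hab, hb⟩ hab
  simp only at this
  linarith

theorem d1_strictMonoOn : StrictMonoOn θ.d1 (Set.Ioc 0 1) := fun a ha b hb hab => by
  have := θ.modulus_mul_le_d1_sub ha.1 hab.le hb.2
  have := mul_pos θ.modulus_pos (sub_pos.2 hab)
  linarith

/-- The tangent inequality for the strongly convex function `θ`. -/
theorem tangent_le {a b : ℝ} (ha : a ∈ Set.Icc (0 : ℝ) 1) (hb : b ∈ Set.Ioc (0 : ℝ) 1) :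
    θ.modulus / 2 * (a - b) ^ 2 ≤ θ.toFun a - θ.toFun b - θ.d1 b * (a - b) := by
  set φ : ℝ → ℝ := fun x => θ.toFun x - θ.d1 b * x - θ.modulus / 2 * (x - b) ^ 2 with hφ
  have hder : ∀ x ∈ Set.Ioo (0 : ℝ) 1,
      HasDerivAt φ (θ.d1 x - θ.d1 b - θ.modulus * (x - b)) x := by
    intro x hx
    have h1 := (θ.hasDeriv1 x ⟨hx.1, hx.2.le⟩).hasDerivAt (Ioc_mem_nhds hx.1 hx.2)
    have h2 := ((hasDerivAt_id x).sub_const b).pow 2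
    have h3 := (h1.sub ((hasDerivAt_id x).const_mul (θ.d1 b))).sub (h2.const_mul (θ.modulus / 2))
    refine h3.congr_deriv ?_
    simp
    ring
  have hcont : ContinuousOn φ (Set.Icc 0 1) :=
    (θ.continuousOn.sub (by fun_prop)).sub (by fun_prop)
  suffices h : φ b ≤ φ a by
    simp only [hφ, sub_self] at h
    linarith
  rcases le_total a b with hab | hab
  · have hanti : AntitoneOn φ (Set.Icc 0 b) := by
      refine antitoneOn_of_hasDerivWithinAt_nonpos
        (f' := fun x => θ.d1 x - θ.d1 b - θ.modulus * (x - b))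
        (convex_Icc 0 b) (hcont.mono (Set.Icc_subset_Icc_right hb.2)) ?_ ?_
      · intro x hx
        rw [interior_Icc] at hx
        exact (hder x ⟨hx.1, hx.2.trans_le hb.2⟩).hasDerivWithinAt
      · intro x hx
        rw [interior_Icc] at hx
        have := θ.modulus_mul_le_d1_sub hx.1 hx.2.le hb.2
        linarith
    exact hanti ⟨ha.1, hab⟩ ⟨hb.1.le, le_rfl⟩ hab
  · have hmono : MonotoneOn φ (Set.Icc b 1) := by
      refine monotoneOn_of_hasDerivWithinAt_nonneg
        (f' := fun x => θ.d1 x - θ.d1 b - θ.modulus * (x - b))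
        (convex_Icc b 1) (hcont.mono (Set.Icc_subset_Icc_left hb.1.le)) ?_ ?_
      · intro x hx
        rw [interior_Icc] at hx
        exact (hder x ⟨hb.1.trans hx.1, hx.2⟩).hasDerivWithinAt
      · intro x hx
        rw [interior_Icc] at hx
        have := θ.modulus_mul_le_d1_sub hb.1 hx.1.le hx.2.le
        linarith
    exact hmono ⟨le_rfl, hb.2⟩ ⟨hab, ha.2⟩ hab

theorem exists_bound : ∃ M, 0 ≤ M ∧ ∀ x ∈ Set.Icc (0 : ℝ) 1, |θ.toFun x| ≤ M := by
  obtain ⟨M, hM⟩ := isCompact_Icc.exists_bound_of_continuousOn θ.continuousOn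
  exact ⟨|M|, abs_nonneg M, fun x hx => (hM x hx).trans (le_abs_self M)⟩

/-- For a steep kernel `θ'` maps `(0, 1]` onto `(-∞, θ'(1)]`; by strong convexity the inverse is
Lipschitz, hence extends continuously to the line. -/
theorem Steep.exists_inverse {θ : Kernel} (hθ : θ.Steep) :
    ∃ g : ℝ → ℝ, Continuous g ∧ ∀ y ≤ θ.d1 1, g y ∈ Set.Ioc (0 : ℝ) 1 ∧ θ.d1 (g y) = y := by
  have hsurj : ∀ y : ℝ, ∃ x ∈ Set.Ioc (0 : ℝ) 1, θ.d1 x = min y (θ.d1 1) := by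
    intro y
    have h1 : ∀ᶠ x in 𝓝[>] (0 : ℝ), θ.d1 x ≤ min y (θ.d1 1) :=
      hθ.eventually (eventually_le_atBot _)
    have h2 : ∀ᶠ x in 𝓝[>] (0 : ℝ), x ∈ Set.Ioc (0 : ℝ) 1 := Ioc_mem_nhdsGT one_pos
    obtain ⟨x₀, hx₀, hx₀'⟩ := (h1.and h2).exists
    have hsub : Set.Icc x₀ 1 ⊆ Set.Ioc (0 : ℝ) 1 := fun x hx => ⟨hx₀'.1.trans_le hx.1, hx.2⟩
    obtain ⟨x, hx, hxy⟩ := intermediate_value_Icc hx₀'.2 (θ.d1_continuousOn.mono hsub)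
      ⟨hx₀, min_le_right _ _⟩
    exact ⟨x, hsub hx, hxy⟩
  choose g hg hgd using hsurj
  refine ⟨g, ?_, fun y hy => ⟨hg y, by rw [hgd, min_eq_left hy]⟩⟩
  have hle : ∀ y z, g y ≤ g z → dist (g y) (g z) ≤ θ.modulus⁻¹ * dist y z := by
    intro y z hyz
    have h := θ.modulus_mul_le_d1_sub (hg y).1 hyz (hg z).2
    rw [hgd, hgd] at h
    have h2 : min z (θ.d1 1) - min y (θ.d1 1) ≤ dist y z := by
      have := abs_min_sub_min_le_max z (θ.d1 1) y (θ.d1 1)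
      rw [sub_self, abs_zero, max_eq_left (abs_nonneg _)] at this
      rw [dist_comm, Real.dist_eq]
      exact (le_abs_self _).trans this
    rw [dist_comm (g y), Real.dist_eq, abs_of_nonneg (sub_nonneg.2 hyz), inv_mul_eq_div,
      le_div_iff₀ θ.modulus_pos]
    linarith
  refine (LipschitzWith.of_dist_le_mul (K := (θ.modulus⁻¹).toNNReal) fun y z => ?_).continuous
  rw [Real.coe_toNNReal _ (inv_nonneg.2 θ.modulus_pos.le)]
  rcases le_total (g y) (g z) with h | h
  · exact hle y z h
  · rw [dist_comm, dist_comm y]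
    exact hle z y h

end Kernel

/-! ### Density matrices and faces -/

section Faces

variable {m : ℕ}

theorem exists_conjDiag_of_mem_densities {X : Mat m} (hX : X ∈ densities m) :
    ∃ U ∈ Matrix.unitaryGroup (Fin m) ℂ, ∃ x : Fin m → ℝ,
      X = conjDiag U x ∧ (∀ j, 0 ≤ x j) ∧ ∑ j, x j = 1 := by
  obtain ⟨U, hU, x, rfl⟩ := exists_conjDiag hX.1.isHermitian
  refine ⟨U, hU, x, rfl, (posSemidef_conjDiag_iff hU x).1 hX.1, ?_⟩
  have := hX.2
  rw [trace_conjDiag hU] at this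
  exact_mod_cast this

theorem conjDiag_mem_densities {U : Mat m} (hU : U ∈ Matrix.unitaryGroup (Fin m) ℂ)
    {x : Fin m → ℝ} (h0 : ∀ j, 0 ≤ x j) (h1 : ∑ j, x j = 1) : conjDiag U x ∈ densities m :=
  ⟨(posSemidef_conjDiag_iff hU x).2 h0, by rw [trace_conjDiag hU, h1, Complex.ofReal_one]⟩

theorem le_one_of_sum_eq_one {x : Fin m → ℝ} (h0 : ∀ j, 0 ≤ x j) (h1 : ∑ j, x j = 1) (j : Fin m) :
    x j ≤ 1 := h1 ▸ Finset.single_le_sum (fun i _ => h0 i) (Finset.mem_univ j)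

theorem pair_one_of_mem_densities {X : Mat m} (hX : X ∈ densities m) : pair 1 X = 1 := by
  rw [pair_one_left, hX.2, Complex.one_re]

theorem norm_le_one_of_mem_densities {X : Mat m} (hX : X ∈ densities m) : ‖X‖ ≤ 1 := by
  obtain ⟨U, hU, x, rfl, h0, h1⟩ := exists_conjDiag_of_mem_densities hX
  have h : ‖conjDiag U x‖ ^ 2 ≤ 1 := by
    rw [norm_sq_of_isHermitian (isHermitian_conjDiag U x), pair, conjDiag_mul hU,
      trace_conjDiag hU, Complex.ofReal_re, ← h1]
    exact Finset.sum_le_sum fun j _ => by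
      simpa using mul_le_of_le_one_left (h0 j) (le_one_of_sum_eq_one h0 h1 j)
  exact (sq_le_one_iff₀ (norm_nonneg _)).1 h

theorem convex_densities : Convex ℝ (densities m) := by
  intro X hX Y hY a b ha hb hab
  refine ⟨?_, ?_⟩
  · exact (hX.1.smul ha).add (hY.1.smul hb)
  · rw [Matrix.trace_add, Matrix.trace_smul, Matrix.trace_smul, hX.2, hY.2]
    simp only [Complex.real_smul, mul_one]
    exact_mod_cast hab

theorem self_mem_face {X : Mat m} (hX : X ∈ densities m) : X ∈ face X := ⟨hX, fun _ h => h⟩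

theorem face_trans {X₀ X Z : Mat m} (hZ : Z ∈ face X) (hX : X ∈ face X₀) : Z ∈ face X₀ :=
  ⟨hZ.1, fun v hv => hZ.2 v (hX.2 v hv)⟩

theorem face_eq_of_mem {X₀ X : Mat m} (h : X ∈ face X₀) (h' : X₀ ∈ face X) : face X = face X₀ :=
  Set.Subset.antisymm (fun _ hZ => face_trans hZ h) fun _ hZ => face_trans hZ h'

/-- The orthogonal projection onto the range of a Hermitian matrix. -/
noncomputable def suppProj (X : Mat m) : Mat m := cfc (fun t : ℝ => if t = 0 then 0 else 1) X

theorem suppProj_conjDiag {U : Mat m} (hU : U ∈ Matrix.unitaryGroup (Fin m) ℂ) (x : Fin m → ℝ) :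
    suppProj (conjDiag U x) = conjDiag U fun j => if x j = 0 then 0 else 1 :=
  cfc_conjDiag hU x _

theorem suppProj_isHermitian {X : Mat m} (hX : X.IsHermitian) : (suppProj X).IsHermitian := by
  obtain ⟨U, hU, x, rfl⟩ := exists_conjDiag hX
  rw [suppProj_conjDiag hU]
  exact isHermitian_conjDiag _ _

theorem suppProj_mul_self {X : Mat m} (hX : X.IsHermitian) :
    suppProj X * suppProj X = suppProj X := by
  obtain ⟨U, hU, x, rfl⟩ := exists_conjDiag hX
  rw [suppProj_conjDiag hU, conjDiag_mul hU]
  congr 1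
  ext j
  simp

theorem suppProj_mulVec_eq_zero_iff {X : Mat m} (hX : X.IsHermitian) (v : Fin m → ℂ) :
    (suppProj X).mulVec v = 0 ↔ X.mulVec v = 0 := by
  obtain ⟨U, hU, x, rfl⟩ := exists_conjDiag hX
  rw [suppProj_conjDiag hU, conjDiag_mulVec_eq_zero_iff hU, conjDiag_mulVec_eq_zero_iff hU]
  simp

theorem mul_suppProj {X A : Mat m} (hX : X.IsHermitian)
    (hA : ∀ v, X.mulVec v = 0 → A.mulVec v = 0) : A * suppProj X = A := by
  refine Matrix.toLin'.injective (LinearMap.ext fun v => ?_)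
  rw [Matrix.toLin'_apply, Matrix.toLin'_apply, ← sub_eq_zero, ← Matrix.mulVec_mulVec,
    ← Matrix.mulVec_sub]
  refine hA _ ((suppProj_mulVec_eq_zero_iff hX _).1 ?_)
  rw [Matrix.mulVec_sub, Matrix.mulVec_mulVec, suppProj_mul_self hX, sub_self]

theorem suppProj_mul {X A : Mat m} (hX : X.IsHermitian) (hAh : A.IsHermitian)
    (hA : ∀ v, X.mulVec v = 0 → A.mulVec v = 0) : suppProj X * A = A := by
  have h := congrArg Matrix.conjTranspose (mul_suppProj hX hA)
  rwa [Matrix.conjTranspose_mul, hAh.eq, (suppProj_isHermitian hX).eq] at h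

theorem face_col_eq_zero {U : Mat m} (hU : U ∈ Matrix.unitaryGroup (Fin m) ℂ) {x : Fin m → ℝ}
    {Z : Mat m} (hZ : Z ∈ face (conjDiag U x)) {j : Fin m} (hj : x j = 0) (a : Fin m) :
    (U.conjTranspose * Z * U) a j = 0 := by
  have h1 : (conjDiag U x).mulVec (U.mulVec (Pi.single j 1)) = 0 := by
    rw [conjDiag_mulVec_eq_zero_iff hU]
    intro k
    rw [Matrix.mulVec_mulVec, conjTranspose_mul_self_of_unitary hU, Matrix.one_mulVec]
    rcases eq_or_ne k j with rfl | hk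
    · exact Or.inl hj
    · exact Or.inr (by simp [hk])
  have h2 := congrArg U.conjTranspose.mulVec (hZ.2 _ h1)
  rw [Matrix.mulVec_mulVec, Matrix.mulVec_mulVec, Matrix.mulVec_zero] at h2
  have h3 := congrFun h2 a
  simpa using h3

end Faces

/-! ### Klein's inequality and regularized best responses -/

section BestResponse

variable {m : ℕ} (θ : Kernel)

theorem Kernel.reg_conjDiag {U : Mat m} (hU : U ∈ Matrix.unitaryGroup (Fin m) ℂ)
    (x : Fin m → ℝ) : θ.reg (conjDiag U x) = ∑ j, θ.toFun (x j) := by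
  rw [Kernel.reg, cfc_conjDiag hU, trace_conjDiag hU, Complex.ofReal_re]
  rfl

theorem Kernel.exists_reg_bound (m : ℕ) :
    ∃ M, 0 ≤ M ∧ ∀ X ∈ densities m, |θ.reg X| ≤ M := by
  obtain ⟨M, hM0, hM⟩ := θ.exists_bound
  refine ⟨m * M, by positivity, fun X hX => ?_⟩
  obtain ⟨U, hU, x, rfl, h0, h1⟩ := exists_conjDiag_of_mem_densities hX
  rw [θ.reg_conjDiag hU]
  refine (Finset.abs_sum_le_sum_abs _ _).trans ?_
  refine (Finset.sum_le_sum fun j _ => hM (x j) ⟨h0 j, le_one_of_sum_eq_one h0 h1 j⟩).trans ?_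
  simp

/-- The Bregman divergence of the regularizer, based at `X`, dominates the squared distance. In
eigenbases of `Z` and `X` it is the average of the scalar tangent defects of `θ`, weighted by the
overlaps of the eigenvectors. -/
theorem Kernel.klein_le {X Z : Mat m} (hX : X ∈ densities m) (hZ : Z ∈ face X) :
    θ.modulus / 2 * ‖Z - X‖ ^ 2 ≤ θ.reg Z - θ.reg X - pair (cfc θ.d1 X) (Z - X) := by
  obtain ⟨U, hU, x, rfl, hx0, hx1⟩ := exists_conjDiag_of_mem_densities hX
  obtain ⟨W, hW, z, rfl, hz0, hz1⟩ := exists_conjDiag_of_mem_densities hZ.1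
  have hzero : ∀ j, x j = 0 → ∀ k, z k * overlap W U k j = 0 := by
    intro j hj
    have h1 := face_col_eq_zero hU hZ hj j
    rw [diag_conjDiag] at h1
    have h2 : ∑ k, z k * overlap W U k j = 0 := by exact_mod_cast h1
    have h3 := (Finset.sum_eq_zero_iff_of_nonneg
      fun k _ => mul_nonneg (hz0 k) (overlap_nonneg W U k j)).1 h2
    exact fun k => h3 k (Finset.mem_univ k)
  have hsumz : ∀ f : ℝ → ℝ, ∑ k, f (z k) = ∑ j, ∑ k, overlap W U k j * f (z k) := by
    intro f
    rw [Finset.sum_comm]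
    refine Finset.sum_congr rfl fun k _ => ?_
    rw [← Finset.sum_mul, sum_overlap_right hW hU, one_mul]
  have hsumx : ∀ f : ℝ → ℝ, ∑ j, f (x j) = ∑ j, ∑ k, overlap W U k j * f (x j) := by
    intro f
    refine Finset.sum_congr rfl fun j _ => ?_
    rw [← Finset.sum_mul, sum_overlap_left hW hU, one_mul]
  have hpairself : ∀ (V : Mat m) (_ : V ∈ Matrix.unitaryGroup (Fin m) ℂ) (a b : Fin m → ℝ),
      pair (conjDiag V a) (conjDiag V b) = ∑ j, a j * b j := by
    intro V hV a b
    rw [pair, conjDiag_mul hV, trace_conjDiag hV, Complex.ofReal_re]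
    rfl
  have hnorm : ‖conjDiag W z - conjDiag U x‖ ^ 2 =
      ∑ j, ∑ k, overlap W U k j * (z k - x j) ^ 2 := by
    rw [norm_sq_of_isHermitian ((isHermitian_conjDiag W z).sub (isHermitian_conjDiag U x)),
      pair_sub_left, pair_sub_right, pair_sub_right, hpairself W hW, hpairself U hU,
      pair_comm (conjDiag W z) (conjDiag U x), pair_conjDiag_conjDiag,
      hsumz (fun t => t * t), hsumx (fun t => t * t)]
    simp only [← Finset.sum_sub_distrib]
    exact Finset.sum_congr rfl fun j _ => Finset.sum_congr rfl fun k _ => by ring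
  have hrhs : θ.reg (conjDiag W z) - θ.reg (conjDiag U x) -
      pair (cfc θ.d1 (conjDiag U x)) (conjDiag W z - conjDiag U x) =
      ∑ j, ∑ k, overlap W U k j *
        (θ.toFun (z k) - θ.toFun (x j) - θ.d1 (x j) * (z k - x j)) := by
    rw [θ.reg_conjDiag hW, θ.reg_conjDiag hU, cfc_conjDiag hU, pair_sub_right, hpairself U hU,
      pair_conjDiag_conjDiag, hsumz, hsumx]
    simp only [Function.comp_apply]
    rw [hsumx (fun t => θ.d1 t * t)]
    simp only [← Finset.sum_sub_distrib]
    exact Finset.sum_congr rfl fun j _ => Finset.sum_congr rfl fun k _ => by ring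
  rw [hnorm, hrhs, Finset.mul_sum]
  refine Finset.sum_le_sum fun j _ => ?_
  rw [Finset.mul_sum]
  refine Finset.sum_le_sum fun k _ => ?_
  have hzk : z k ∈ Set.Icc (0 : ℝ) 1 := ⟨hz0 k, le_one_of_sum_eq_one hz0 hz1 k⟩
  -- At a zero eigenvalue of `X` there is no tangent and `θ.d1` is a junk value, but there `Z` has
  -- no weight either.
  rcases eq_or_ne (x j) 0 with hj | hj
  · rcases mul_eq_zero.1 (hzero j hj k) with h | h
    · simp [h, hj]
    · simp [h]
  · have h := θ.tangent_le hzk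
      ⟨lt_of_le_of_ne (hx0 j) (Ne.symm hj), le_one_of_sum_eq_one hx0 hx1 j⟩
    calc _ = overlap W U k j * (θ.modulus / 2 * (z k - x j) ^ 2) := by ring
      _ ≤ _ := mul_le_mul_of_nonneg_left h (overlap_nonneg W U k j)

end BestResponse

section BestResponse

variable {m : ℕ} {θ : Kernel}

/-- Some real number is not an eigenvalue of a given Hermitian matrix. -/
theorem exists_forall_mulVec_eq_smul {A : Mat m} (hA : A.IsHermitian) :
    ∃ K : ℝ, ∀ v : Fin m → ℂ, A.mulVec v = (K : ℂ) • v → v = 0 := by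
  obtain ⟨U, hU, a, rfl⟩ := exists_conjDiag hA
  obtain ⟨K, hK⟩ := (Set.finite_range a).infinite_compl.nonempty
  refine ⟨K, fun v hv => ?_⟩
  have h1 : (conjDiag U (a + fun _ => -K)).mulVec v = 0 := by
    have e : conjDiag U (fun _ => -K) = (-(K : ℂ)) • (1 : Mat m) := by
      rw [← self_mul_conjTranspose_of_unitary hU, conjDiag]
      ext i j
      simp [Matrix.mul_apply, Matrix.diagonal_apply, Finset.mul_sum, mul_left_comm, mul_assoc]
    rw [conjDiag_add, Matrix.add_mulVec, hv, e, Matrix.smul_mulVec, Matrix.one_mulVec, neg_smul,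
      add_neg_cancel]
  rw [conjDiag_mulVec_eq_zero_iff hU] at h1
  have h2 : (conjDiag U fun _ => 1).mulVec v = 0 := by
    rw [conjDiag_mulVec_eq_zero_iff hU]
    intro j
    rcases h1 j with h | h
    · exact absurd ⟨j, by simpa [add_neg_eq_zero] using h⟩ hK
    · exact Or.inr h
  rwa [conjDiag_one hU, Matrix.one_mulVec] at h2

/-- A Hermitian matrix, compressed to the range of another one, is diagonalized in a basis adapted
to that range. -/
theorem exists_adapted_conjDiag {X Y : Mat m} (hX : X.IsHermitian) (hY : Y.IsHermitian) :
    ∃ U ∈ Matrix.unitaryGroup (Fin m) ℂ, ∃ (J : Finset (Fin m)) (n : Fin m → ℝ),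
      suppProj X = conjDiag U (fun j => if j ∈ J then 1 else 0) ∧
      suppProj X * Y * suppProj X = conjDiag U (fun j => if j ∈ J then n j else 0) := by
  set P := suppProj X with hP
  have hPh : P.IsHermitian := suppProj_isHermitian hX
  have hPP : P * P = P := suppProj_mul_self hX
  have hA : (P * Y * P).IsHermitian := by
    rw [Matrix.IsHermitian, Matrix.conjTranspose_mul, Matrix.conjTranspose_mul, hPh.eq, hY.eq,
      mul_assoc]
  obtain ⟨K, hK⟩ := exists_forall_mulVec_eq_smul hA
  -- On the complement of the range a value is prescribed that the compression does not attain,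
  -- so that no eigenvector mixes the range and its complement.
  have hN : (P * Y * P + (K : ℂ) • (1 - P)).IsHermitian := by
    refine hA.add ?_
    rw [Matrix.IsHermitian, Matrix.conjTranspose_smul, Matrix.conjTranspose_sub, hPh.eq,
      Matrix.conjTranspose_one, Complex.star_def, Complex.conj_ofReal]
  obtain ⟨U, hU, n, hn⟩ := exists_conjDiag hN
  have hcol : ∀ j, (P * Y * P + (K : ℂ) • (1 - P)).mulVec (U.mulVec (Pi.single j 1)) =
      (n j : ℂ) • U.mulVec (Pi.single j 1) := by
    intro j
    rw [hn, conjDiag, Matrix.mulVec_mulVec, mul_assoc, conjTranspose_mul_self_of_unitary hU,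
      mul_one, ← Matrix.mulVec_mulVec, ← Matrix.mulVec_smul]
    congr 1
    ext k
    rw [Matrix.mulVec_diagonal]
    rcases eq_or_ne k j with rfl | hk
    · simp
    · simp [hk]
  have hPN : P * (P * Y * P + (K : ℂ) • (1 - P)) = P * Y * P := by
    simp [mul_add, mul_sub, ← mul_assoc, hPP]
  have hQN : (1 - P) * (P * Y * P + (K : ℂ) • (1 - P)) = (K : ℂ) • (1 - P) := by
    simp [mul_add, sub_mul, mul_sub, ← mul_assoc, hPP]
  have hin : ∀ j, n j = K → P.mulVec (U.mulVec (Pi.single j 1)) = 0 := by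
    intro j hj
    apply hK
    have h1 := congrArg P.mulVec (hcol j)
    rw [Matrix.mulVec_mulVec, hPN, hj, Matrix.mulVec_smul] at h1
    rw [← h1, Matrix.mulVec_mulVec, mul_assoc (P * Y), hPP]
  have hout : ∀ j, n j ≠ K →
      P.mulVec (U.mulVec (Pi.single j 1)) = U.mulVec (Pi.single j 1) := by
    intro j hj
    have h1 := congrArg (1 - P).mulVec (hcol j)
    rw [Matrix.mulVec_mulVec, hQN, Matrix.mulVec_smul, Matrix.smul_mulVec, ← sub_eq_zero,
      ← sub_smul] at h1
    rcases smul_eq_zero.1 h1 with h2 | h2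
    · exact absurd (by exact_mod_cast (sub_eq_zero.1 h2).symm) hj
    · rw [Matrix.sub_mulVec, Matrix.one_mulVec, sub_eq_zero] at h2
      exact h2.symm
  have hPU : P * U = U * Matrix.diagonal
      (fun j => ((if n j ≠ K then 1 else 0 : ℝ) : ℂ)) := by
    ext a j
    have h1 : (P * U) a j = P.mulVec (U.mulVec (Pi.single j 1)) a := by
      rw [Matrix.mulVec_mulVec]; simp
    rw [h1, Matrix.mul_diagonal]
    by_cases hj : n j = K
    · rw [hin j hj, Pi.zero_apply, if_neg (not_not.2 hj), Complex.ofReal_zero, mul_zero]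
    · rw [hout j hj, if_pos hj, Complex.ofReal_one, mul_one]
      simp
  have hPd : P = conjDiag U
      (fun j => if j ∈ Finset.univ.filter (fun j => n j ≠ K) then 1 else 0) := by
    rw [conjDiag]
    simp only [Finset.mem_filter, Finset.mem_univ, true_and]
    rw [← hPU, mul_assoc, self_mul_conjTranspose_of_unitary hU, mul_one]
  refine ⟨U, hU, Finset.univ.filter (fun j => n j ≠ K), n, hPd, ?_⟩
  rw [← hPN, hn]
  conv_lhs => rw [hPd]
  rw [conjDiag_mul hU]
  congr 1
  ext j
  simp

/-- Scalar first-order condition: levels `n` over a nonempty index set are matched by `θ'` at a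
point of the open simplex, up to a common shift. -/
theorem Kernel.Steep.exists_simplex_point (hθ : θ.Steep) {J : Finset (Fin m)} (hJ : J.Nonempty)
    (n : Fin m → ℝ) :
    ∃ (x : Fin m → ℝ) (k : ℝ), (∀ j ∈ J, x j ∈ Set.Ioc (0 : ℝ) 1 ∧ θ.d1 (x j) = n j + k) ∧
      ∑ j ∈ J, x j = 1 := by
  obtain ⟨g, hgc, hg⟩ := hθ.exists_inverse
  obtain ⟨j₀, hj₀, hmax⟩ := J.exists_max_image n hJ
  have hcard : (1 : ℝ) ≤ J.card := by exact_mod_cast hJ.card_pos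
  have hc01 : (J.card : ℝ)⁻¹ ∈ Set.Ioc (0 : ℝ) 1 := ⟨by positivity, inv_le_one_of_one_le₀ hcard⟩
  have h11 : (1 : ℝ) ∈ Set.Ioc (0 : ℝ) 1 := ⟨one_pos, le_rfl⟩
  have hle : θ.d1 (J.card : ℝ)⁻¹ ≤ θ.d1 1 := θ.d1_strictMonoOn.monotoneOn hc01 h11 hc01.2
  have hG : Continuous fun k => ∑ j ∈ J, g (n j + k) := by fun_prop
  -- A shift that puts the top level at `θ'(1 / |J|)` gives a sum of at most one, and a shift that
  -- puts it at `θ'(1)` gives a sum of at least one.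
  have hlow : ∑ j ∈ J, g (n j + (θ.d1 (J.card : ℝ)⁻¹ - n j₀)) ≤ 1 := by
    have hb : ∀ j ∈ J, g (n j + (θ.d1 (J.card : ℝ)⁻¹ - n j₀)) ≤ (J.card : ℝ)⁻¹ := by
      intro j hj
      have h1 := hmax j hj
      have h2 := hg (n j + (θ.d1 (J.card : ℝ)⁻¹ - n j₀)) (by linarith)
      refine (θ.d1_strictMonoOn.le_iff_le h2.1 hc01).1 ?_
      rw [h2.2]
      linarith
    refine (Finset.sum_le_sum hb).trans ?_
    rw [Finset.sum_const, nsmul_eq_mul, mul_inv_cancel₀ (by positivity)]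
  have hhigh : 1 ≤ ∑ j ∈ J, g (n j + (θ.d1 1 - n j₀)) := by
    have hpos : ∀ j ∈ J, 0 ≤ g (n j + (θ.d1 1 - n j₀)) := by
      intro j hj
      have h1 := hmax j hj
      exact (hg (n j + (θ.d1 1 - n j₀)) (by linarith)).1.1.le
    refine le_trans ?_ (Finset.single_le_sum hpos hj₀)
    have h2 := hg (n j₀ + (θ.d1 1 - n j₀)) (by linarith)
    refine (θ.d1_strictMonoOn.le_iff_le h11 h2.1).1 ?_
    rw [h2.2]
    linarith
  obtain ⟨k, hk, hk1⟩ := intermediate_value_Icc (sub_le_sub_right hle (n j₀)) hG.continuousOn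
    ⟨hlow, hhigh⟩
  refine ⟨fun j => g (n j + k), k, fun j hj => ?_, hk1⟩
  have h1 := hmax j hj
  have h2 := hk.2
  exact hg _ (by linarith)

/-- The first-order characterization of best responses over a face: for each payoff matrix `Y` there
is a state with the same support as `X₀` at which the gradient of the regularizer represents `Y` on
the face up to a constant. -/
theorem Kernel.Steep.exists_firstOrder (hθ : θ.Steep) {X₀ Y : Mat m} (hX₀ : X₀ ∈ densities m)
    (hY : Y.IsHermitian) :
    ∃ X ∈ face X₀, X₀ ∈ face X ∧
      ∃ k : ℝ, ∀ Z ∈ face X₀, pair Y Z = pair (cfc θ.d1 X) Z + k := by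
  have hX₀h := hX₀.1.isHermitian
  obtain ⟨U, hU, J, n, hP, hPY⟩ := exists_adapted_conjDiag hX₀h hY
  have hker : ∀ v, X₀.mulVec v = 0 ↔ ∀ j ∈ J, U.conjTranspose.mulVec v j = 0 := by
    intro v
    rw [← suppProj_mulVec_eq_zero_iff hX₀h, hP, conjDiag_mulVec_eq_zero_iff hU]
    refine forall_congr' fun j => ?_
    by_cases hj : j ∈ J <;> simp [hj]
  have hJ : J.Nonempty := by
    rw [Finset.nonempty_iff_ne_empty]
    rintro rfl
    have h0 : X₀ = 0 := by
      refine Matrix.toLin'.injective (LinearMap.ext fun v => ?_)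
      rw [Matrix.toLin'_apply, (hker v).2 (by simp)]
      simp
    have := hX₀.2
    rw [h0, Matrix.trace_zero] at this
    exact zero_ne_one this
  obtain ⟨x, k, hx, hx1⟩ := hθ.exists_simplex_point hJ n
  set y : Fin m → ℝ := fun j => if j ∈ J then x j else 0 with hy
  have hy0 : ∀ j, 0 ≤ y j := by
    intro j
    by_cases hj : j ∈ J
    · simpa [hy, hj] using (hx j hj).1.1.le
    · simp [hy, hj]
  have hdens : conjDiag U y ∈ densities m := by
    refine conjDiag_mem_densities hU hy0 ?_
    simpa [hy] using hx1
  have hker' : ∀ v, (conjDiag U y).mulVec v = 0 ↔ X₀.mulVec v = 0 := by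
    intro v
    rw [hker, conjDiag_mulVec_eq_zero_iff hU]
    refine forall_congr' fun j => ?_
    by_cases hj : j ∈ J
    · simp [hy, hj, (hx j hj).1.1.ne']
    · simp [hy, hj]
  refine ⟨conjDiag U y, ⟨hdens, fun v hv => (hker' v).2 hv⟩,
    ⟨hX₀, fun v hv => (hker' v).1 hv⟩, -k, fun Z hZ => ?_⟩
  have hZU : Z ∈ face (conjDiag U y) := ⟨hZ.1, fun v hv => hZ.2 v ((hker' v).1 hv)⟩
  have hZP : suppProj X₀ * Z * suppProj X₀ = Z := by
    rw [suppProj_mul hX₀h hZ.1.1.isHermitian hZ.2, mul_suppProj hX₀h hZ.2]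
  have h1 : pair Y Z = pair (suppProj X₀ * Y * suppProj X₀) Z := by
    conv_lhs => rw [← hZP]
    rw [pair, pair, ← mul_assoc, Matrix.trace_mul_comm]
    simp only [mul_assoc]
  have hq1 : ∑ j, ((U.conjTranspose * Z * U) j j).re = 1 := by
    have h2 := pair_one_of_mem_densities hZ.1
    rw [← conjDiag_one hU, pair_conjDiag] at h2
    simpa using h2
  rw [h1, hPY, cfc_conjDiag hU, pair_conjDiag, pair_conjDiag, ← sub_eq_iff_eq_add',
    ← Finset.sum_sub_distrib, ← mul_one (-k), ← hq1, Finset.mul_sum]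
  refine Finset.sum_congr rfl fun j _ => ?_
  by_cases hj : j ∈ J
  · simp only [hy, hj, if_true, Function.comp_apply, (hx j hj).2]
    ring
  · rw [face_col_eq_zero hU hZU (by simp [hy, hj])]
    simp

/-- Strong optimality of a state that satisfies the first-order condition on a face. -/
theorem Kernel.le_of_firstOrder {X₀ X Y Z : Mat m} {k : ℝ} (hX : X ∈ face X₀) (hX' : X₀ ∈ face X)
    (hk : ∀ Z ∈ face X₀, pair Y Z = pair (cfc θ.d1 X) Z + k) (hZ : Z ∈ face X₀) :
    θ.modulus / 2 * ‖Z - X‖ ^ 2 ≤ (pair Y X - θ.reg X) - (pair Y Z - θ.reg Z) := by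
  have h := θ.klein_le hX.1 (face_trans hZ hX')
  rw [pair_sub_right] at h
  rw [hk X hX, hk Z hZ]
  linarith

theorem Kernel.isBestResponse_iff {S : Set (Mat m)} {X Y : Mat m} :
    θ.IsBestResponse S Y X ↔
      X ∈ S ∧ ∀ Z ∈ S, pair Y Z - θ.reg Z ≤ pair Y X - θ.reg X := Iff.rfl

theorem Kernel.isBestResponse_of_firstOrder {X₀ X Y : Mat m} {k : ℝ} (hX : X ∈ face X₀)
    (hX' : X₀ ∈ face X) (hk : ∀ Z ∈ face X₀, pair Y Z = pair (cfc θ.d1 X) Z + k) :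
    θ.IsBestResponse (face X₀) Y X := by
  refine Kernel.isBestResponse_iff.2 ⟨hX, fun Z hZ => ?_⟩
  have h := Kernel.le_of_firstOrder hX hX' hk hZ
  have := mul_nonneg (half_pos θ.modulus_pos).le (sq_nonneg ‖Z - X‖)
  linarith

/-- A best response over the face of `X₀` has the same support as `X₀`, and it satisfies the
first-order condition. Steepness keeps it off the boundary of the face. -/
theorem Kernel.IsBestResponse.firstOrder (hθ : θ.Steep) {X₀ X Y : Mat m} (hX₀ : X₀ ∈ densities m)
    (hY : Y.IsHermitian) (h : θ.IsBestResponse (face X₀) Y X) :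
    X ∈ face X₀ ∧ X₀ ∈ face X ∧ ∃ k : ℝ, ∀ Z ∈ face X₀, pair Y Z = pair (cfc θ.d1 X) Z + k := by
  obtain ⟨X', hX', hX'', k, hk⟩ := hθ.exists_firstOrder hX₀ hY
  rw [Kernel.isBestResponse_iff] at h
  have h1 := Kernel.le_of_firstOrder hX' hX'' hk h.1
  have h2 := h.2 X' hX'
  have h3 : ‖X - X'‖ ^ 2 ≤ 0 := by
    by_contra hcon
    have := mul_pos (half_pos θ.modulus_pos) (not_le.1 hcon)
    linarith
  have h4 : X = X' := by
    rw [← sub_eq_zero, ← norm_eq_zero]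
    exact pow_eq_zero_iff two_ne_zero |>.1 (le_antisymm h3 (sq_nonneg _))
  subst h4
  exact ⟨hX', hX'', k, hk⟩

/-- Strong convexity at the maximum: the loss of a state against the best response dominates the
squared distance. -/
theorem Kernel.IsBestResponse.strong (hθ : θ.Steep) {X₀ X Y Z : Mat m} (hX₀ : X₀ ∈ densities m)
    (hY : Y.IsHermitian) (h : θ.IsBestResponse (face X₀) Y X) (hZ : Z ∈ face X₀) :
    θ.modulus / 2 * ‖Z - X‖ ^ 2 ≤ (pair Y X - θ.reg X) - (pair Y Z - θ.reg Z) := by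
  obtain ⟨h1, h2, k, hk⟩ := h.firstOrder hθ hX₀ hY
  exact Kernel.le_of_firstOrder h1 h2 hk hZ

/-- Best responses are Lipschitz in the payoff matrix, by strong convexity of the regularizer. -/
theorem Kernel.IsBestResponse.norm_sub_le (hθ : θ.Steep) {X₀ X X' Y Y' : Mat m}
    (hX₀ : X₀ ∈ densities m) (hY : Y.IsHermitian) (hY' : Y'.IsHermitian)
    (h : θ.IsBestResponse (face X₀) Y X) (h' : θ.IsBestResponse (face X₀) Y' X') :
    ‖X - X'‖ ≤ θ.modulus⁻¹ * ‖Y - Y'‖ := by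
  have h1 := h.strong hθ hX₀ hY h'.1
  have h2 := h'.strong hθ hX₀ hY' h.1
  rw [norm_sub_rev] at h1
  have h3 : θ.modulus * ‖X - X'‖ ^ 2 ≤ pair (Y - Y') (X - X') := by
    rw [pair_sub_left, pair_sub_right, pair_sub_right]
    linarith
  have h4 := h3.trans ((le_abs_self _).trans (abs_pair_le _ _))
  rw [inv_mul_eq_div, le_div_iff₀ θ.modulus_pos]
  rcases (norm_nonneg (X - X')).eq_or_lt with h0 | h0
  · rw [← h0, zero_mul]; positivity
  · refine le_of_mul_le_mul_right ?_ h0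
    linarith

/-- Payoff matrices that differ by a constant on the face have the same best response. -/
theorem Kernel.IsBestResponse.unique (hθ : θ.Steep) {X₀ X X' Y Y' : Mat m}
    (hX₀ : X₀ ∈ densities m) (hY' : Y'.IsHermitian)
    (h : θ.IsBestResponse (face X₀) Y X) (h' : θ.IsBestResponse (face X₀) Y' X')
    {k : ℝ} (hk : ∀ Z ∈ face X₀, pair Y Z = pair Y' Z + k) : X = X' := by
  have h1 : θ.IsBestResponse (face X₀) Y' X := by
    rw [Kernel.isBestResponse_iff] at h ⊢
    refine ⟨h.1, fun Z hZ => ?_⟩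
    have := h.2 Z hZ
    rw [hk Z hZ, hk X h.1] at this
    linarith
  have h2 := h1.norm_sub_le hθ hX₀ hY' hY' h'
  rw [sub_self, norm_zero, mul_zero] at h2
  exact sub_eq_zero.1 (norm_le_zero_iff.1 h2)

theorem Kernel.isBestResponse_self {X : Mat m} (hX : X ∈ densities m) :
    θ.IsBestResponse (face X) (cfc θ.d1 X) X :=
  Kernel.isBestResponse_of_firstOrder (k := 0) (self_mem_face hX) (self_mem_face hX) fun Z _ => by
    rw [add_zero]

theorem cfc_isHermitian (f : ℝ → ℝ) {X : Mat m} (hX : X.IsHermitian) : (cfc f X).IsHermitian := by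
  obtain ⟨U, hU, x, rfl⟩ := exists_conjDiag hX
  rw [cfc_conjDiag hU]
  exact isHermitian_conjDiag _ _

end BestResponse

/-! ### Payoff gradients -/

section Gradient

variable {ι : Type*} [Fintype ι] [DecidableEq ι] {d : ι → ℕ} {Ω : Type*} [Fintype Ω]
  (G : QuantumGame ι d Ω)

theorem QuantumGame.payoff_update (i : ι) (X : Profile d) (Z : Mat (d i)) :
    G.payoff i (Function.update X i Z) = pair (G.grad X i) Z := by
  rw [pair_comm, pair, G.trace_mul_grad, QuantumGame.payoff]

theorem QuantumGame.payoff_eq_pair (i : ι) (X : Profile d) :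
    G.payoff i X = pair (G.grad X i) (X i) := by
  rw [← G.payoff_update, Function.update_eq_self]

theorem QuantumGame.isNash_iff {X : Profile d} :
    G.IsNash X ↔ ∀ i, ∀ Z ∈ densities (d i), pair (G.grad X i) Z ≤ pair (G.grad X i) (X i) := by
  simp only [QuantumGame.IsNash, G.payoff_update, G.payoff_eq_pair]

/-- A player's payoff gradient does not depend on the player's own state. -/
theorem QuantumGame.grad_congr {X X' : Profile d} (i : ι) (h : ∀ j, j ≠ i → X j = X' j) :
    G.grad X i = G.grad X' i := by
  have : ∀ Z, Function.update X i Z = Function.update X' i Z := by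
    intro Z
    ext1 j
    rcases eq_or_ne j i with rfl | hj
    · simp
    · simp [hj, h j hj]
  ext a b
  simp only [QuantumGame.grad, Matrix.of_apply, this]

theorem conjTranspose_tensor (X : Profile d) :
    (tensor X).conjTranspose = tensor fun i => (X i).conjTranspose := by
  ext k l
  simp [tensor, Matrix.conjTranspose_apply]

theorem QuantumGame.isHermitian_grad {X : Profile d} (hX : ∀ i, (X i).IsHermitian) (i : ι) :
    (G.grad X i).IsHermitian := by
  ext a b
  rw [Matrix.conjTranspose_apply]
  simp only [QuantumGame.grad, Matrix.of_apply, QuantumGame.payoffC, star_sum, star_mul']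
  refine Finset.sum_congr rfl fun ω _ => ?_
  rw [← Matrix.trace_conjTranspose, Matrix.conjTranspose_mul, (G.povm_posSemidef ω).1.eq,
    conjTranspose_tensor, Matrix.trace_mul_comm, Complex.star_def, Complex.conj_ofReal]
  congr 4
  ext1 j
  rcases eq_or_ne j i with rfl | hj
  · simp
  · simp [hj, (hX j).eq]

theorem states_isHermitian {X : Profile d} (hX : X ∈ states d) (i : ι) : (X i).IsHermitian :=
  (hX i).1.isHermitian

theorem contDiff_entry (i : ι) (a b : Fin (d i)) :
    ContDiff ℝ 1 fun X : Profile d => X i a b := by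
  let L : Profile d →ₗ[ℝ] ℂ :=
    { toFun := fun X => X i a b
      map_add' := fun _ _ => rfl
      map_smul' := fun _ _ => rfl }
  exact L.toContinuousLinearMap.contDiff

theorem contDiff_tensor_update (i : ι) (Z : Mat (d i)) (k l : JointIdx d) :
    ContDiff ℝ 1 fun X : Profile d => tensor (Function.update X i Z) k l := by
  simp only [tensor, Matrix.of_apply]
  refine contDiff_prod fun j _ => ?_
  rcases eq_or_ne j i with rfl | hj
  · simp only [Function.update_self]
    exact contDiff_const
  · simp only [Function.update_of_ne hj]
    exact contDiff_entry j _ _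

theorem QuantumGame.contDiff_grad : ContDiff ℝ 1 G.grad := by
  refine contDiff_pi.2 fun i => ?_
  have h : (fun X : Profile d => G.grad X i) = fun X =>
      ∑ b, ∑ a, G.payoffC i (Function.update X i (Matrix.single a b 1)) •
        Matrix.single b a (1 : ℂ) := by
    ext X b a
    simp [Matrix.sum_apply, Matrix.single_apply, QuantumGame.grad, ite_and]
  rw [h]
  refine ContDiff.sum fun b _ => ContDiff.sum fun a _ => ContDiff.fun_smul ?_ contDiff_const
  simp only [QuantumGame.payoffC, Matrix.trace, Matrix.diag_apply, Matrix.mul_apply]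
  refine ContDiff.sum fun ω _ => contDiff_const.mul (ContDiff.sum fun k _ =>
    ContDiff.sum fun l _ => contDiff_const.mul ?_)
  exact contDiff_tensor_update i _ l k

theorem QuantumGame.continuous_grad : Continuous G.grad := G.contDiff_grad.continuous

theorem norm_le_one_of_mem_states {X : Profile d} (hX : X ∈ states d) : ‖X‖ ≤ 1 :=
  (pi_norm_le_iff_of_nonneg zero_le_one).2 fun i => norm_le_one_of_mem_densities (hX i)

theorem QuantumGame.exists_lipschitzOnWith_grad :
    ∃ K, LipschitzOnWith K G.grad (states d) := by
  obtain ⟨K, hK⟩ := G.contDiff_grad.contDiffOn.exists_lipschitzOnWith one_ne_zero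
    (convex_closedBall (0 : Profile d) 1) (isCompact_closedBall _ _)
  exact ⟨K, hK.mono fun X hX => by simpa using norm_le_one_of_mem_states hX⟩

theorem QuantumGame.exists_norm_grad_le :
    ∃ L : NNReal, ∀ X ∈ states d, ‖G.grad X‖ ≤ L := by
  obtain ⟨C, hC⟩ := (isCompact_closedBall (0 : Profile d) 1).exists_bound_of_continuousOn
    G.continuous_grad.continuousOn
  refine ⟨C.toNNReal, fun X hX => ?_⟩
  exact (hC X (by simpa using norm_le_one_of_mem_states hX)).trans (Real.le_coe_toNNReal C)

end Gradient

/-! ### Global solutions of bounded Lipschitz differential equations -/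

/-- By Picard-Lindelöf there are solutions on the intervals `[-(n + 1), n + 1]`, since the speed is
bounded; by uniqueness they fit together. -/
theorem exists_global_solution {E : Type*} [NormedAddCommGroup E] [NormedSpace ℝ E]
    [CompleteSpace E] {f : E → E} {K L : NNReal} (hf : LipschitzWith K f) (hL : ∀ x, ‖f x‖ ≤ L)
    (x₀ : E) : ∃ α : ℝ → E, α 0 = x₀ ∧ ∀ t, HasDerivAt α (f (α t)) t := by
  have hloc : ∀ n : ℕ, ∃ α : ℝ → E, α 0 = x₀ ∧ ∀ t ∈ Set.Icc (-(n + 1) : ℝ) (n + 1),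
      HasDerivWithinAt α (f (α t)) (Set.Icc (-(n + 1) : ℝ) (n + 1)) t := by
    intro n
    have hn : (0 : ℝ) ∈ Set.Icc (-(n + 1) : ℝ) (n + 1) := ⟨by linarith [n.cast_nonneg (α := ℝ)],
      by positivity⟩
    have hpl : IsPicardLindelof (fun _ => f) (⟨0, hn⟩ : Set.Icc (-(n + 1) : ℝ) (n + 1)) x₀
        (L * (n + 1)) 0 L K :=
      { lipschitzOnWith := fun _ _ => hf.lipschitzOnWith
        continuousOn := fun _ _ => continuousOn_const
        norm_le := fun _ _ x _ => hL x
        mul_max_le := by simp }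
    exact hpl.exists_eq_forall_mem_Icc_hasDerivWithinAt₀
  choose α hα0 hα using hloc
  have hagree : ∀ n N : ℕ, n ≤ N → ∀ s ∈ Set.Icc (-(n + 1) : ℝ) (n + 1), α n s = α N s := by
    intro n N hnN s hs
    have hnN' : (n : ℝ) ≤ N := by exact_mod_cast hnN
    have hsub : Set.Icc (-(n + 1) : ℝ) (n + 1) ⊆ Set.Icc (-(N + 1) : ℝ) (N + 1) :=
      Set.Icc_subset_Icc (by linarith) (by linarith)
    have hn0 : (0 : ℝ) < n + 1 := by positivity
    refine ODE_solution_unique_of_mem_Icc (v := fun _ => f) (s := fun _ => Set.univ) (K := K)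
      (t₀ := 0) (fun _ _ => hf.lipschitzOnWith) ⟨by linarith, hn0⟩
      (fun t ht => (hα n t ht).continuousWithinAt) (fun t ht => ?_) (fun _ _ => trivial)
      (fun t ht => ((hα N t (hsub ht)).mono hsub).continuousWithinAt) (fun t ht => ?_)
      (fun _ _ => trivial) (by rw [hα0, hα0]) hs
    · exact (hα n t (Set.Ioo_subset_Icc_self ht)).hasDerivAt (Icc_mem_nhds ht.1 ht.2)
    · exact ((hα N t (hsub (Set.Ioo_subset_Icc_self ht))).mono hsub).hasDerivAt
        (Icc_mem_nhds ht.1 ht.2)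
  refine ⟨fun t => α ⌈|t|⌉₊ t, hα0 _, fun t => ?_⟩
  set N : ℕ := ⌈|t|⌉₊ + 1 with hN
  have hmem : ∀ n : ℕ, ∀ s : ℝ, |s| < n → s ∈ Set.Icc (-(n + 1) : ℝ) (n + 1) := fun n s hs =>
    ⟨by linarith [(abs_lt.1 hs).1], by linarith [(abs_lt.1 hs).2]⟩
  have hNt : |t| < N := by
    have := Nat.le_ceil |t|
    rw [hN]; push_cast; linarith
  have hev : (fun t : ℝ => α ⌈|t|⌉₊ t) =ᶠ[𝓝 t] α N := by
    have : ∀ᶠ s : ℝ in 𝓝 t, |s| < (N : ℝ) :=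
      (continuous_abs.tendsto t).eventually (gt_mem_nhds hNt)
    filter_upwards [this] with s hs
    refine hagree _ _ (Nat.ceil_le.2 hs.le) s ⟨?_, ?_⟩
    · linarith [neg_abs_le s, Nat.le_ceil |s|]
    · linarith [le_abs_self s, Nat.le_ceil |s|]
  have ht' : α ⌈|t|⌉₊ t = α N t := hev.eq_of_nhds
  simp only [ht']
  refine HasDerivAt.congr_of_eventuallyEq ?_ hev
  refine (hα N t (hmem N t hNt)).hasDerivAt (Icc_mem_nhds ?_ ?_)
  · linarith [(abs_lt.1 hNt).1]
  · linarith [(abs_lt.1 hNt).2]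

/-! ### Orbits of the quantum state dynamics -/

section Orbits

/-- The Hermitian part of a matrix. -/
noncomputable def hermPart {m : ℕ} (A : Mat m) : Mat m := (1 / 2 : ℝ) • (A + A.conjTranspose)

theorem isHermitian_hermPart {m : ℕ} (A : Mat m) : (hermPart A).IsHermitian := by
  rw [Matrix.IsHermitian, hermPart, Matrix.conjTranspose_smul, Matrix.conjTranspose_add,
    Matrix.conjTranspose_conjTranspose, star_trivial, add_comm]

theorem hermPart_eq {m : ℕ} {A : Mat m} (hA : A.IsHermitian) : hermPart A = A := by
  rw [hermPart, hA.eq, ← two_smul ℝ A, smul_smul]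
  norm_num

theorem norm_hermPart_sub_le {m : ℕ} (A B : Mat m) : ‖hermPart A - hermPart B‖ ≤ ‖A - B‖ := by
  have h : hermPart A - hermPart B = (1 / 2 : ℝ) • ((A - B) + (A - B).conjTranspose) := by
    rw [hermPart, hermPart, ← smul_sub, Matrix.conjTranspose_sub]
    congr 1
    abel
  have h2 := norm_add_le (A - B) (A - B).conjTranspose
  rw [Matrix.frobenius_norm_conjTranspose] at h2
  rw [h, norm_smul, Real.norm_of_nonneg (by norm_num)]
  linarith

/-- The regularized best response over the face of `X₀`. It is taken to the Hermitian part of `Y`,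
so that it is Lipschitz on the space of all matrices. -/
noncomputable def Kernel.bestResponse (θ : Kernel) {m : ℕ} (X₀ Y : Mat m) : Mat m :=
  Classical.epsilon fun X => θ.IsBestResponse (face X₀) (hermPart Y) X

theorem Kernel.Steep.isBestResponse_bestResponse {θ : Kernel} (hθ : θ.Steep) {m : ℕ} {X₀ : Mat m}
    (hX₀ : X₀ ∈ densities m) (Y : Mat m) :
    θ.IsBestResponse (face X₀) (hermPart Y) (θ.bestResponse X₀ Y) := by
  obtain ⟨X, h1, h2, k, hk⟩ := hθ.exists_firstOrder hX₀ (isHermitian_hermPart Y)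
  exact Classical.epsilon_spec ⟨X, Kernel.isBestResponse_of_firstOrder h1 h2 hk⟩

theorem Kernel.Steep.eq_bestResponse {θ : Kernel} (hθ : θ.Steep) {m : ℕ} {X₀ X Y : Mat m}
    (hX₀ : X₀ ∈ densities m) (hY : Y.IsHermitian) (h : θ.IsBestResponse (face X₀) Y X) :
    X = θ.bestResponse X₀ Y := by
  have h2 := hθ.isBestResponse_bestResponse hX₀ Y
  rw [hermPart_eq hY] at h2
  exact h.unique hθ hX₀ hY h2 (k := 0) fun Z _ => by rw [add_zero]

variable {ι : Type*} [Fintype ι] [DecidableEq ι] {d : ι → ℕ} {Ω : Type*} [Fintype Ω]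
  {G : QuantumGame ι d Ω} {θ : ι → Kernel}

theorem hasDerivAt_profile_iff {Y : ℝ → Profile d} {V : Profile d} {t : ℝ} :
    HasDerivAt Y V t ↔ ∀ i a b, HasDerivAt (fun s => Y s i a b) (V i a b) t := by
  refine hasDerivAt_pi.trans (forall_congr' fun i => ?_)
  refine Iff.trans hasDerivAt_pi (forall_congr' fun a => ?_)
  exact hasDerivAt_pi

/-- The profile of regularized best responses over the faces of `X₀`. -/
noncomputable def bestResponses (θ : ι → Kernel) (X₀ Y : Profile d) : Profile d :=
  fun i => (θ i).bestResponse (X₀ i) (Y i)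

theorem bestResponses_mem_states (hθ : ∀ i, (θ i).Steep) {X₀ : Profile d} (hX₀ : X₀ ∈ states d)
    (Y : Profile d) : bestResponses θ X₀ Y ∈ states d := fun i =>
  ((hθ i).isBestResponse_bestResponse (hX₀ i) (Y i)).1.1

theorem lipschitzWith_bestResponses (hθ : ∀ i, (θ i).Steep) {X₀ : Profile d}
    (hX₀ : X₀ ∈ states d) :
    LipschitzWith (∑ i, ((θ i).modulus⁻¹).toNNReal) (bestResponses θ X₀) := by
  refine LipschitzWith.of_dist_le_mul fun Y Y' => (dist_pi_le_iff (by positivity)).2 fun i => ?_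
  have h1 := ((hθ i).isBestResponse_bestResponse (hX₀ i) (Y i)).norm_sub_le (hθ i) (hX₀ i)
    (isHermitian_hermPart _) (isHermitian_hermPart _)
    ((hθ i).isBestResponse_bestResponse (hX₀ i) (Y' i))
  have hm : 0 ≤ (θ i).modulus⁻¹ := inv_nonneg.2 (θ i).modulus_pos.le
  have h2 : (θ i).modulus⁻¹ ≤ ((∑ i, ((θ i).modulus⁻¹).toNNReal : NNReal) : ℝ) := by
    rw [← Real.coe_toNNReal _ hm]
    exact_mod_cast Finset.single_le_sum (f := fun i => ((θ i).modulus⁻¹).toNNReal)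
      (fun _ _ => zero_le) (Finset.mem_univ i)
  rw [dist_eq_norm]
  refine h1.trans (mul_le_mul h2 ?_ (norm_nonneg _) (by positivity))
  refine (norm_hermPart_sub_le _ _).trans ?_
  rw [← dist_eq_norm]
  exact dist_le_pi_dist Y Y' i

/-- The velocity of the payoff matrices under follow the quantum leader on the faces of `X₀`. -/
noncomputable def leaderField (G : QuantumGame ι d Ω) (θ : ι → Kernel) (X₀ Y : Profile d) :
    Profile d := G.grad (bestResponses θ X₀ Y)

theorem exists_lipschitzWith_leaderField (G : QuantumGame ι d Ω) (hθ : ∀ i, (θ i).Steep)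
    {X₀ : Profile d} (hX₀ : X₀ ∈ states d) : ∃ K, LipschitzWith K (leaderField G θ X₀) := by
  obtain ⟨K, hK⟩ := G.exists_lipschitzOnWith_grad
  refine ⟨K * ∑ i, ((θ i).modulus⁻¹).toNNReal, ?_⟩
  rw [← lipschitzOnWith_univ]
  exact hK.comp (lipschitzWith_bestResponses hθ hX₀).lipschitzOnWith
    fun Y _ => bestResponses_mem_states hθ hX₀ Y

/-- A curve whose velocity is Hermitian stays Hermitian if it starts so. -/
theorem isHermitian_of_hasDerivAt {Y V : ℝ → Profile d} (h0 : ∀ i, (Y 0 i).IsHermitian)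
    (hV : ∀ t i, (V t i).IsHermitian) (h : ∀ t, HasDerivAt Y (V t) t) (t : ℝ) (i : ι) :
    (Y t i).IsHermitian := by
  ext a b
  rw [Matrix.conjTranspose_apply]
  have hd : ∀ s, HasDerivAt (fun s => star (Y s i b a) - Y s i a b) 0 s := by
    intro s
    have h1 := (hasDerivAt_profile_iff.1 (h s) i b a).star
    have h2 := h1.sub (hasDerivAt_profile_iff.1 (h s) i a b)
    refine h2.congr_deriv ?_
    rw [← Matrix.conjTranspose_apply, (hV s i).eq, sub_self]
  have hc := is_const_of_deriv_eq_zero (fun s => (hd s).differentiableAt)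
    (fun s => (hd s).deriv) t 0
  rw [← sub_eq_zero, hc, ← Matrix.conjTranspose_apply, (h0 i).eq, sub_self]

theorem exists_isQDOrbit (G : QuantumGame ι d Ω) (hθ : ∀ i, (θ i).Steep) {X₀ : Profile d}
    (hX₀ : X₀ ∈ states d) : ∃ X, IsQDOrbit G θ X₀ X := by
  obtain ⟨K, hK⟩ := exists_lipschitzWith_leaderField G hθ hX₀
  obtain ⟨L, hL⟩ := G.exists_norm_grad_le
  have hmem := bestResponses_mem_states hθ hX₀
  obtain ⟨Y, hY0, hY⟩ := exists_global_solution hK (fun Y => hL _ (hmem Y))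
    (fun i => cfc (θ i).d1 (X₀ i))
  have hherm : ∀ t i, (Y t i).IsHermitian :=
    isHermitian_of_hasDerivAt
      (fun i => by rw [hY0]; exact cfc_isHermitian _ (states_isHermitian hX₀ i))
      (fun t i => G.isHermitian_grad (states_isHermitian (hmem (Y t))) i) hY
  refine ⟨fun t => bestResponses θ X₀ (Y t), ?_, Y, fun t i => ⟨hherm t i, ?_, ?_⟩⟩
  · ext1 i
    have h1 := Kernel.isBestResponse_self (θ := θ i) (hX₀ i)
    rw [(hθ i).eq_bestResponse (hX₀ i) (cfc_isHermitian _ (states_isHermitian hX₀ i)) h1]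
    simp only [bestResponses, hY0]
  · have := (hθ i).isBestResponse_bestResponse (hX₀ i) (Y t i)
    rwa [hermPart_eq (hherm t i)] at this
  · exact hasDerivAt_profile_iff.1 (hY t) i

theorem IsQDOrbit.unique (hθ : ∀ i, (θ i).Steep) {X₀ : Profile d} (hX₀ : X₀ ∈ states d)
    {X X' : ℝ → Profile d} (h : IsQDOrbit G θ X₀ X) (h' : IsQDOrbit G θ X₀ X') : X = X' := by
  obtain ⟨h0, Y, hY⟩ := h
  obtain ⟨h0', Y', hY'⟩ := h'
  obtain ⟨K, hK⟩ := exists_lipschitzWith_leaderField G hθ hX₀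
  -- Both payoff matrices at time `0` have the best response `X₀`, so they differ by a constant on
  -- the face, and shifting one curve by the difference does not change its best responses.
  have hconst : ∀ i, ∃ k : ℝ, ∀ Z ∈ face (X₀ i), pair (Y 0 i) Z = pair (Y' 0 i) Z + k := by
    intro i
    obtain ⟨-, -, k, hk⟩ := (hY 0 i).2.1.firstOrder (hθ i) (hX₀ i) (hY 0 i).1
    obtain ⟨-, -, k', hk'⟩ := (hY' 0 i).2.1.firstOrder (hθ i) (hX₀ i) (hY' 0 i).1
    refine ⟨k - k', fun Z hZ => ?_⟩
    rw [hk Z hZ, hk' Z hZ, h0, h0']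
    ring
  choose k hk using hconst
  have hX : ∀ t, X t = bestResponses θ X₀ (Y t + (Y' 0 - Y 0)) := by
    intro t
    ext1 i
    have hh : ((Y t + (Y' 0 - Y 0)) i).IsHermitian :=
      (hY t i).1.add ((hY' 0 i).1.sub (hY 0 i).1)
    have h1 := (hθ i).isBestResponse_bestResponse (hX₀ i) ((Y t + (Y' 0 - Y 0)) i)
    rw [hermPart_eq hh] at h1
    refine (hY t i).2.1.unique (hθ i) (hX₀ i) hh h1 (k := k i) fun Z hZ => ?_
    rw [Pi.add_apply, Pi.sub_apply, pair_add_left, pair_sub_left, hk i Z hZ]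
    ring
  have hX' : ∀ t, X' t = bestResponses θ X₀ (Y' t) := fun t => funext fun i =>
    (hθ i).eq_bestResponse (hX₀ i) (hY' t i).1 (hY' t i).2.1
  have heq : (fun t => Y t + (Y' 0 - Y 0)) = Y' := by
    refine ODE_solution_unique_univ (v := fun _ => leaderField G θ X₀) (s := fun _ => Set.univ)
      (K := K) (t₀ := 0) (fun _ => hK.lipschitzOnWith) (fun t => ⟨?_, trivial⟩)
      (fun t => ⟨?_, trivial⟩) (by simp)
    · rw [leaderField, ← hX]
      exact (hasDerivAt_profile_iff.2 fun i => (hY t i).2.2).add_const _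
    · rw [leaderField, ← hX']
      exact hasDerivAt_profile_iff.2 fun i => (hY' t i).2.2
  funext t
  have ht : Y t + (Y' 0 - Y 0) = Y' t := congrFun heq t
  rw [hX, hX', ht]

end Orbits

/-! ### Relative interior of a face, and pure states -/

section RelativeInterior

variable {m : ℕ}

/-- A positive semidefinite matrix tolerates all small Hermitian perturbations that vanish on its
kernel. -/
theorem exists_forall_posSemidef_add {X : Mat m} (hX : X.PosSemidef) :
    ∃ μ > 0, ∀ W : Mat m, W.IsHermitian → (∀ v, X.mulVec v = 0 → W.mulVec v = 0) → ‖W‖ ≤ μ →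
      (X + W).PosSemidef := by
  obtain ⟨U, hU, x, rfl⟩ := exists_conjDiag hX.isHermitian
  have hx := (posSemidef_conjDiag_iff hU x).1 hX
  obtain ⟨μ, hμ, hμx⟩ : ∃ μ > 0, ∀ j, x j ≠ 0 → μ ≤ x j := by
    rcases (Finset.univ.filter fun j => x j ≠ 0).eq_empty_or_nonempty with h | h
    · refine ⟨1, one_pos, fun j hj => ?_⟩
      have : j ∈ Finset.univ.filter fun j => x j ≠ 0 := by simpa using hj
      simp [h] at this
    · obtain ⟨j₀, hj₀, hmin⟩ := Finset.exists_min_image _ x h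
      refine ⟨x j₀, lt_of_le_of_ne (hx j₀) (Ne.symm (by simpa using hj₀)), fun j hj => ?_⟩
      exact hmin j (by simpa using hj)
  refine ⟨μ, hμ, fun W hW hker hnorm => ?_⟩
  have hWW : suppProj (conjDiag U x) * W * suppProj (conjDiag U x) = W := by
    rw [suppProj_mul hX.isHermitian hW hker, mul_suppProj hX.isHermitian hker]
  have hsq := suppProj_mul_self hX.isHermitian
  have hPh := suppProj_isHermitian hX.isHermitian
  obtain ⟨V, hV, w, rfl⟩ := exists_conjDiag hW
  have hw : ∀ j, -μ ≤ w j := by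
    intro j
    have h1 : w j ^ 2 ≤ ‖conjDiag V w‖ ^ 2 := by
      rw [norm_sq_of_isHermitian hW, pair, conjDiag_mul hV, trace_conjDiag hV, Complex.ofReal_re]
      rw [pow_two]
      exact Finset.single_le_sum (f := fun j => w j * w j) (fun i _ => mul_self_nonneg _)
        (Finset.mem_univ j)
    have h2 := abs_le_of_sq_le_sq' h1 (norm_nonneg _)
    linarith [h2.1]
  have h1 : (conjDiag V ((fun _ => μ) + w)).PosSemidef :=
    (posSemidef_conjDiag_iff hV _).2 fun j => by
      simp only [Pi.add_apply]
      linarith [hw j]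
  have h2 : (conjDiag U (x - fun j => if x j = 0 then 0 else μ)).PosSemidef := by
    refine (posSemidef_conjDiag_iff hU _).2 fun j => ?_
    by_cases hj : x j = 0
    · simp [hj]
    · simpa [hj] using hμx j hj
  have h3 := h1.mul_mul_conjTranspose_same (suppProj (conjDiag U x))
  have e1 : suppProj (conjDiag U x) * conjDiag V ((fun _ => μ) + w) *
      (suppProj (conjDiag U x)).conjTranspose =
      conjDiag U (fun j => if x j = 0 then 0 else μ) + conjDiag V w := by
    have e2 : conjDiag V (fun _ => μ) = (μ : ℂ) • (1 : Mat m) := by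
      rw [← self_mul_conjTranspose_of_unitary hV, conjDiag]
      ext i j
      simp [Matrix.mul_apply, Matrix.diagonal_apply, Finset.mul_sum, mul_left_comm, mul_assoc]
    rw [hPh.eq, conjDiag_add, mul_add, add_mul, hWW, e2, mul_smul_comm, mul_one, smul_mul_assoc,
      hsq, suppProj_conjDiag hU]
    congr 1
    ext a b
    simp only [Matrix.smul_apply, conjDiag_apply, smul_eq_mul, Finset.mul_sum]
    refine Finset.sum_congr rfl fun j _ => ?_
    by_cases hj : x j = 0 <;> simp [hj]
  have h4 := h2.add h3
  rw [e1, ← add_assoc, ← conjDiag_add, sub_add_cancel] at h4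
  exact h4

theorem face_sub_isHermitian {X Z Z' : Mat m} (hZ : Z ∈ face X) (hZ' : Z' ∈ face X) :
    (Z - Z').IsHermitian := hZ.1.1.isHermitian.sub hZ'.1.1.isHermitian

/-- A linear functional that attains its maximum over all states at `X` is constant on the face
of `X`. -/
theorem pair_eq_of_isMax {X V Z : Mat m} (hX : X ∈ densities m)
    (hV : ∀ Z ∈ densities m, pair V Z ≤ pair V X) (hZ : Z ∈ face X) : pair V Z = pair V X := by
  refine le_antisymm (hV Z hZ.1) ?_
  obtain ⟨μ, hμ, hadd⟩ := exists_forall_posSemidef_add hX.1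
  obtain ⟨s, hs, hsμ⟩ : ∃ s > 0, s * ‖X - Z‖ ≤ μ := by
    refine ⟨μ / (‖X - Z‖ + 1), by positivity, ?_⟩
    rw [div_mul_eq_mul_div, div_le_iff₀ (by positivity)]
    nlinarith [norm_nonneg (X - Z)]
  have hW : (s • (X - Z)).IsHermitian := by
    rw [Matrix.IsHermitian, Matrix.conjTranspose_smul,
      (face_sub_isHermitian (self_mem_face hX) hZ).eq, star_trivial]
  have hmem : X + s • (X - Z) ∈ densities m := by
    refine ⟨hadd _ hW (fun v hv => ?_) ?_, ?_⟩
    · rw [Matrix.smul_mulVec, Matrix.sub_mulVec, hv, hZ.2 v hv, sub_self, smul_zero]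
    · rwa [norm_smul, Real.norm_of_nonneg hs.le]
    · rw [Matrix.trace_add, Matrix.trace_smul, Matrix.trace_sub, hX.2, hZ.1.2]
      simp
  have h := hV _ hmem
  rw [pair_add_right, pair_smul_right, pair_sub_right] at h
  have h2 : s * (pair V X - pair V Z) ≤ 0 := by linarith
  nlinarith

/-- The rank-one matrix `v vᴴ`. -/
noncomputable def rankOne (v : Fin m → ℂ) : Mat m := Matrix.vecMulVec v (star v)

theorem rankOne_mulVec (v w : Fin m → ℂ) : (rankOne v).mulVec w = (star v ⬝ᵥ w) • v := by
  ext a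
  simp only [rankOne, Matrix.mulVec, Matrix.vecMulVec_apply, dotProduct, Pi.smul_apply, smul_eq_mul,
    Finset.sum_mul]
  exact Finset.sum_congr rfl fun j _ => by ring

theorem pair_rankOne (A : Mat m) (v : Fin m → ℂ) :
    pair A (rankOne v) = (star v ⬝ᵥ A.mulVec v).re := by
  rw [pair, rankOne, Matrix.trace_mul_comm, Matrix.vecMulVec_mul, Matrix.trace_vecMulVec,
    Matrix.dotProduct_mulVec, dotProduct_comm]

theorem rankOne_mem_densities {v : Fin m → ℂ} (hv : star v ⬝ᵥ v = 1) :
    rankOne v ∈ densities m := by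
  refine ⟨Matrix.posSemidef_vecMulVec_self_star v, ?_⟩
  rw [rankOne, Matrix.trace_vecMulVec, dotProduct_comm, hv]

/-- If a linear functional attains its maximum over all states at `X`, then the range of `X` is an
eigenspace of it: in an eigenbasis of `X`, the columns of positive weight are those of a multiple
of the identity. -/
theorem entry_eq_of_isMax {U V : Mat m} {x : Fin m → ℝ} (hU : U ∈ Matrix.unitaryGroup (Fin m) ℂ)
    (hX : conjDiag U x ∈ densities m) (hVh : V.IsHermitian)
    (hV : ∀ Z ∈ densities m, pair V Z ≤ pair V (conjDiag U x)) {α : Fin m} (hα : x α ≠ 0)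
    (β : Fin m) : (U.conjTranspose * V * U) β α =
      if β = α then (pair V (conjDiag U x) : ℂ) else 0 := by
  set l := pair V (conjDiag U x) with hl
  have hM : ((l : ℂ) • (1 : Mat m) - V).PosSemidef := by
    have hh : ((l : ℂ) • (1 : Mat m) - V).IsHermitian := by
      refine Matrix.IsHermitian.sub ?_ hVh
      rw [Matrix.IsHermitian, Matrix.conjTranspose_smul, Matrix.conjTranspose_one, Complex.star_def,
        Complex.conj_ofReal]
    obtain ⟨W, hW, w, hw⟩ := exists_conjDiag hh
    rw [hw, posSemidef_conjDiag_iff hW]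
    intro j
    have hZ : conjDiag W (Pi.single j 1) ∈ densities m :=
      conjDiag_mem_densities hW (fun k => by
        rcases eq_or_ne k j with rfl | hk
        · simp
        · simp [hk]) (by simp)
    have h1 := hV _ hZ
    have h2 : pair (conjDiag W w) (conjDiag W (Pi.single j 1)) = w j := by
      rw [pair, conjDiag_mul hW, trace_conjDiag hW, Complex.ofReal_re]
      simp [Pi.single_apply]
    have h3 : pair ((l : ℂ) • (1 : Mat m) - V) (conjDiag W (Pi.single j 1)) =
        l - pair V (conjDiag W (Pi.single j 1)) := by
      have h4 : pair ((l : ℂ) • (1 : Mat m)) (conjDiag W (Pi.single j 1)) = l := by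
        have h5 := hZ.2
        rw [pair, smul_mul_assoc, one_mul, Matrix.trace_smul, h5]
        simp
      rw [pair_sub_left, h4]
    rw [← h2, ← hw, h3]
    linarith
  set M := U.conjTranspose * ((l : ℂ) • (1 : Mat m) - V) * U with hMdef
  have hM' : M.PosSemidef := hM.conjTranspose_mul_mul_same U
  have hMe : M = (l : ℂ) • (1 : Mat m) - U.conjTranspose * V * U := by
    rw [hMdef, mul_sub, sub_mul, mul_smul_comm, mul_one, smul_mul_assoc,
      conjTranspose_mul_self_of_unitary hU]
  have hx0 := (posSemidef_conjDiag_iff hU x).1 hX.1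
  have hsum : ∑ j, x j * (M j j).re = 0 := by
    rw [hMdef, ← pair_conjDiag, pair_sub_right, pair_comm _ V, ← hl]
    have : pair (conjDiag U x) ((l : ℂ) • 1) = l := by
      rw [pair, mul_smul_comm, mul_one, Matrix.trace_smul, hX.2]
      simp
    rw [this, sub_self]
  have hnn : ∀ j, 0 ≤ (M j j).re := fun j => (Complex.le_def.1 hM'.diag_nonneg).1
  have h0 := (Finset.sum_eq_zero_iff_of_nonneg fun j _ => mul_nonneg (hx0 j) (hnn j)).1 hsum α
    (Finset.mem_univ α)
  have h1 : M α α = 0 := by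
    refine Complex.ext ?_ ?_
    · exact (mul_eq_zero.1 h0).resolve_left hα
    · exact (Complex.le_def.1 (hM'.diag_nonneg (i := α))).2.symm
  have h2 : M.mulVec (Pi.single α 1) = 0 := by
    rw [← hM'.dotProduct_mulVec_zero_iff]
    simp [h1]
  have h3 := congrFun h2 β
  rw [Matrix.mulVec_single_one, Matrix.col_apply, hMe, Matrix.sub_apply, Pi.zero_apply,
    sub_eq_zero, Matrix.smul_apply, Matrix.one_apply] at h3
  rw [← h3]
  by_cases hβ : β = α <;> simp [hβ]

end RelativeInterior

/-! ### Nash equilibria are rest points -/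

section Dynamics

variable {ι : Type*} [Fintype ι] [DecidableEq ι] {d : ι → ℕ} {Ω : Type*} [Fintype Ω]
  {G : QuantumGame ι d Ω} {θ : ι → Kernel}

theorem Kernel.qdEntry_eq_zero_of_isMax (θ : Kernel) {m : ℕ} {U V : Mat m} {x : Fin m → ℝ}
    (hU : U ∈ Matrix.unitaryGroup (Fin m) ℂ) (hX : conjDiag U x ∈ densities m)
    (hVh : V.IsHermitian) (hV : ∀ Z ∈ densities m, pair V Z ≤ pair V (conjDiag U x))
    (α β : Fin m) : θ.qdEntry x (U.conjTranspose * V * U) α β = 0 := by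
  have hx0 := (posSemidef_conjDiag_iff hU x).1 hX.1
  have hx1 : ∑ j, x j = 1 := by
    have := hX.2
    rw [trace_conjDiag hU] at this
    exact_mod_cast this
  have hd2 : ∀ j, x j ≠ 0 → 0 < θ.d2 (x j) := fun j hj =>
    θ.modulus_pos.trans_le
      (θ.modulus_le ⟨lt_of_le_of_ne (hx0 j) (Ne.symm hj), le_one_of_sum_eq_one hx0 hx1 j⟩)
  have hent : ∀ α, x α ≠ 0 → ∀ β, (U.conjTranspose * V * U) β α =
      if β = α then (pair V (conjDiag U x) : ℂ) else 0 :=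
    fun α hα β => entry_eq_of_isMax hU hX hVh hV hα β
  set W := U.conjTranspose * V * U
  rw [Kernel.qdEntry]
  split_ifs with h1 h2 h3
  · rfl
  · subst h2
    rw [or_self] at h1
    set l := pair V (conjDiag U x)
    set S : ℝ := ∑ γ with x γ ≠ 0, (θ.d2 (x γ))⁻¹ with hS
    have e1 : (∑ γ with x γ ≠ 0, W γ γ / (θ.d2 (x γ) : ℂ)) = ((l * S : ℝ) : ℂ) := by
      rw [hS, Finset.mul_sum, Complex.ofReal_sum]
      refine Finset.sum_congr rfl fun γ hγ => ?_
      rw [hent γ (by simpa using hγ), if_pos rfl]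
      push_cast
      rw [div_eq_mul_inv]
    have e2 : (∑ γ with x γ ≠ 0, θ.d2 (x α) / θ.d2 (x γ) : ℝ) = θ.d2 (x α) * S := by
      rw [hS, Finset.mul_sum]
      exact Finset.sum_congr rfl fun γ _ => div_eq_mul_inv _ _
    have hSpos : 0 < S := Finset.sum_pos
      (fun γ hγ => inv_pos.2 (hd2 γ (by simpa using hγ))) ⟨α, by simpa using h1⟩
    rw [e1, e2, hent α h1, if_pos rfl, ← Complex.ofReal_div, ← Complex.ofReal_div,
      mul_div_mul_right _ _ hSpos.ne', sub_self]
  · rw [hent β (not_or.1 h1).2, if_neg h2, zero_div]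
  · rw [hent β (not_or.1 h1).2, if_neg h2, mul_zero]

theorem QuantumGame.IsNash.qdFieldVanishes {X : Profile d} (hX : X ∈ states d)
    (h : G.IsNash X) (θ : ι → Kernel) : QDFieldVanishes G θ X := by
  intro i U hU x hx α β
  have hXi := hX i
  have hN := G.isNash_iff.1 h i
  change X i = conjDiag U x at hx
  rw [hx] at hXi hN
  exact (θ i).qdEntry_eq_zero_of_isMax hU hXi (G.isHermitian_grad (states_isHermitian hX) i) hN α β

/-- At a Nash equilibrium the payoff matrices `θ'(X) + t V(X)` keep the best response `X` for all
times, because `V(X)` is constant on the face of `X`. -/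
theorem QuantumGame.IsNash.isQDOrbit_const {X : Profile d} (hX : X ∈ states d)
    (h : G.IsNash X) (θ : ι → Kernel) : IsQDOrbit G θ X fun _ => X := by
  have hVh := G.isHermitian_grad (states_isHermitian hX)
  refine ⟨rfl, fun t i => cfc (θ i).d1 (X i) + t • G.grad X i, fun t i => ⟨?_, ?_, fun a b => ?_⟩⟩
  · refine (cfc_isHermitian _ (states_isHermitian hX i)).add ?_
    rw [Matrix.IsHermitian, Matrix.conjTranspose_smul, (hVh i).eq, star_trivial]
  · refine Kernel.isBestResponse_of_firstOrder (k := t * pair (G.grad X i) (X i))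
      (self_mem_face (hX i)) (self_mem_face (hX i)) fun Z hZ => ?_
    rw [pair_add_left, pair_smul_left, pair_eq_of_isMax (hX i) (G.isNash_iff.1 h i) hZ]
  · have h1 := ((hasDerivAt_id t).smul_const (G.grad X i a b)).const_add
      (cfc (θ i).d1 (X i) a b)
    rw [one_smul] at h1
    exact h1

theorem QuantumGame.IsNash.isRestPoint (hθ : ∀ i, (θ i).Steep) {Φ : ℝ → Profile d → Profile d}
    (hΦ : IsQDFlow G θ Φ) {X : Profile d} (hX : X ∈ states d) (h : G.IsNash X) :
    IsRestPoint G θ Φ X :=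
  ⟨h.qdFieldVanishes hX θ, fun t =>
    congrFun ((hΦ X hX).unique hθ hX (h.isQDOrbit_const hX θ)) t⟩

/-! ### Trajectories cannot be trapped near a state that is not a Nash equilibrium -/

theorem hasDerivWithinAt_pair {m : ℕ} {Y : ℝ → Mat m} {V : Mat m} {S : Set ℝ} {t : ℝ}
    (h : ∀ a b, HasDerivWithinAt (fun s => Y s a b) (V a b) S t) (W : Mat m) :
    HasDerivWithinAt (fun s => pair (Y s) W) (pair V W) S t := by
  have e : ∀ A : Mat m, pair A W = (∑ a, ∑ b, A a b * W b a).re := fun A => by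
    simp [pair, Matrix.trace, Matrix.mul_apply]
  simp only [e]
  have h1 : HasDerivWithinAt (fun s => ∑ a, ∑ b, Y s a b * W b a) (∑ a, ∑ b, V a b * W b a) S t :=
    HasDerivWithinAt.fun_sum fun a _ => HasDerivWithinAt.fun_sum fun b _ => (h a b).mul_const _
  exact Complex.reCLM.hasFDerivAt.comp_hasDerivWithinAt t h1

theorem continuous_pair {m : ℕ} {T : Type*} [TopologicalSpace T] {A B : T → Mat m}
    (hA : Continuous A) (hB : Continuous B) : Continuous fun t => pair (A t) (B t) :=
  Complex.continuous_re.comp (hA.matrix_mul hB).matrix_trace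

theorem continuous_grad_apply (G : QuantumGame ι d Ω) (i : ι) :
    Continuous fun X => G.grad X i :=
  (continuous_apply i).comp G.continuous_grad

/-- A state that is not a Nash equilibrium has a neighborhood in which no trajectory stays forever:
a profitable deviation would pile up an unbounded advantage over the states that are played, whereas
best responses keep this advantage bounded. -/
theorem QuantumGame.exists_nhds_not_trapped {P : Profile d} (hP : ¬ G.IsNash P)
    (θ : ι → Kernel) : ∃ N ∈ 𝓝 P, ∀ Y X : ℝ → Profile d, IsFTQL G θ Y X →
      ∀ t₀ ≥ 0, ¬ ∀ t ≥ t₀, X t ∈ N := by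
  rw [G.isNash_iff] at hP
  push Not at hP
  obtain ⟨i, Z, hZ, hlt⟩ := hP
  obtain ⟨c, hc, hcl⟩ : ∃ c > 0, c < pair (G.grad P i) (Z - P i) := by
    refine ⟨(pair (G.grad P i) (Z - P i)) / 2, ?_, ?_⟩ <;> rw [pair_sub_right] <;> linarith
  have hcont : Continuous fun q : Profile d × Profile d => pair (G.grad q.1 i) (Z - q.2 i) :=
    continuous_pair ((continuous_grad_apply G i).comp continuous_fst)
      (continuous_const.sub ((continuous_apply i).comp continuous_snd))
  have hev : ∀ᶠ q in 𝓝 P ×ˢ 𝓝 P, c < pair (G.grad q.1 i) (Z - q.2 i) := by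
    rw [← nhds_prod_eq]
    exact (hcont.tendsto (P, P)).eventually (lt_mem_nhds hcl)
  obtain ⟨N, hN, hNc⟩ := eventually_prod_self_iff
    (r := fun A B : Profile d => c < pair (G.grad A i) (Z - B i)) |>.1 hev
  refine ⟨N, hN, fun Y X hYX t₀ ht₀ htrap => ?_⟩
  obtain ⟨M, hM0, hM⟩ := (θ i).exists_reg_bound (d i)
  have hbound : ∀ t ≥ t₀, c * (t - t₀) ≤ 2 * M + 2 * ‖Y t₀ i‖ := by
    intro t ht
    set g : ℝ → ℝ := fun s => pair (Y s i) (Z - X t i)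
    have hder : ∀ s ≥ 0, HasDerivWithinAt g (pair (G.grad (X s) i) (Z - X t i)) (Set.Ici 0) s :=
      fun s hs => hasDerivWithinAt_pair (fun a b => (hYX s hs i).2.2 a b) _
    have hXt := (hYX t (ht₀.trans ht) i).2.1
    rw [Kernel.isBestResponse_iff] at hXt
    have h1 : c * (t - t₀) ≤ g t - g t₀ := by
      refine (convex_Icc t₀ t).mul_sub_le_image_sub_of_le_deriv (f := g) ?_ ?_ ?_ t₀ ⟨le_rfl, ht⟩ t
        ⟨ht, le_rfl⟩ ht
      · intro s hs
        exact ((hder s (ht₀.trans hs.1)).continuousWithinAt).mono fun r hr => ht₀.trans hr.1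
      · intro s hs
        rw [interior_Icc] at hs
        exact ((hder s (ht₀.trans hs.1.le)).hasDerivAt
          (Ici_mem_nhds (ht₀.trans_lt hs.1))).differentiableAt.differentiableWithinAt
      · intro s hs
        rw [interior_Icc] at hs
        rw [((hder s (ht₀.trans hs.1.le)).hasDerivAt (Ici_mem_nhds (ht₀.trans_lt hs.1))).deriv]
        exact (hNc _ (htrap s hs.1.le) _ (htrap t ht)).le
    have h2 : g t ≤ 2 * M := by
      have h3 := hXt.2 Z hZ
      have h4 := abs_le.1 (hM Z hZ)
      have h5 := abs_le.1 (hM _ hXt.1)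
      simp only [g, pair_sub_right]
      linarith [h4.2, h5.1]
    have h3 : -(2 * ‖Y t₀ i‖) ≤ g t₀ := by
      have h4 := (abs_le.1 (abs_pair_le (Y t₀ i) (Z - X t i))).1
      have h5 : ‖Z - X t i‖ ≤ 2 := (norm_sub_le _ _).trans (by
        linarith [norm_le_one_of_mem_densities hZ, norm_le_one_of_mem_densities hXt.1])
      have := mul_le_mul_of_nonneg_left h5 (norm_nonneg (Y t₀ i))
      simp only [g]
      linarith
    linarith
  have h := hbound (t₀ + ((2 * M + 2 * ‖Y t₀ i‖) / c + 1))
    (by have : 0 ≤ (2 * M + 2 * ‖Y t₀ i‖) / c := by positivity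
        linarith)
  rw [add_sub_cancel_left, mul_add, mul_div_cancel₀ _ hc.ne'] at h
  linarith

theorem IsFTQL.isNash_of_tendsto {Y X : ℝ → Profile d} (h : IsFTQL G θ Y X) {P : Profile d}
    (hlim : Tendsto X atTop (𝓝 P)) : G.IsNash P := by
  by_contra hP
  obtain ⟨N, hN, htrap⟩ := G.exists_nhds_not_trapped hP θ
  obtain ⟨T, hT⟩ := eventually_atTop.1 (hlim.eventually hN)
  exact htrap Y X h (max T 0) (le_max_right _ _) fun t ht => hT t ((le_max_left _ _).trans ht)

theorem IsQDOrbit.exists_isFTQL {X₀ : Profile d} {X : ℝ → Profile d} (h : IsQDOrbit G θ X₀ X)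
    (hfull : ∀ i, face (X₀ i) = densities (d i)) : ∃ Y, IsFTQL G θ Y X := by
  obtain ⟨-, Y, hY⟩ := h
  refine ⟨Y, fun t _ i => ⟨(hY t i).1, ?_, fun a b => ((hY t i).2.2 a b).hasDerivWithinAt⟩⟩
  rw [← hfull i]
  exact (hY t i).2.1

/-- States of full rank are dense: every neighborhood of a state contains one. -/
theorem exists_full_rank_mem {P : Profile d} (hP : P ∈ states d) {N : Set (Profile d)}
    (hN : N ∈ 𝓝 P) : ∃ X ∈ N ∩ states d, ∀ i, face (X i) = densities (d i) := by
  have hd : ∀ i, 0 < d i := by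
    intro i
    by_contra h0
    have h1 : d i = 0 := by omega
    have : IsEmpty (Fin (d i)) := by rw [h1]; infer_instance
    have h2 := (hP i).2
    simp [Matrix.trace] at h2
  -- Mix in a little of the maximally mixed state.
  set C : Profile d := fun i => ((d i : ℝ)⁻¹) • (1 : Mat (d i)) with hC
  have hCdens : C ∈ states d := by
    intro i
    have h0 : (d i : ℂ) ≠ 0 := by exact_mod_cast (hd i).ne'
    refine ⟨Matrix.PosSemidef.one.smul (by positivity), ?_⟩
    simp [hC, Matrix.trace_smul, h0]
  have hcont : Continuous fun ε : ℝ => P + ε • (C - P) := by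
    refine continuous_pi fun i => ?_
    exact continuous_const.add (continuous_id.smul continuous_const)
  have h0 : Tendsto (fun ε : ℝ => P + ε • (C - P)) (𝓝[>] 0) (𝓝 P) := by
    have := (hcont.tendsto 0).mono_left (nhdsWithin_le_nhds (s := Set.Ioi (0 : ℝ)))
    simpa using this
  have h1 : ∀ᶠ ε : ℝ in 𝓝[>] 0, ε ∈ Set.Ioc (0 : ℝ) 1 := Ioc_mem_nhdsGT one_pos
  obtain ⟨ε, hεN, hε⟩ := ((h0.eventually hN).and h1).exists
  have hmem : P + ε • (C - P) ∈ states d := fun i =>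
    (convex_densities (m := d i)).add_smul_sub_mem (hP i) (hCdens i) ⟨hε.1.le, hε.2⟩
  refine ⟨_, ⟨hεN, hmem⟩, fun i => Set.Subset.antisymm (fun Z hZ => hZ.1) fun Z hZ => ⟨hZ, ?_⟩⟩
  have hpos : ((P + ε • (C - P)) i).PosDef := by
    have e : (P + ε • (C - P)) i = (ε * (d i : ℝ)⁻¹) • (1 : Mat (d i)) + (1 - ε) • P i := by
      simp only [Pi.add_apply, Pi.smul_apply, Pi.sub_apply, hC, smul_sub, sub_smul, smul_smul,
        one_smul]
      abel
    rw [e]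
    have hpos' : 0 < ε * (d i : ℝ)⁻¹ := mul_pos hε.1 (inv_pos.2 (by exact_mod_cast hd i))
    exact (Matrix.PosDef.one.smul hpos').add_posSemidef ((hP i).1.smul (sub_nonneg.2 hε.2))
  intro v hv
  have : v = 0 := by
    by_contra hne
    have := hpos.dotProduct_mulVec_pos hne
    rw [hv, dotProduct_zero] at this
    exact lt_irrefl _ this
  rw [this, Matrix.mulVec_zero]

/-- Stability traps the orbits of nearby states. Those of full rank are trajectories of follow the
quantum leader. -/
theorem LyapunovStable.isNash {Φ : ℝ → Profile d → Profile d} (hΦ : IsQDFlow G θ Φ)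
    {P : Profile d} (hP : P ∈ states d) (h : LyapunovStable Φ P) : G.IsNash P := by
  by_contra hN
  obtain ⟨N, hNP, htrap⟩ := G.exists_nhds_not_trapped hN θ
  obtain ⟨U', hU', hstab⟩ := h N hNP
  obtain ⟨X, hX, hfull⟩ := exists_full_rank_mem hP hU'
  obtain ⟨Y, hY⟩ := (hΦ X hX.2).exists_isFTQL hfull
  exact htrap Y _ hY 0 le_rfl (hstab X hX)

/-! ### The flow property -/

theorem IsQDOrbit.mem_face (hθ : ∀ i, (θ i).Steep) {X₀ : Profile d} (hX₀ : X₀ ∈ states d)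
    {X : ℝ → Profile d} (h : IsQDOrbit G θ X₀ X) (t : ℝ) (i : ι) :
    X t i ∈ face (X₀ i) ∧ X₀ i ∈ face (X t i) := by
  obtain ⟨-, Y, hY⟩ := h
  obtain ⟨h1, h2, -⟩ := (hY t i).2.1.firstOrder (hθ i) (hX₀ i) (hY t i).1
  exact ⟨h1, h2⟩

theorem IsQDOrbit.mem_states {X₀ : Profile d} {X : ℝ → Profile d} (h : IsQDOrbit G θ X₀ X)
    (t : ℝ) : X t ∈ states d := by
  obtain ⟨-, Y, hY⟩ := h
  exact fun i => (hY t i).2.1.1.1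

theorem IsQDOrbit.shift (hθ : ∀ i, (θ i).Steep) {X₀ : Profile d} (hX₀ : X₀ ∈ states d)
    {X : ℝ → Profile d} (h : IsQDOrbit G θ X₀ X) (s : ℝ) :
    IsQDOrbit G θ (X s) fun t => X (s + t) := by
  have hface : ∀ i, face (X s i) = face (X₀ i) := fun i =>
    face_eq_of_mem (h.mem_face hθ hX₀ s i).1 (h.mem_face hθ hX₀ s i).2
  obtain ⟨-, Y, hY⟩ := h
  refine ⟨by simp, fun t => Y (s + t), fun t i => ⟨(hY (s + t) i).1, ?_, fun a b => ?_⟩⟩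
  · rw [hface i]
    exact (hY (s + t) i).2.1
  · exact ((hY (s + t) i).2.2 a b).comp_const_add s t

theorem IsQDFlow.add (hθ : ∀ i, (θ i).Steep) {Φ : ℝ → Profile d → Profile d}
    (hΦ : IsQDFlow G θ Φ) {X : Profile d} (hX : X ∈ states d) (s t : ℝ) :
    Φ t (Φ s X) = Φ (s + t) X := by
  have h := hΦ X hX
  have h2 := hΦ (Φ s X) (h.mem_states s)
  exact congrFun (h2.unique hθ (h.mem_states s) (h.shift hθ hX s)) t

theorem IsQDOrbit.continuous (hθ : ∀ i, (θ i).Steep) {X₀ : Profile d} (hX₀ : X₀ ∈ states d)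
    {X : ℝ → Profile d} (h : IsQDOrbit G θ X₀ X) : Continuous X := by
  obtain ⟨-, Y, hY⟩ := h
  have hYc : Continuous Y := continuous_iff_continuousAt.2 fun t =>
    (hasDerivAt_profile_iff.2 fun i => (hY t i).2.2 : HasDerivAt Y (G.grad (X t)) t).continuousAt
  have hX : X = fun t => bestResponses θ X₀ (Y t) := funext fun t => funext fun i =>
    (hθ i).eq_bestResponse (hX₀ i) (hY t i).1 (hY t i).2.1
  rw [hX]
  exact (lipschitzWith_bestResponses hθ hX₀).continuous.comp hYc

end Dynamics

/-! ### Compactness of the state space -/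

theorem isClosed_densities (m : ℕ) : IsClosed (densities m) := by
  have h : densities m = {X : Mat m | X.conjTranspose = X} ∩
      (⋂ v : Fin m → ℂ, {X : Mat m | 0 ≤ star v ⬝ᵥ X.mulVec v}) ∩ {X : Mat m | X.trace = 1} := by
    ext X
    simp only [densities, Matrix.posSemidef_iff_dotProduct_mulVec, Matrix.IsHermitian,
      Set.mem_ofPred_eq, Set.mem_inter_iff, Set.mem_iInter]
  rw [h]
  refine (IsClosed.inter ?_ (isClosed_iInter fun v => ?_)).inter ?_
  · exact isClosed_eq (continuous_id.matrix_conjTranspose) continuous_id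
  · exact isClosed_le continuous_const
      (continuous_const.dotProduct (continuous_id.matrix_mulVec continuous_const))
  · exact isClosed_eq continuous_id.matrix_trace continuous_const

theorem isCompact_densities (m : ℕ) : IsCompact (densities m) :=
  (isCompact_closedBall (0 : Mat m) 1).of_isClosed_subset (isClosed_densities m) fun X hX => by
    simpa using norm_le_one_of_mem_densities hX

theorem isCompact_states {ι : Type*} [Fintype ι] (d : ι → ℕ) : IsCompact (states d) := by
  have h : states d = Set.univ.pi fun i => densities (d i) := by
    ext X
    simp [states]
  rw [h]
  exact isCompact_univ_pi fun i => isCompact_densities (d i)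

/-! ### The Fenchel coupling along an orbit -/

section Fenchel

/-- The value of the regularized best response problem is differentiable along a curve of payoff
matrices, with the derivative that treats the best response as frozen: by strong convexity the
response moves no faster than the payoffs, which makes its effect of second order. -/
theorem hasDerivAt_value {θ : Kernel} (hθ : θ.Steep) {m : ℕ} {X₀ : Mat m}
    (hX₀ : X₀ ∈ densities m) {Y X : ℝ → Mat m} (hY : ∀ t, (Y t).IsHermitian)
    (hX : ∀ t, θ.IsBestResponse (face X₀) (Y t) (X t)) {V : Mat m} {t : ℝ}
    (hV : HasDerivAt Y V t) :
    HasDerivAt (fun s => pair (Y s) (X s) - θ.reg (X s)) (pair V (X t)) t := by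
  set R : ℝ → ℝ := fun s => (pair (Y s) (X s) - θ.reg (X s)) - (pair (Y s) (X t) - θ.reg (X t))
  have hR : ∀ s, ‖R s‖ ≤ θ.modulus⁻¹ * ‖‖Y s - Y t‖ ^ 2‖ := by
    intro s
    have h1 := (Kernel.isBestResponse_iff.1 (hX s)).2 _ (hX t).1
    have h2 := (Kernel.isBestResponse_iff.1 (hX t)).2 _ (hX s).1
    have h3 : R s ≤ pair (Y s - Y t) (X s - X t) := by
      simp only [R, pair_sub_left, pair_sub_right]
      linarith
    have h4 := (hX s).norm_sub_le hθ hX₀ (hY s) (hY t) (hX t)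
    have h5 := (le_abs_self _).trans (abs_pair_le (Y s - Y t) (X s - X t))
    have h6 := mul_le_mul_of_nonneg_left h4 (norm_nonneg (Y s - Y t))
    rw [Real.norm_of_nonneg (sub_nonneg.2 h1), norm_pow, norm_norm]
    refine h3.trans (h5.trans (h6.trans (le_of_eq ?_)))
    ring
  have hO : (fun s => Y s - Y t) =O[𝓝 t] fun s => s - t := hV.isBigO_sub
  have hO2 : R =O[𝓝 t] fun s => ‖s - t‖ ^ 2 :=
    (Asymptotics.IsBigO.of_bound _ (Eventually.of_forall hR)).trans (hO.norm_norm.pow 2)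
  have hR0 : HasDerivAt R 0 t := by
    have h1 : HasFDerivAt R (0 : ℝ →L[ℝ] ℝ) t := hO2.hasFDerivAt one_lt_two
    simpa using h1.hasDerivAt
  have hlin : HasDerivAt (fun s => pair (Y s) (X t) - θ.reg (X t)) (pair V (X t)) t := by
    have h1 : ∀ a b, HasDerivWithinAt (fun s => Y s a b) (V a b) Set.univ t := fun a b =>
      (hasDerivAt_pi.1 (hasDerivAt_pi.1 hV a) b).hasDerivWithinAt
    exact (hasDerivWithinAt_univ.1 (hasDerivWithinAt_pair h1 (X t))).sub_const _
  have := hlin.add hR0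
  rw [add_zero] at this
  refine this.congr_of_eventuallyEq (Eventually.of_forall fun s => ?_)
  simp only [R, Pi.add_apply]
  ring

variable {ι : Type*} [Fintype ι] [DecidableEq ι] {d : ι → ℕ} {Ω : Type*} [Fintype Ω]
  {G : QuantumGame ι d Ω} {θ : ι → Kernel}

/-- The loss of the response `P` to the payoff matrix `Y` against the response `X`. If `X` is the
best response, this is the Fenchel coupling of `P` and `Y`. -/
noncomputable def Kernel.coupling (θ : Kernel) {m : ℕ} (P Y X : Mat m) : ℝ :=
  (pair Y X - θ.reg X) - (pair Y P - θ.reg P)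

/-- An orbit together with payoff matrices that generate it. -/
structure IsLift (G : QuantumGame ι d Ω) (θ : ι → Kernel) (X₀ : Profile d)
    (X Y : ℝ → Profile d) : Prop where
  isHermitian : ∀ t i, (Y t i).IsHermitian
  isBestResponse : ∀ t i, (θ i).IsBestResponse (face (X₀ i)) (Y t i) (X t i)
  hasDerivAt : ∀ t, HasDerivAt Y (G.grad (X t)) t

theorem IsQDOrbit.exists_isLift {X₀ : Profile d} {X : ℝ → Profile d} (h : IsQDOrbit G θ X₀ X) :
    ∃ Y, IsLift G θ X₀ X Y := by
  obtain ⟨-, Y, hY⟩ := h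
  exact ⟨Y, fun t i => (hY t i).1, fun t i => (hY t i).2.1,
    fun t => hasDerivAt_profile_iff.2 fun i => (hY t i).2.2⟩

theorem IsLift.hasDerivAt_coupling (hθ : ∀ i, (θ i).Steep) {X₀ : Profile d} (hX₀ : X₀ ∈ states d)
    {X Y : ℝ → Profile d} (h : IsLift G θ X₀ X Y) (P : Profile d) (t : ℝ) :
    HasDerivAt (fun s => ∑ i, (θ i).coupling (P i) (Y s i) (X s i))
      (∑ i, pair (G.grad (X t) i) (X t i - P i)) t := by
  refine HasDerivAt.fun_sum fun i _ => ?_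
  have hi : HasDerivAt (fun s => Y s i) (G.grad (X t) i) t := hasDerivAt_pi.1 (h.hasDerivAt t) i
  have h1 := hasDerivAt_value (hθ i) (hX₀ i) (fun s => h.isHermitian s i)
    (fun s => h.isBestResponse s i) hi
  have h2 : HasDerivAt (fun s => pair (Y s i) (P i) - (θ i).reg (P i))
      (pair (G.grad (X t) i) (P i)) t := by
    have h3 : ∀ a b, HasDerivWithinAt (fun s => Y s i a b) (G.grad (X t) i a b) Set.univ t :=
      fun a b => (hasDerivAt_pi.1 (hasDerivAt_pi.1 hi a) b).hasDerivWithinAt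
    exact (hasDerivWithinAt_univ.1 (hasDerivWithinAt_pair h3 (P i))).sub_const _
  rw [pair_sub_right]
  exact h1.sub h2

theorem IsLift.le_coupling (hθ : ∀ i, (θ i).Steep) {X₀ : Profile d} (hX₀ : X₀ ∈ states d)
    {X Y : ℝ → Profile d} (h : IsLift G θ X₀ X Y) (t : ℝ) (i : ι) {P : Mat (d i)}
    (hP : P ∈ face (X₀ i)) :
    (θ i).modulus / 2 * ‖P - X t i‖ ^ 2 ≤ (θ i).coupling P (Y t i) (X t i) :=
  (h.isBestResponse t i).strong (hθ i) (hX₀ i) (h.isHermitian t i) hP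

theorem IsLift.coupling_nonneg {X₀ : Profile d}
    {X Y : ℝ → Profile d} (h : IsLift G θ X₀ X Y) (t : ℝ) (i : ι) {P : Mat (d i)}
    (hP : P ∈ face (X₀ i)) : 0 ≤ (θ i).coupling P (Y t i) (X t i) :=
  sub_nonneg.2 ((Kernel.isBestResponse_iff.1 (h.isBestResponse t i)).2 P hP)

/-- A bound on the velocity integrates to a bound on the growth of the Fenchel coupling. -/
theorem IsLift.sum_coupling_sub_le (hθ : ∀ i, (θ i).Steep) {X₀ : Profile d}
    (hX₀ : X₀ ∈ states d) {X Y : ℝ → Profile d} (h : IsLift G θ X₀ X Y) (P : Profile d) {T C : ℝ}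
    (hT : 0 ≤ T) (hC : ∀ t ∈ Set.Ioo 0 T, ∑ i, pair (G.grad (X t) i) (X t i - P i) ≤ C) :
    ∑ i, (θ i).coupling (P i) (Y T i) (X T i) -
      ∑ i, (θ i).coupling (P i) (Y 0 i) (X 0 i) ≤ C * T := by
  have hd := h.hasDerivAt_coupling hθ hX₀ P
  have h1 := (convex_Icc 0 T).image_sub_le_mul_sub_of_deriv_le
    (f := fun s => ∑ i, (θ i).coupling (P i) (Y s i) (X s i)) (C := C)
    (fun s _ => (hd s).continuousAt.continuousWithinAt)
    (fun s _ => (hd s).differentiableAt.differentiableWithinAt)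
    (fun s hs => by
      rw [interior_Icc] at hs
      rw [(hd s).deriv]
      exact hC s hs) 0 ⟨le_rfl, hT⟩ T ⟨hT, le_rfl⟩ hT
  rwa [sub_zero] at h1

end Fenchel

/-! ### Near-optimal states when the payoff matrix has a spectral gap -/

section Gap

variable {m : ℕ}

theorem conjDiag_single (U : Mat m) (j : Fin m) :
    conjDiag U (Pi.single j 1) = rankOne fun a => U a j := by
  ext a b
  rw [conjDiag_apply, Finset.sum_eq_single j]
  · simp [rankOne, Matrix.vecMulVec_apply]
  · intro k _ hk
    simp [hk]
  · simp

theorem pair_conjDiag_single (U A : Mat m) (j : Fin m) :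
    pair A (conjDiag U (Pi.single j 1)) = ((U.conjTranspose * A * U) j j).re := by
  rw [pair_comm, pair_conjDiag, Finset.sum_eq_single j]
  · simp
  · intro k _ hk
    simp [hk]
  · simp

theorem rankOne_mulVec_basis {U : Mat m} (c : Fin m → ℂ) :
    U.conjTranspose * rankOne (U.mulVec c) * U =
      rankOne ((U.conjTranspose * U).mulVec c) := by
  rw [rankOne, rankOne, Matrix.mul_vecMulVec, Matrix.vecMulVec_mul, Matrix.mulVec_mulVec,
    Matrix.star_mulVec, Matrix.vecMul_vecMul, Matrix.star_mulVec, Matrix.conjTranspose_mul,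
    Matrix.conjTranspose_conjTranspose]

theorem diag_re_nonneg {U Z : Mat m} (hZ : Z.PosSemidef) (j : Fin m) :
    0 ≤ ((U.conjTranspose * Z * U) j j).re :=
  (Complex.le_def.1 (hZ.conjTranspose_mul_mul_same U).diag_nonneg).1

theorem sum_diag_re {U Z : Mat m} (hU : U ∈ Matrix.unitaryGroup (Fin m) ℂ)
    (hZ : Z ∈ densities m) : ∑ j, ((U.conjTranspose * Z * U) j j).re = 1 := by
  have h := pair_one_of_mem_densities hZ
  rw [← conjDiag_one hU, pair_conjDiag] at h
  simpa using h

/-- In any plane there is a unit vector orthogonal to a given vector. -/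
theorem exists_unit_combination (a b : ℂ) :
    ∃ α β : ℂ, α * a + β * b = 0 ∧ ‖α‖ ^ 2 + ‖β‖ ^ 2 = 1 := by
  by_cases h : a = 0 ∧ b = 0
  · exact ⟨0, 1, by simp [h.1, h.2], by simp⟩
  · have hs : 0 < ‖a‖ ^ 2 + ‖b‖ ^ 2 := by
      rcases not_and_or.1 h with h | h
      · have := norm_pos_iff.2 h; positivity
      · have := norm_pos_iff.2 h; positivity
    have hn : ‖(((Real.sqrt (‖a‖ ^ 2 + ‖b‖ ^ 2))⁻¹ : ℝ) : ℂ)‖ ^ 2 = (‖a‖ ^ 2 + ‖b‖ ^ 2)⁻¹ := by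
      rw [Complex.norm_real, norm_inv, Real.norm_of_nonneg (Real.sqrt_nonneg _), inv_pow,
        Real.sq_sqrt hs.le]
    refine ⟨((Real.sqrt (‖a‖ ^ 2 + ‖b‖ ^ 2))⁻¹ : ℝ) * b,
      -(((Real.sqrt (‖a‖ ^ 2 + ‖b‖ ^ 2))⁻¹ : ℝ) * a), by ring, ?_⟩
    rw [norm_neg, norm_mul, norm_mul, mul_pow, mul_pow, hn, ← mul_add, add_comm (‖b‖ ^ 2),
      inv_mul_cancel₀ hs.ne']

/-- Suppose that `Y` gives every pure state of the face of `X₀` that is orthogonal to `e` a payoff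
lower by `g` than that of `X₀`. In an eigenbasis of the best response `X`, all eigenvectors but the
top one then have a first-order payoff lower by `g` than the top one, since the plane that one of
them spans with the top one contains a vector orthogonal to `e`. Hence states of the face with a
nearly optimal payoff, in particular `X` and `X₀`, are close to the top eigenprojection. -/
theorem Kernel.IsBestResponse.norm_sub_sq_le_of_gap {θ : Kernel} (hθ : θ.Steep) {X₀ X Y : Mat m}
    (hX₀ : X₀ ∈ densities m) (hY : Y.IsHermitian) (h : θ.IsBestResponse (face X₀) Y X)
    {M g η : ℝ} (hM : ∀ Z ∈ densities m, |θ.reg Z| ≤ M) {e : Fin m → ℂ} (hg : 0 < g)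
    (hgap : ∀ w, star w ⬝ᵥ w = 1 → star e ⬝ᵥ w = 0 → rankOne w ∈ face X₀ →
      g ≤ pair Y X₀ - pair Y (rankOne w))
    (hη : pair Y X - pair Y X₀ ≤ η) : ‖X - X₀‖ ^ 2 ≤ (16 * M + 4 * η) / g := by
  obtain ⟨hX, hX', k, hk⟩ := h.firstOrder hθ hX₀ hY
  have hfe := face_eq_of_mem hX hX'
  obtain ⟨U, hU, x, rfl, hx0, hx1⟩ := exists_conjDiag_of_mem_densities hX.1
  set q : Mat m → Fin m → ℝ := fun Z j => ((U.conjTranspose * Z * U) j j).re with hq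
  have hYZ : ∀ Z ∈ face X₀, pair Y Z = ∑ j, θ.d1 (x j) * q Z j + k := by
    intro Z hZ
    rw [hk Z hZ, cfc_conjDiag hU, pair_conjDiag]
    rfl
  have hne : (Finset.univ : Finset (Fin m)).Nonempty := by
    rw [Finset.nonempty_iff_ne_empty]
    intro h0
    rw [h0, Finset.sum_empty] at hx1
    exact zero_ne_one hx1
  obtain ⟨p, -, hp⟩ := Finset.exists_max_image Finset.univ x hne
  have hxp : 0 < x p := by
    by_contra hcon
    have : ∑ j, x j ≤ 0 := Finset.sum_nonpos fun j _ => (hp j (Finset.mem_univ j)).trans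
      (not_lt.1 hcon)
    linarith
  have hle1 := le_one_of_sum_eq_one hx0 hx1
  have hΔ0 : ∀ j, x j ≠ 0 → θ.d1 (x j) ≤ θ.d1 (x p) := fun j hj =>
    θ.d1_strictMonoOn.monotoneOn ⟨lt_of_le_of_ne (hx0 j) (Ne.symm hj), hle1 j⟩ ⟨hxp, hle1 p⟩
      (hp j (Finset.mem_univ j))
  -- The loss of a state against the top eigenvector is the weighted sum of the differences of
  -- eigenvalues.
  have hdef : ∀ A ∈ face X₀, θ.d1 (x p) + k - pair Y A =
      ∑ j, (θ.d1 (x p) - θ.d1 (x j)) * q A j := by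
    intro A hA
    have h1 : ∑ j, q A j = 1 := sum_diag_re hU hA.1
    simp only [sub_mul, Finset.sum_sub_distrib, ← Finset.mul_sum, h1, hYZ A hA]
    ring
  have hq0 : ∀ A ∈ face X₀, ∀ j, x j = 0 → q A j = 0 := by
    intro A hA j hj
    rw [← hfe] at hA
    simp only [hq, face_col_eq_zero hU hA hj, Complex.zero_re]
  have hqn : ∀ A ∈ face X₀, ∀ j, 0 ≤ q A j := fun A hA j => diag_re_nonneg hA.1.1 j
  have hterm : ∀ A ∈ face X₀, ∀ j, 0 ≤ (θ.d1 (x p) - θ.d1 (x j)) * q A j := by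
    intro A hA j
    by_cases hj : x j = 0
    · rw [hq0 A hA j hj, mul_zero]
    · exact mul_nonneg (sub_nonneg.2 (hΔ0 j hj)) (hqn A hA j)
  -- Each occupied eigenvector other than the top one lies below it by `g`: test `hgap` with a unit
  -- vector `w = U c` of the plane they span that is orthogonal to `e`.
  have hgapj : ∀ j, j ≠ p → x j ≠ 0 → g ≤ θ.d1 (x p) - θ.d1 (x j) := by
    intro j hjp hj
    obtain ⟨α, β, horth, hunit⟩ := exists_unit_combination
      (star e ⬝ᵥ U.mulVec (Pi.single p 1)) (star e ⬝ᵥ U.mulVec (Pi.single j 1))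
    set c : Fin m → ℂ := α • Pi.single p 1 + β • Pi.single j 1 with hc
    have hcp : c p = α := by simp [hc, hjp.symm]
    have hcj : c j = β := by simp [hc, hjp]
    have hcl : ∀ l, l ≠ p → l ≠ j → c l = 0 := fun l h1 h2 => by simp [hc, h1, h2]
    have hsum : ∀ f : Fin m → ℂ, (∀ l, l ≠ p → l ≠ j → f l = 0) → ∑ l, f l = f p + f j := by
      intro f hf
      rw [← Finset.sum_pair hjp.symm]
      symm
      refine Finset.sum_subset (Finset.subset_univ _) fun l _ hl => ?_
      simp only [Finset.mem_insert, Finset.mem_singleton, not_or] at hl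
      exact hf l hl.1 hl.2
    have hsq : ∀ z : ℂ, star z * z = ((‖z‖ ^ 2 : ℝ) : ℂ) := fun z => by
      rw [Complex.star_def, ← Complex.normSq_eq_conj_mul_self, Complex.normSq_eq_norm_sq]
    have hcc : star c ⬝ᵥ c = 1 := by
      rw [dotProduct, hsum _ fun l h1 h2 => by simp [hcl l h1 h2]]
      simp only [Pi.star_apply, hcp, hcj, hsq]
      exact_mod_cast hunit
    have hww : star (U.mulVec c) ⬝ᵥ U.mulVec c = 1 := by
      rw [Matrix.star_mulVec, ← Matrix.dotProduct_mulVec, Matrix.mulVec_mulVec,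
        conjTranspose_mul_self_of_unitary hU, Matrix.one_mulVec, hcc]
    have hew : star e ⬝ᵥ U.mulVec c = 0 := by
      rw [hc, Matrix.mulVec_add, Matrix.mulVec_smul, Matrix.mulVec_smul, dotProduct_add,
        dotProduct_smul, dotProduct_smul, smul_eq_mul, smul_eq_mul, horth]
    have hwf : rankOne (U.mulVec c) ∈ face X₀ := by
      rw [← hfe]
      refine ⟨rankOne_mem_densities hww, fun v hv => ?_⟩
      rw [conjDiag_mulVec_eq_zero_iff hU] at hv
      rw [rankOne_mulVec, Matrix.star_mulVec, ← Matrix.dotProduct_mulVec, dotProduct,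
        hsum _ fun l h1 h2 => by simp [hcl l h1 h2], (hv p).resolve_left hxp.ne',
        (hv j).resolve_left hj]
      simp
    have hqw : ∀ l, q (rankOne (U.mulVec c)) l = ‖c l‖ ^ 2 := by
      intro l
      simp only [hq]
      rw [rankOne_mulVec_basis, conjTranspose_mul_self_of_unitary hU, Matrix.one_mulVec, rankOne,
        Matrix.vecMulVec_apply, Pi.star_apply, mul_comm, hsq, Complex.ofReal_re]
    have h1 := hgap _ hww hew hwf
    have h2 := hdef _ hwf
    have h3 : ∑ l, (θ.d1 (x p) - θ.d1 (x l)) * q (rankOne (U.mulVec c)) l =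
        (θ.d1 (x p) - θ.d1 (x j)) * ‖β‖ ^ 2 := by
      rw [Finset.sum_eq_single j]
      · rw [hqw, hcj]
      · intro l _ hl
        by_cases hlp : l = p
        · rw [hlp, sub_self, zero_mul]
        · rw [hqw, hcl l hlp hl]; simp
      · simp
    have h4 := hdef _ (self_mem_face hX₀)
    have h5 : 0 ≤ ∑ l, (θ.d1 (x p) - θ.d1 (x l)) * q X₀ l :=
      Finset.sum_nonneg fun l _ => hterm _ (self_mem_face hX₀) l
    have h6 : ‖β‖ ^ 2 ≤ 1 := by linarith [sq_nonneg ‖α‖]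
    have h7 := mul_le_mul_of_nonneg_left h6 (sub_nonneg.2 (hΔ0 j hj))
    linarith
  -- Near-optimality controls the weight outside the top eigenvector, hence the distance to it.
  set R := conjDiag U (Pi.single p 1) with hR
  have hRdens : R ∈ densities m := conjDiag_mem_densities hU (fun j => by
    rcases eq_or_ne j p with rfl | hj
    · simp
    · simp [hj]) (by simp)
  have hRf : R ∈ face X₀ := by
    rw [← hfe]
    refine ⟨hRdens, fun v hv => ?_⟩
    rw [conjDiag_mulVec_eq_zero_iff hU] at hv ⊢
    intro j
    rcases eq_or_ne j p with rfl | hj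
    · exact Or.inr ((hv j).resolve_left hxp.ne')
    · exact Or.inl (by simp [hj])
  have hdist : ∀ A ∈ face X₀, g * ‖A - R‖ ^ 2 ≤ 2 * (θ.d1 (x p) + k - pair Y A) := by
    intro A hA
    have h1 : ‖A - R‖ ^ 2 ≤ 2 * (1 - q A p) := by
      have h2 : ‖A‖ ^ 2 ≤ 1 :=
        (sq_le_one_iff₀ (norm_nonneg _)).2 (norm_le_one_of_mem_densities hA.1)
      have h3 : ‖R‖ ^ 2 ≤ 1 :=
        (sq_le_one_iff₀ (norm_nonneg _)).2 (norm_le_one_of_mem_densities hRdens)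
      have h4 : pair A R = q A p := pair_conjDiag_single U A p
      rw [norm_sq_of_isHermitian hA.1.1.isHermitian] at h2
      rw [norm_sq_of_isHermitian hRdens.1.isHermitian] at h3
      rw [norm_sq_of_isHermitian (face_sub_isHermitian hA hRf), pair_sub_left, pair_sub_right,
        pair_sub_right, pair_comm R A, h4]
      linarith
    have h2 : g * (1 - q A p) ≤ ∑ j, (θ.d1 (x p) - θ.d1 (x j)) * q A j := by
      have h3 : 1 - q A p = ∑ j ∈ Finset.univ.erase p, q A j := by
        rw [← sum_diag_re hU hA.1, ← Finset.add_sum_erase _ _ (Finset.mem_univ p)]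
        ring
      rw [h3, Finset.mul_sum, ← Finset.add_sum_erase _ _ (Finset.mem_univ p), sub_self, zero_mul,
        zero_add]
      refine Finset.sum_le_sum fun j hj => ?_
      by_cases hxj : x j = 0
      · rw [hq0 A hA j hxj, mul_zero, mul_zero]
      · exact mul_le_mul_of_nonneg_right (hgapj j (Finset.ne_of_mem_erase hj) hxj) (hqn A hA j)
    rw [hdef A hA]
    have := mul_le_mul_of_nonneg_left h1 hg.le
    linarith
  have hYR : pair Y R = θ.d1 (x p) + k := by
    have h1 := hdef R hRf
    rw [Finset.sum_eq_zero] at h1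
    · linarith
    · intro j _
      rcases eq_or_ne j p with rfl | hj
      · rw [sub_self, zero_mul]
      · have : q R j = 0 := by
          simp only [hq, hR, conjDiag_diag_self hU, Matrix.diagonal_apply_eq]
          simp [hj]
        rw [this, mul_zero]
  have hbest := (Kernel.isBestResponse_iff.1 h).2 R hRf
  have hM1 := abs_le.1 (hM R hRdens)
  have hM2 := abs_le.1 (hM _ hX.1)
  have h1 := hdist _ hX
  have h2 := hdist _ (self_mem_face hX₀)
  have h3 : ‖conjDiag U x - X₀‖ ^ 2 ≤ 2 * ‖conjDiag U x - R‖ ^ 2 + 2 * ‖X₀ - R‖ ^ 2 := by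
    have h4 : ‖conjDiag U x - X₀‖ ≤ ‖conjDiag U x - R‖ + ‖X₀ - R‖ := by
      have := _root_.norm_sub_le (conjDiag U x - R) (X₀ - R)
      rwa [sub_sub_sub_cancel_right] at this
    have h5 := pow_le_pow_left₀ (norm_nonneg _) h4 2
    nlinarith [sq_nonneg (‖conjDiag U x - R‖ - ‖X₀ - R‖)]
  rw [le_div_iff₀ hg]
  have h4 := mul_le_mul_of_nonneg_right h3 hg.le
  linarith [hM1.1, hM1.2, hM2.1, hM2.2]

end Gap

/-! ### Variational stability: strictness, purity and the spectral gap -/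

section Variational

variable {ι : Type*} [Fintype ι] [DecidableEq ι] {d : ι → ℕ} {Ω : Type*} [Fintype Ω]
  {G : QuantumGame ι d Ω} {θ : ι → Kernel}

theorem re_sum_trace (V W : Profile d) :
    (∑ i, (V i * W i).trace).re = ∑ i, pair (V i) (W i) := Complex.re_sum _ _

/-- A variationally stable state is a strict Nash equilibrium: move along the segment towards a
unilateral deviation, on which the deviating player's gradient is constant. -/
theorem QuantumGame.IsVariationallyStable.pair_lt {P : Profile d} (hP : P ∈ states d)
    (h : G.IsVariationallyStable P) (i : ι) {Z : Mat (d i)} (hZ : Z ∈ densities (d i))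
    (hne : Z ≠ P i) : pair (G.grad P i) Z < pair (G.grad P i) (P i) := by
  obtain ⟨U, hU, hneg⟩ := h
  set c : ℝ → Profile d := fun ε => Function.update P i (P i + ε • (Z - P i)) with hc
  have hcont : Continuous c :=
    continuous_const.update i (continuous_const.add (continuous_id.smul continuous_const))
  have h0 : Tendsto c (𝓝[>] 0) (𝓝 P) := by
    have h1 := (hcont.tendsto 0).mono_left (nhdsWithin_le_nhds (s := Set.Ioi (0 : ℝ)))
    have h2 : c 0 = P := by simp [hc]
    rwa [h2] at h1
  have h1 : ∀ᶠ ε : ℝ in 𝓝[>] 0, ε ∈ Set.Ioc (0 : ℝ) 1 := Ioc_mem_nhdsGT one_pos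
  obtain ⟨ε, hεU, hε⟩ := ((h0.eventually hU).and h1).exists
  have hi : c ε i = P i + ε • (Z - P i) := Function.update_self ..
  have hj : ∀ j, j ≠ i → c ε j = P j := fun j hj => Function.update_of_ne hj ..
  have hmem : c ε ∈ states d := by
    intro j
    rcases eq_or_ne j i with rfl | hji
    · rw [hi]
      exact (convex_densities (m := d j)).add_smul_sub_mem (hP j) hZ ⟨hε.1.le, hε.2⟩
    · rw [hj j hji]
      exact hP j
  have hneP : c ε ≠ P := by
    intro heq
    have h2 : P i + ε • (Z - P i) = P i := by rw [← hi, heq]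
    rw [add_eq_left, smul_eq_zero] at h2
    rcases h2 with h2 | h2
    · exact hε.1.ne' h2
    · exact hne (sub_eq_zero.1 h2)
  have h2 := hneg _ ⟨hεU, hmem⟩ hneP
  have h3 : (∑ j, (G.grad (c ε) j * (c ε j - P j)).trace).re = ε * pair (G.grad P i) (Z - P i) := by
    rw [re_sum_trace (G.grad (c ε)) (fun j => c ε j - P j), Finset.sum_eq_single i]
    · rw [hi, add_sub_cancel_left, pair_smul_right, G.grad_congr i hj]
    · intro j _ hji
      rw [hj j hji, sub_self]
      simp [pair]
    · simp
  rw [h3, pair_sub_right] at h2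
  by_contra hcon
  have := mul_nonneg hε.1.le (sub_nonneg.2 (not_lt.1 hcon))
  linarith

theorem exists_rankOne_mem_face {m : ℕ} {P : Mat m} (hP : P ∈ densities m) :
    ∃ e : Fin m → ℂ, star e ⬝ᵥ e = 1 ∧ rankOne e ∈ face P := by
  obtain ⟨U, hU, x, rfl, hx0, hx1⟩ := exists_conjDiag_of_mem_densities hP
  obtain ⟨j, hj⟩ : ∃ j, x j ≠ 0 := by
    by_contra hcon
    push Not at hcon
    simp [hcon] at hx1
  have hR : conjDiag U (Pi.single j 1) ∈ densities m := conjDiag_mem_densities hU (fun k => by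
    rcases eq_or_ne k j with rfl | hk
    · simp
    · simp [hk]) (by simp)
  have hRf : conjDiag U (Pi.single j 1) ∈ face (conjDiag U x) := by
    refine ⟨hR, fun v hv => ?_⟩
    rw [conjDiag_mulVec_eq_zero_iff hU] at hv ⊢
    intro k
    rcases eq_or_ne k j with rfl | hk
    · exact Or.inr ((hv k).resolve_left hj)
    · exact Or.inl (by simp [hk])
  rw [conjDiag_single] at hR hRf
  refine ⟨_, ?_, hRf⟩
  have := hR.2
  rwa [rankOne, Matrix.trace_vecMulVec, dotProduct_comm] at this

/-- The unique maximizer of a linear functional over the density matrices is a pure state. -/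
theorem exists_eq_rankOne_of_strict {m : ℕ} {V P : Mat m} (hP : P ∈ densities m)
    (h : ∀ Z ∈ densities m, Z ≠ P → pair V Z < pair V P) :
    ∃ e : Fin m → ℂ, star e ⬝ᵥ e = 1 ∧ P = rankOne e := by
  have hle : ∀ Z ∈ densities m, pair V Z ≤ pair V P := by
    intro Z hZ
    rcases eq_or_ne Z P with rfl | hne
    · exact le_rfl
    · exact (h Z hZ hne).le
  obtain ⟨e, he, hef⟩ := exists_rankOne_mem_face hP
  refine ⟨e, he, ?_⟩
  by_contra hne
  exact (h _ hef.1 (Ne.symm hne)).ne (pair_eq_of_isMax hP hle hef)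

theorem pair_rankOne_rankOne {m : ℕ} (e w : Fin m → ℂ) :
    pair (rankOne e) (rankOne w) = ((star e ⬝ᵥ w) * (star w ⬝ᵥ e)).re := by
  rw [pair_rankOne, rankOne_mulVec, dotProduct_smul, smul_eq_mul]

theorem exists_gap_of_strict {m : ℕ} {V : Mat m} {e : Fin m → ℂ} (he : star e ⬝ᵥ e = 1)
    (h : ∀ Z ∈ densities m, Z ≠ rankOne e → pair V Z < pair V (rankOne e)) :
    ∃ κ > 0, ∀ w, star w ⬝ᵥ w = 1 → star e ⬝ᵥ w = 0 →
      pair V (rankOne w) ≤ pair V (rankOne e) - κ := by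
  have hK : IsCompact (densities m ∩ {Z | pair (rankOne e) Z = 0}) :=
    (isCompact_densities m).inter_right
      (isClosed_eq (continuous_pair continuous_const continuous_id) continuous_const)
  have hmem : ∀ w, star w ⬝ᵥ w = 1 → star e ⬝ᵥ w = 0 →
      rankOne w ∈ densities m ∩ {Z | pair (rankOne e) Z = 0} := by
    intro w hw hew
    refine ⟨rankOne_mem_densities hw, ?_⟩
    change pair (rankOne e) (rankOne w) = 0
    rw [pair_rankOne_rankOne, hew, zero_mul, Complex.zero_re]
  rcases (densities m ∩ {Z | pair (rankOne e) Z = 0}).eq_empty_or_nonempty with hem | hne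
  · refine ⟨1, one_pos, fun w hw hew => ?_⟩
    have := hmem w hw hew
    rw [hem] at this
    exact this.elim
  · obtain ⟨Z, hZ, hmax⟩ := hK.exists_isMaxOn hne
      (continuous_pair continuous_const continuous_id : Continuous fun Z => pair V Z).continuousOn
    have hZe : Z ≠ rankOne e := by
      intro heq
      have h1 : pair (rankOne e) Z = 0 := hZ.2
      rw [heq, pair_rankOne_rankOne, he] at h1
      simp at h1
    refine ⟨pair V (rankOne e) - pair V Z, sub_pos.2 (h Z hZ.1 hZe), fun w hw hew => ?_⟩
    have : pair V (rankOne w) ≤ pair V Z := hmax (hmem w hw hew)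
    linarith

theorem exists_pos_le {ι : Type*} [Finite ι] {f : ι → ℝ} (hf : ∀ i, 0 < f i) :
    ∃ c > 0, ∀ i, c ≤ f i := by
  have h : ∀ᶠ c : ℝ in 𝓝[>] 0, ∀ i, c ∈ Set.Ioc 0 (f i) :=
    eventually_all.2 fun i => Ioc_mem_nhdsGT (hf i)
  obtain ⟨c, hc, hc0⟩ := (h.and self_mem_nhdsWithin).exists
  exact ⟨c, hc0, fun i => (hc i).2⟩

theorem eventually_mul_lt (A : ℝ) {B : ℝ} (hB : 0 < B) : ∀ᶠ ρ : ℝ in 𝓝[>] 0, A * ρ < B := by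
  have h : Tendsto (fun ρ : ℝ => A * ρ) (𝓝[>] 0) (𝓝 (A * 0)) :=
    ((continuous_const.mul continuous_id).tendsto 0).mono_left nhdsWithin_le_nhds
  rw [mul_zero] at h
  exact h.eventually (gt_mem_nhds hB)

theorem exists_first_exit {f : ℝ → ℝ} (hf : Continuous f) {r t : ℝ} (h0 : f 0 < r) (ht : 0 ≤ t)
    (hft : r ≤ f t) : ∃ T > 0, r ≤ f T ∧ ∀ s, 0 ≤ s → s < T → f s < r := by
  have hc : IsCompact (Set.Icc 0 t ∩ {s | r ≤ f s}) :=
    isCompact_Icc.inter_right (isClosed_le continuous_const hf)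
  obtain ⟨T, hT, hmin⟩ := hc.exists_isLeast ⟨t, ⟨ht, le_rfl⟩, hft⟩
  have hrT : r ≤ f T := hT.2
  refine ⟨T, lt_of_le_of_ne hT.1.1 ?_, hrT, fun s hs hsT => ?_⟩
  · rintro rfl
    linarith
  · by_contra hcon
    exact hsT.not_ge (hmin ⟨⟨hs, hsT.le.trans hT.1.2⟩, not_lt.1 hcon⟩)

/-! ### Variationally stable states are consistently asymptotically stable -/

/-- The orbit of `X₀` is compared with `X₀` itself rather than with `P`: `P` may lie outside the
face of `X₀`. The velocity of this Fenchel coupling is at most of the order `ρ` of the distance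
between `X₀` and `P`, so that the orbit stays close to `X₀` for a time `T₀` which does not depend on
`ρ`. Beyond it the payoff matrices have a spectral gap proportional to the time, which turns the
linear growth of the coupling into a bound on the distance. -/
theorem QuantumGame.IsVariationallyStable.lyapunovStable (hθ : ∀ i, (θ i).Steep)
    {Φ : ℝ → Profile d → Profile d} (hΦ : IsQDFlow G θ Φ) {P : Profile d} (hP : P ∈ states d)
    (h : G.IsVariationallyStable P) : LyapunovStable Φ P := by
  intro U₀ hU₀
  choose e he hPe using fun i => exists_eq_rankOne_of_strict (hP i) fun Z hZ => h.pair_lt hP i hZ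
  have hgap := fun i => exists_gap_of_strict (V := G.grad P i) (he i) fun Z hZ hne => by
    have := h.pair_lt hP i hZ (by rwa [hPe i])
    rwa [hPe i] at this
  choose κ' hκ' hgap using hgap
  obtain ⟨κ, hκ, hκle⟩ := exists_pos_le hκ'
  obtain ⟨c, hc, hcle⟩ := exists_pos_le fun i => (θ i).modulus_pos
  choose M' hM'0 hM' using fun i => (θ i).exists_reg_bound (d i)
  set M := ∑ i, M' i with hMdef
  have hM0 : 0 ≤ M := Finset.sum_nonneg fun i _ => hM'0 i
  have hM : ∀ i, ∀ Z ∈ densities (d i), |(θ i).reg Z| ≤ M := fun i Z hZ =>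
    (hM' i Z hZ).trans (Finset.single_le_sum (f := M') (fun i _ => hM'0 i) (Finset.mem_univ i))
  obtain ⟨L, hL⟩ := G.exists_norm_grad_le
  have hLi : ∀ X ∈ states d, ∀ i, ‖G.grad X i‖ ≤ L := fun X hX i =>
    (norm_le_pi_norm (G.grad X) i).trans (hL X hX)
  obtain ⟨U, hU, hneg⟩ := h
  have hV : {X | ‖G.grad X - G.grad P‖ < κ / 8} ∈ 𝓝 P := by
    have h1 : Continuous fun X => ‖G.grad X - G.grad P‖ :=
      (G.continuous_grad.sub continuous_const).norm
    exact (h1.tendsto P).eventually (gt_mem_nhds (by simpa using by positivity))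
  obtain ⟨r, hr, hball⟩ := Metric.mem_nhds_iff.1 (inter_mem (inter_mem hU hU₀) hV)
  set N : ℝ := (Fintype.card ι : ℝ) with hN
  -- After the time `T₀` the initial payoff matrices, which prefer `X₀` by at least `-2 M`, cost at
  -- most half of the gap `T κ / 2`, and the contribution `96 M / (T κ)` of the regularizers to the
  -- squared distance is below `r ^ 2 / 8`.
  set T₀ : ℝ := max (8 * M / κ) (768 * M / (κ * r ^ 2)) + 1 with hT₀
  have hev := (((eventually_mul_lt 1 (B := r / 2) (by positivity)).and
    (eventually_mul_lt (N * L * T₀) (B := c / 2 * (r / 2) ^ 2) (by positivity))).and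
    ((eventually_mul_lt L (B := κ / 4) (by positivity)).and
    (eventually_mul_lt (16 * N * L / κ) (B := r ^ 2 / 8) (by positivity)))).and
    (self_mem_nhdsWithin (s := Set.Ioi (0 : ℝ)) (a := 0))
  obtain ⟨ρ, ⟨⟨hρ1, hρ2⟩, hρ3, hρ4⟩, hρ⟩ := hev.exists
  have hρ0 : 0 < ρ := hρ
  rw [one_mul] at hρ1
  refine ⟨Metric.ball P ρ, Metric.ball_mem_nhds P hρ0, fun X₀ hX₀ t ht => ?_⟩
  by_contra hout
  have hX₀s := hX₀.2
  have horb := hΦ X₀ hX₀s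
  obtain ⟨Y, hY⟩ := horb.exists_isLift
  set X : ℝ → Profile d := fun t => Φ t X₀ with hX
  have hX0 : X 0 = X₀ := horb.1
  have hXs : ∀ t, X t ∈ states d := horb.mem_states
  have hfc : Continuous fun t => dist (X t) P :=
    (horb.continuous hθ hX₀s).dist continuous_const
  have hd0 : dist X₀ P < ρ := hX₀.1
  obtain ⟨T, hT, hTr, hbefore⟩ := exists_first_exit (f := fun t => dist (X t) P) hfc
    (r := r) (t := t)
    (by rw [hX0]; linarith) ht (by
      by_contra hcon
      exact hout (hball (show X t ∈ Metric.ball P r from not_le.1 hcon)).1.2)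
  have hin : ∀ s, 0 ≤ s → s < T → X s ∈ (U ∩ U₀) ∩ {X | ‖G.grad X - G.grad P‖ < κ / 8} :=
    fun s hs hsT => hball (show X s ∈ Metric.ball P r from hbefore s hs hsT)
  have hdi : ∀ i, ‖X₀ i - P i‖ ≤ ρ := fun i => by
    rw [← dist_eq_norm]
    exact (dist_le_pi_dist X₀ P i).trans hd0.le
  -- The Fenchel coupling with `X₀` grows at most linearly, with a rate of order `ρ`.
  have hgrow : ∑ i, (θ i).coupling (X₀ i) (Y T i) (X T i) ≤ N * (L * ρ) * T := by
    have h1 := hY.sum_coupling_sub_le hθ hX₀s X₀ (C := N * (L * ρ)) hT.le fun s hs => by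
      have h2 : ∑ i, pair (G.grad (X s) i) (X s i - X₀ i) =
          ∑ i, pair (G.grad (X s) i) (X s i - P i) - ∑ i, pair (G.grad (X s) i) (X₀ i - P i) := by
        rw [← Finset.sum_sub_distrib]
        refine Finset.sum_congr rfl fun i _ => ?_
        simp only [pair_sub_right]
        ring
      have h3 : ∑ i, pair (G.grad (X s) i) (X s i - P i) ≤ 0 := by
        rcases eq_or_ne (X s) P with heq | hne
        · rw [heq]
          simp [pair]
        · have := hneg (X s) ⟨(hin s hs.1.le hs.2).1.1, hXs s⟩ hne
          rw [re_sum_trace (G.grad (X s)) (fun j => X s j - P j)] at this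
          exact this.le
      have h4 : ∑ i, -pair (G.grad (X s) i) (X₀ i - P i) ≤ ∑ _i : ι, L * ρ := by
        refine Finset.sum_le_sum fun i _ => ?_
        refine (neg_le_abs _).trans ((abs_pair_le _ _).trans ?_)
        exact mul_le_mul (hLi _ (hXs s) i) (hdi i) (norm_nonneg _) L.2
      rw [Finset.sum_neg_distrib, Finset.sum_const, Finset.card_univ, nsmul_eq_mul] at h4
      rw [h2]
      linarith
    have h2 : ∑ i, (θ i).coupling (X₀ i) (Y 0 i) (X 0 i) = 0 :=
      Finset.sum_eq_zero fun i _ => by rw [hX0]; exact sub_self _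
    linarith
  have hself : ∀ i, X₀ i ∈ face (X₀ i) := fun i => self_mem_face (hX₀s i)
  have hcoup : ∀ i, (θ i).coupling (X₀ i) (Y T i) (X T i) ≤ N * (L * ρ) * T := fun i =>
    (Finset.single_le_sum (f := fun i => (θ i).coupling (X₀ i) (Y T i) (X T i))
      (fun i _ => hY.coupling_nonneg T i (hself i)) (Finset.mem_univ i)).trans hgrow
  obtain ⟨i, hi⟩ : ∃ i, r ≤ ‖X T i - P i‖ := by
    by_contra hcon
    push Not at hcon
    have h1 : dist (X T) P < r := (dist_pi_lt_iff hr).2 fun i => by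
      rw [dist_eq_norm]
      exact hcon i
    exact absurd hTr (not_le.2 h1)
  have hi2 : r / 2 ≤ ‖X T i - X₀ i‖ := by
    have h1 := norm_add_le (X T i - X₀ i) (X₀ i - P i)
    rw [sub_add_sub_cancel] at h1
    linarith [hdi i]
  have hsq : (r / 2) ^ 2 ≤ ‖X T i - X₀ i‖ ^ 2 := pow_le_pow_left₀ (by positivity) hi2 2
  -- Before `T₀` strong convexity of the coupling suffices, after `T₀` the gap takes over.
  rcases le_or_gt T T₀ with hTT | hTT
  · have h1 := hY.le_coupling hθ hX₀s T i (hself i)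
    rw [norm_sub_rev] at h1
    have h2 : c / 2 * (r / 2) ^ 2 ≤ (θ i).modulus / 2 * ‖X T i - X₀ i‖ ^ 2 :=
      mul_le_mul (by linarith [hcle i]) hsq (by positivity)
        (by linarith [(θ i).modulus_pos])
    have h3 : N * (L * ρ) * T ≤ N * (L * ρ) * T₀ :=
      mul_le_mul_of_nonneg_left hTT (by positivity)
    have h4 := hcoup i
    have h5 : N * (L * ρ) * T₀ = N * L * T₀ * ρ := by ring
    linarith
  · have hT1 : 8 * M / κ < T := ((le_max_left _ _).trans (lt_add_one _).le).trans_lt hTT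
    have hT2 : 768 * M / (κ * r ^ 2) < T :=
      ((le_max_right _ _).trans (lt_add_one _).le).trans_lt hTT
    rw [div_lt_iff₀ hκ] at hT1
    rw [div_lt_iff₀ (by positivity)] at hT2
    -- Up to the exit time the payoff matrix grows along `V(P)`.
    have hYT : ‖Y T i - Y 0 i - T • G.grad P i‖ ≤ κ / 8 * T := by
      have h1 : ∀ s ∈ Set.Icc 0 T, HasDerivWithinAt (fun s => Y s i - s • G.grad P i)
          (G.grad (X s) i - G.grad P i) (Set.Icc 0 T) s := by
        intro s _
        have h2 : HasDerivAt (fun s => Y s i) (G.grad (X s) i) s :=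
          hasDerivAt_pi.1 (hY.hasDerivAt s) i
        have h3 := (hasDerivAt_id s).smul_const (G.grad P i)
        rw [one_smul] at h3
        exact (h2.sub h3).hasDerivWithinAt
      have h2 := norm_image_sub_le_of_norm_deriv_le_segment' h1 (C := κ / 8) (fun s hs => by
        have h3 := (hin s hs.1 hs.2).2
        exact (norm_le_pi_norm (G.grad (X s) - G.grad P) i).trans (le_of_lt h3)) T ⟨hT.le, le_rfl⟩
      simp only [zero_smul, sub_zero] at h2
      rwa [sub_right_comm] at h2
    have hb := (hY.isBestResponse T i).norm_sub_sq_le_of_gap (hθ i) (hX₀s i) (hY.isHermitian T i)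
      (hM i) (e := e i) (g := T * κ / 4) (η := N * (L * ρ) * T + 2 * M) (by positivity)
      (fun w hw hew hwf => by
        have h0 := (Kernel.isBestResponse_iff.1 (hY.isBestResponse 0 i)).2 _ hwf
        rw [hX0] at h0
        have hm1 := abs_le.1 (hM i _ hwf.1)
        have hm2 := abs_le.1 (hM i _ (hX₀s i))
        have h1 := hgap i w hw hew
        rw [← hPe i] at h1
        have h2 : -(L * ρ) ≤ pair (G.grad P i) (X₀ i - P i) := by
          refine neg_le.1 ((neg_le_abs _).trans ((abs_pair_le _ _).trans ?_))
          exact mul_le_mul (hLi _ hP i) (hdi i) (norm_nonneg _) L.2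
        have h3 : ‖X₀ i - rankOne w‖ ≤ 2 := (norm_sub_le _ _).trans (by
          linarith [norm_le_one_of_mem_densities (hX₀s i), norm_le_one_of_mem_densities hwf.1])
        have h4 : -(κ / 8 * T * 2) ≤
            pair (Y T i - Y 0 i - T • G.grad P i) (X₀ i - rankOne w) := by
          refine neg_le.1 ((neg_le_abs _).trans ((abs_pair_le _ _).trans ?_))
          exact mul_le_mul hYT h3 (norm_nonneg _) (by positivity)
        have h5 : κ * 3 / 4 ≤ pair (G.grad P i) (X₀ i - rankOne w) := by
          rw [pair_sub_right] at h2 ⊢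
          linarith [hκle i]
        have h6 := mul_le_mul_of_nonneg_left h5 hT.le
        simp only [pair_sub_left, pair_smul_left, pair_sub_right] at h4 h6
        nlinarith)
      (by
        have h1 := hcoup i
        have hm1 := abs_le.1 (hM i _ (hXs T i))
        have hm2 := abs_le.1 (hM i _ (hX₀s i))
        simp only [Kernel.coupling] at h1
        linarith)
    rw [le_div_iff₀ (by positivity)] at hb
    have h1 := mul_le_mul_of_nonneg_right hsq (show 0 ≤ T * κ / 4 by positivity)
    have h2 : 16 * N * L * ρ < r ^ 2 / 8 * κ := by
      have h3 := mul_lt_mul_of_pos_right hρ4 hκ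
      have h4 : 16 * N * L / κ * ρ * κ = 16 * N * L * ρ := by field_simp
      rwa [h4] at h3
    have h3 := mul_lt_mul_of_pos_left h2 hT
    nlinarith

/-- The Fenchel coupling with a variationally stable state decreases along consistent orbits, at a
rate bounded away from zero outside each neighborhood of the state; so the orbit comes close to the
state at some time, and stability keeps it there. -/
theorem QuantumGame.IsVariationallyStable.consistentlyAttracting (hθ : ∀ i, (θ i).Steep)
    {Φ : ℝ → Profile d → Profile d} (hΦ : IsQDFlow G θ Φ) {P : Profile d} (hP : P ∈ states d)
    (h : G.IsVariationallyStable P) : ConsistentlyAttracting Φ P := by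
  have hstab := h.lyapunovStable hθ hΦ hP
  obtain ⟨U, hU, hneg⟩ := h
  obtain ⟨r, hr, hball⟩ := Metric.nhds_basis_closedBall.mem_iff.1 hU
  obtain ⟨U', hU', hstay⟩ := hstab _ (Metric.closedBall_mem_nhds P hr)
  refine ⟨U', hU', fun X₀ hX₀ hcons => ?_⟩
  obtain ⟨hX₀s, hker⟩ := hcons
  have horb := hΦ X₀ hX₀s
  obtain ⟨Y, hY⟩ := horb.exists_isLift
  set X : ℝ → Profile d := fun t => Φ t X₀ with hX
  have hXs : ∀ t, X t ∈ states d := horb.mem_states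
  set q : Profile d → ℝ := fun A => ∑ i, pair (G.grad A i) (A i - P i) with hq
  have hqc : Continuous q := continuous_finsetSum _ fun i _ =>
    continuous_pair (continuous_grad_apply G i) ((continuous_apply i).sub continuous_const)
  have hvisit : ∀ W ∈ 𝓝 P, ∃ t ≥ 0, X t ∈ W := by
    intro W hW
    by_contra hcon
    push Not at hcon
    have hK : IsCompact ((Metric.closedBall P r ∩ states d) ∩ (interior W)ᶜ) :=
      ((isCompact_states d).inter_left Metric.isClosed_closedBall).inter_right
        isOpen_interior.isClosed_compl
    have hXK : ∀ t ≥ 0, X t ∈ (Metric.closedBall P r ∩ states d) ∩ (interior W)ᶜ := fun t ht =>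
      ⟨⟨hstay X₀ ⟨hX₀, hX₀s⟩ t ht, hXs t⟩, fun hin => hcon t ht (interior_subset hin)⟩
    obtain ⟨Z, hZ, hmax⟩ := hK.exists_isMaxOn ⟨X 0, hXK 0 le_rfl⟩ hqc.continuousOn
    have hZP : Z ≠ P := by
      rintro rfl
      exact hZ.2 (mem_interior_iff_mem_nhds.2 hW)
    have hqZ : q Z < 0 := by
      have := hneg Z ⟨hball hZ.1.1, hZ.1.2⟩ hZP
      rwa [re_sum_trace (G.grad Z) (fun j => Z j - P j)] at this
    have hPf : ∀ i, P i ∈ face (X₀ i) := fun i => ⟨hP i, hker i⟩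
    set c₀ := ∑ i, (θ i).coupling (P i) (Y 0 i) (X 0 i) with hc₀
    have hc₀0 : 0 ≤ c₀ := Finset.sum_nonneg fun i _ => hY.coupling_nonneg 0 i (hPf i)
    have hT : 0 ≤ (c₀ + 1) / -q Z := div_nonneg (by linarith) (by linarith)
    have h1 := hY.sum_coupling_sub_le hθ hX₀s P hT (C := q Z)
      fun s hs => hmax (hXK s hs.1.le)
    have h2 : 0 ≤ ∑ i, (θ i).coupling (P i) (Y ((c₀ + 1) / -q Z) i) (X ((c₀ + 1) / -q Z) i) :=
      Finset.sum_nonneg fun i _ => hY.coupling_nonneg _ i (hPf i)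
    have h3 : q Z * ((c₀ + 1) / -q Z) = -(c₀ + 1) := by
      rw [div_neg, mul_neg, mul_div_cancel₀ _ hqZ.ne]
    linarith
  intro N hN
  obtain ⟨W, hW, hWN⟩ := hstab N hN
  obtain ⟨t₀, -, ht₀⟩ := hvisit W hW
  refine mem_map.2 (mem_atTop_sets.2 ⟨t₀, fun t ht => ?_⟩)
  have h1 := hWN (X t₀) ⟨ht₀, hXs t₀⟩ (t - t₀) (sub_nonneg.2 ht)
  rw [hX, hΦ.add hθ hX₀s, add_sub_cancel] at h1
  exact h1

end Variational

/-! ### Sums of shear fields cannot attract a ball -/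

section Volume

open MeasureTheory

variable {E : Type*} [NormedAddCommGroup E] [NormedSpace ℝ E] [FiniteDimensional ℝ E]

/-- A shear, which moves points along a subspace by an amount that is constant on the translates of
the subspace, preserves volume. -/
theorem measurePreserving_shear [MeasurableSpace E] [BorelSpace E] (μ : Measure E)
    [μ.IsAddHaarMeasure] {W : Submodule ℝ E} {g : E → E} (hg : Continuous g)
    (hgW : ∀ y, g y ∈ W) (hinv : ∀ y, ∀ w ∈ W, g (y + w) = g y) :
    MeasurePreserving (fun y => y + g y) μ μ := by
  obtain ⟨W', hW'⟩ := W.exists_isCompl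
  let e : (W' × W) ≃L[ℝ] E := (Submodule.prodEquivOfIsCompl W' W hW'.symm).toContinuousLinearEquiv
  have he : ∀ p : W' × W, e p = (p.1 : E) + p.2 := fun p => by simp [e]
  let ν : Measure (W' × W) := (Measure.addHaar : Measure W').prod (Measure.addHaar : Measure W)
  have hshear : MeasurePreserving (fun p : W' × W => (p.1, p.2 + ⟨g p.1, hgW p.1⟩)) ν ν := by
    have hc : Continuous fun p : W' × W => p.2 + (⟨g p.1, hgW p.1⟩ : W) :=
      continuous_snd.add ((hg.comp (continuous_subtype_val.comp continuous_fst)).subtype_mk _)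
    exact MeasurePreserving.skew_product (f := id)
      (g := fun (b : W') (a : W) => a + (⟨g b, hgW b⟩ : W)) (MeasurePreserving.id Measure.addHaar)
      hc.measurable (Eventually.of_forall fun b => map_add_right_eq_self _ _)
  have hν : MeasurePreserving (fun y => y + g y) (ν.map e) (ν.map e) := by
    have he' : MeasurePreserving e ν (ν.map e) := ⟨e.continuous.measurable, rfl⟩
    have hT : Measurable fun y => y + g y := (continuous_id.add hg).measurable
    refine ⟨hT, ?_⟩
    rw [Measure.map_map hT e.continuous.measurable]
    have : (fun y => y + g y) ∘ e = e ∘ fun p : W' × W => (p.1, p.2 + ⟨g p.1, hgW p.1⟩) := by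
      funext p
      simp only [Function.comp, he, hinv _ _ p.2.2, Submodule.coe_add]
      rw [add_assoc]
    rw [this]
    exact (he'.comp hshear).map_eq
  have : (ν.map e).IsAddHaarMeasure := e.isAddHaarMeasure_map ν
  rw [Measure.isAddLeftInvariant_eq_smul μ (ν.map e)]
  exact hν.smul_measure _

variable {ι : Type*} [Fintype ι] {F : ι → E → E} {K L : NNReal}

/-- A composition of shears that follows a sum of shear fields for a time `δ`, up to an error of
order `δ ^ 2`. -/
theorem exists_shear_step [MeasurableSpace E] [BorelSpace E] (μ : Measure E)
    [μ.IsAddHaarMeasure] {W : ι → Submodule ℝ E} (hK : ∀ i, LipschitzWith K (F i))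
    (hL : ∀ i y, ‖F i y‖ ≤ L) (hW : ∀ i y, F i y ∈ W i)
    (hinv : ∀ i y, ∀ w ∈ W i, F i (y + w) = F i y) {δ : ℝ} (hδ : 0 ≤ δ) (s : Finset ι) :
    ∃ Ψ : E → E, MeasurePreserving Ψ μ μ ∧
      (∀ x y, ‖Ψ x - Ψ y‖ ≤ (1 + δ * K) ^ s.card * ‖x - y‖) ∧
      (∀ y, ‖Ψ y - y‖ ≤ s.card * L * δ) ∧
      ∀ y, ‖Ψ y - y - δ • ∑ i ∈ s, F i y‖ ≤ s.card ^ 2 * K * L * δ ^ 2 := by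
  classical
  induction s using Finset.induction_on with
  | empty => exact ⟨id, MeasurePreserving.id μ, by simp, by simp, by simp⟩
  | insert i s his ih =>
    obtain ⟨Ψ, hΨ, hlip, hmove, herr⟩ := ih
    have hKi : ∀ x y, ‖F i x - F i y‖ ≤ K * ‖x - y‖ := fun x y => by
      simpa only [dist_eq_norm] using (hK i).dist_le_mul x y
    have hsh : MeasurePreserving (fun y => y + δ • F i y) μ μ :=
      measurePreserving_shear μ ((hK i).continuous.const_smul δ)
        (fun y => (W i).smul_mem δ (hW i y)) fun y w hw => by rw [hinv i y w hw]
    have hK0 : (0 : ℝ) ≤ K := K.2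
    have hL0 : (0 : ℝ) ≤ L := L.2
    refine ⟨fun y => Ψ y + δ • F i (Ψ y), hsh.comp hΨ, fun x y => ?_, fun y => ?_, fun y => ?_⟩
    · have h1 : Ψ x + δ • F i (Ψ x) - (Ψ y + δ • F i (Ψ y)) =
          (Ψ x - Ψ y) + δ • (F i (Ψ x) - F i (Ψ y)) := by
        rw [smul_sub]; abel
      have h2 : ‖δ • (F i (Ψ x) - F i (Ψ y))‖ ≤ δ * (K * ‖Ψ x - Ψ y‖) := by
        rw [norm_smul, Real.norm_of_nonneg hδ]
        exact mul_le_mul_of_nonneg_left (hKi _ _) hδ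
      rw [h1, Finset.card_insert_of_notMem his, pow_succ']
      refine (norm_add_le _ _).trans ((add_le_add_right h2 _).trans ?_)
      have h3 := mul_le_mul_of_nonneg_left (hlip x y) (show 0 ≤ 1 + δ * K by positivity)
      linarith
    · have h1 : Ψ y + δ • F i (Ψ y) - y = (Ψ y - y) + δ • F i (Ψ y) := by abel
      have h2 : ‖δ • F i (Ψ y)‖ ≤ δ * L := by
        rw [norm_smul, Real.norm_of_nonneg hδ]
        exact mul_le_mul_of_nonneg_left (hL _ _) hδ
      rw [h1, Finset.card_insert_of_notMem his]
      refine (norm_add_le _ _).trans ((add_le_add (hmove y) h2).trans (le_of_eq ?_))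
      push_cast
      ring
    · have h1 : Ψ y + δ • F i (Ψ y) - y - δ • ∑ j ∈ insert i s, F j y =
          (Ψ y - y - δ • ∑ j ∈ s, F j y) + δ • (F i (Ψ y) - F i y) := by
        rw [Finset.sum_insert his, smul_add, smul_sub]; abel
      have h2 : ‖δ • (F i (Ψ y) - F i y)‖ ≤ δ * (K * (s.card * L * δ)) := by
        rw [norm_smul, Real.norm_of_nonneg hδ]
        exact mul_le_mul_of_nonneg_left
          ((hKi _ _).trans (mul_le_mul_of_nonneg_left (hmove y) hK0)) hδ
      rw [h1, Finset.card_insert_of_notMem his]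
      refine (norm_add_le _ _).trans ((add_le_add (herr y) h2).trans ?_)
      push_cast
      have h3 : 0 ≤ (s.card + 1 : ℝ) * K * L * δ ^ 2 := by positivity
      linarith

/-- The first-order Taylor estimate for a solution of the differential equation. -/
theorem norm_taylor_sub_le (hK : ∀ i, LipschitzWith K (F i)) (hL : ∀ i y, ‖F i y‖ ≤ L)
    {φ : ℝ → E} (hφ : ∀ t, HasDerivAt φ (∑ i, F i (φ t)) t) (t : ℝ) {δ : ℝ} (hδ : 0 ≤ δ) :
    ‖φ (t + δ) - φ t - δ • ∑ i, F i (φ t)‖ ≤ (Fintype.card ι : ℝ) ^ 2 * K * L * δ ^ 2 := by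
  set m : ℝ := (Fintype.card ι : ℝ) with hm
  have hspeed : ∀ s, ‖∑ i, F i (φ s)‖ ≤ m * L := fun s =>
    (norm_sum_le_of_le _ fun i _ => hL i (φ s)).trans (le_of_eq (by simp [hm]))
  have hmove : ∀ s ∈ Set.Icc t (t + δ), ‖φ s - φ t‖ ≤ m * L * (s - t) :=
    norm_image_sub_le_of_norm_deriv_le_segment' (fun s _ => (hφ s).hasDerivWithinAt)
      fun s _ => hspeed s
  have hmL : 0 ≤ m * L := by positivity
  have h1 : ∀ s ∈ Set.Icc t (t + δ), HasDerivWithinAt (fun s => φ s - (s - t) • ∑ i, F i (φ t))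
      (∑ i, F i (φ s) - ∑ i, F i (φ t)) (Set.Icc t (t + δ)) s := by
    intro s _
    have h2 := ((hasDerivAt_id s).sub_const t).smul_const (∑ i, F i (φ t))
    rw [one_smul] at h2
    exact ((hφ s).sub h2).hasDerivWithinAt
  have h2 := norm_image_sub_le_of_norm_deriv_le_segment' h1 (C := m * K * (m * L * δ))
    (fun s hs => by
      rw [← Finset.sum_sub_distrib]
      refine (norm_sum_le_of_le (f := fun i => F i (φ s) - F i (φ t))
        (n := fun _ => K * (m * L * δ)) _ fun i _ => ?_).trans (le_of_eq ?_)
      · rw [← dist_eq_norm]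
        refine ((hK i).dist_le_mul _ _).trans (mul_le_mul_of_nonneg_left ?_ K.2)
        rw [dist_eq_norm]
        refine (hmove s (Set.Ico_subset_Icc_self hs)).trans (mul_le_mul_of_nonneg_left ?_ hmL)
        linarith [hs.2]
      · rw [Finset.sum_const, Finset.card_univ, nsmul_eq_mul, ← hm]
        ring) (t + δ) ⟨by linarith, le_rfl⟩
  simp only [add_sub_cancel_left, sub_self, zero_smul, sub_zero] at h2
  rw [sub_right_comm]
  refine h2.trans (le_of_eq ?_)
  ring

/-- The flow of a sum of shear fields is a uniform limit of volume-preserving maps. -/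
theorem exists_measurePreserving_approx [MeasurableSpace E] [BorelSpace E] (μ : Measure E)
    [μ.IsAddHaarMeasure] {W : ι → Submodule ℝ E} (hK : ∀ i, LipschitzWith K (F i))
    (hL : ∀ i y, ‖F i y‖ ≤ L) (hW : ∀ i y, F i y ∈ W i)
    (hinv : ∀ i y, ∀ w ∈ W i, F i (y + w) = F i y) {T ε : ℝ} (hT : 0 ≤ T) (hε : 0 < ε) :
    ∃ Ψ : E → E, MeasurePreserving Ψ μ μ ∧ ∀ φ : ℝ → E,
      (∀ t, HasDerivAt φ (∑ i, F i (φ t)) t) → ‖Ψ (φ 0) - φ T‖ ≤ ε := by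
  set m : ℕ := Fintype.card ι with hm
  set C : ℝ := 2 * ((m : ℝ) ^ 2 * K * L) with hC
  have hC0 : 0 ≤ C := by positivity
  have hlim : Tendsto (fun N : ℕ => C * T * Real.exp (K * T * m) * (T / ((N : ℝ) + 1)))
      atTop (𝓝 0) := by
    have h1 := (tendsto_one_div_add_atTop_nhds_zero_nat (𝕜 := ℝ)).const_mul
      (C * T * Real.exp (K * T * m) * T)
    rw [mul_zero] at h1
    refine h1.congr fun N => ?_
    ring
  obtain ⟨N, hN⟩ := (hlim.eventually (gt_mem_nhds hε)).exists
  set δ : ℝ := T / ((N : ℝ) + 1) with hδdef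
  have hδ : 0 ≤ δ := by positivity
  have hNδ : ((N + 1 : ℕ) : ℝ) * δ = T := by
    rw [hδdef]; push_cast; field_simp
  obtain ⟨Ψ, hΨ, hlip, -, herr⟩ := exists_shear_step μ hK hL hW hinv hδ Finset.univ
  rw [Finset.card_univ, ← hm] at hlip herr
  set a : ℝ := (1 + δ * K) ^ m with ha
  have ha1 : 1 ≤ a := one_le_pow₀ (by have := mul_nonneg hδ K.coe_nonneg; linarith)
  refine ⟨Ψ^[N + 1], hΨ.iterate _, fun φ hφ => ?_⟩
  have hind : ∀ n : ℕ, ‖Ψ^[n] (φ 0) - φ (n * δ)‖ ≤ C * δ ^ 2 * n * a ^ n := by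
    intro n
    induction n with
    | zero => simp
    | succ n ih =>
      have e1 : ((n + 1 : ℕ) : ℝ) * δ = n * δ + δ := by push_cast; ring
      have h1 := norm_taylor_sub_le hK hL hφ (n * δ) hδ
      have h2 := herr (φ (n * δ))
      have h3 := hlip (Ψ^[n] (φ 0)) (φ (n * δ))
      have h4 := mul_le_mul_of_nonneg_left ih (zero_le_one.trans ha1)
      have e2 : Ψ^[n + 1] (φ 0) - φ (n * δ + δ) = (Ψ (Ψ^[n] (φ 0)) - Ψ (φ (n * δ))) +
          ((Ψ (φ (n * δ)) - φ (n * δ) - δ • ∑ i, F i (φ (n * δ))) -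
            (φ (n * δ + δ) - φ (n * δ) - δ • ∑ i, F i (φ (n * δ)))) := by
        rw [Function.iterate_succ_apply']; abel
      rw [e1, e2]
      have h5 := (norm_add_le (Ψ (Ψ^[n] (φ 0)) - Ψ (φ (n * δ))) _).trans
        (add_le_add h3 ((norm_sub_le _ _).trans (add_le_add h2 h1)))
      refine h5.trans ?_
      have h6 : 1 ≤ a ^ (n + 1) := one_le_pow₀ ha1
      have h7 := mul_le_mul_of_nonneg_left h6 (show 0 ≤ C * δ ^ 2 by positivity)
      have h8 : a * (C * δ ^ 2 * n * a ^ n) = C * δ ^ 2 * n * a ^ (n + 1) := by ring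
      push_cast
      rw [h8] at h4
      rw [hC] at h4 h7 ⊢
      linarith
  -- The error constant `a ^ (N + 1)` stays bounded as the step size goes to zero.
  have h1 := hind (N + 1)
  rw [hNδ] at h1
  refine h1.trans (le_trans ?_ hN.le)
  have h2 : a ^ (N + 1) ≤ Real.exp (K * T * m) := by
    have h3 : 1 + δ * K ≤ Real.exp (δ * K) := by
      have := Real.add_one_le_exp (δ * K)
      linarith
    calc a ^ (N + 1) = (1 + δ * K) ^ (m * (N + 1)) := by rw [ha, pow_mul]
      _ ≤ Real.exp (δ * K) ^ (m * (N + 1)) :=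
        pow_le_pow_left₀ (by have := mul_nonneg hδ K.coe_nonneg; linarith) h3 _
      _ = Real.exp (K * T * m) := by
        rw [← Real.exp_nat_mul, ← hNδ]
        congr 1
        push_cast
        ring
  calc C * δ ^ 2 * ((N + 1 : ℕ) : ℝ) * a ^ (N + 1)
      = C * T * δ * a ^ (N + 1) := by rw [← hNδ]; ring
    _ ≤ C * T * δ * Real.exp (K * T * m) := mul_le_mul_of_nonneg_left h2 (by positivity)
    _ = C * T * Real.exp (K * T * m) * δ := by ring

/-- A flow generated by shear fields preserves volume, so it cannot move a ball into smaller and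
smaller neighborhoods of its center. -/
theorem not_tendsto_of_shear_fields [Nontrivial E] {W : ι → Submodule ℝ E}
    (hK : ∀ i, LipschitzWith K (F i)) (hL : ∀ i y, ‖F i y‖ ≤ L) (hW : ∀ i y, F i y ∈ W i)
    (hinv : ∀ i y, ∀ w ∈ W i, F i (y + w) = F i y) {φ : E → ℝ → E} (h0 : ∀ y, φ y 0 = y)
    (hφ : ∀ y t, HasDerivAt (φ y) (∑ i, F i (φ y t)) t) (p : E) {r : ℝ} (hr : 0 < r) :
    ¬ ∀ y ∈ Metric.ball p r, Tendsto (φ y) atTop (𝓝 p) := by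
  intro hlim
  let _ : MeasurableSpace E := borel E
  have : BorelSpace E := ⟨rfl⟩
  let μ : Measure E := Measure.addHaar
  let A : ℕ → Set E := fun n =>
    {y ∈ Metric.ball p r | ∀ k : ℕ, n ≤ k → φ y k ∈ Metric.closedBall p (r / 4)}
  have hmono : Monotone A := fun n n' hn y hy => ⟨hy.1, fun k hk => hy.2 k (hn.trans hk)⟩
  -- The sets `A n` may fail to be measurable; continuity from below holds for outer measures too.
  have hunion : ⋃ n, A n = Metric.ball p r := by
    refine Set.Subset.antisymm (Set.iUnion_subset fun n y hy => hy.1) fun y hy => ?_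
    have h1 := ((hlim y hy).comp tendsto_natCast_atTop_atTop).eventually
      (Metric.closedBall_mem_nhds p (show 0 < r / 4 by positivity))
    obtain ⟨n, hn⟩ := eventually_atTop.1 h1
    exact Set.mem_iUnion.2 ⟨n, hy, hn⟩
  have hA : ∀ n, μ (A n) ≤ μ (Metric.closedBall p (r / 2)) := by
    intro n
    obtain ⟨Ψ, hΨ, happ⟩ := exists_measurePreserving_approx μ hK hL hW hinv
      (T := n) n.cast_nonneg (show 0 < r / 4 by positivity)
    rw [← hΨ.measure_preimage Metric.isClosed_closedBall.measurableSet.nullMeasurableSet]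
    refine measure_mono fun y hy => ?_
    have h1 := happ (φ y) (hφ y)
    rw [h0] at h1
    have h2 := hy.2 n le_rfl
    rw [Metric.mem_closedBall, dist_eq_norm] at h2
    change Ψ y ∈ Metric.closedBall p (r / 2)
    rw [Metric.mem_closedBall, dist_eq_norm, ← sub_add_sub_cancel _ (φ y n)]
    linarith [norm_add_le (Ψ y - φ y n) (φ y n - p)]
  have h1 : μ (Metric.ball p r) ≤ μ (Metric.closedBall p (r / 2)) := by
    rw [← hunion, hmono.measure_iUnion]
    exact iSup_le hA
  rw [Measure.addHaar_closedBall μ p (by positivity), Measure.addHaar_ball μ p hr.le] at h1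
  have hpos : μ (Metric.ball 0 1) ≠ 0 := (Metric.measure_ball_pos μ 0 one_pos).ne'
  have hfin : μ (Metric.ball 0 1) ≠ ⊤ := measure_ball_lt_top.ne
  rw [ENNReal.mul_le_mul_iff_left hpos hfin, ENNReal.ofReal_le_ofReal_iff (by positivity)] at h1
  have h2 : (r / 2) ^ Module.finrank ℝ E < r ^ Module.finrank ℝ E :=
    pow_lt_pow_left₀ (by linarith) (by positivity) Module.finrank_pos.ne'
  linarith

end Volume

/-! ### Payoff matrices modulo constants on a face -/

section Gauge

variable {m : ℕ} {P : Mat m}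

/-- The payoff matrices that represent the affine functions on the face of a density matrix `P`
which vanish at `P`: Hermitian, zero on the kernel of `P`, and orthogonal to `P`. Each Hermitian
matrix agrees on the face with exactly one of them up to a constant, see `gaugeProj`. -/
structure IsGauged (P y : Mat m) : Prop where
  isHermitian : y.IsHermitian
  mulVec_eq_zero : ∀ v, P.mulVec v = 0 → y.mulVec v = 0
  pair_eq_zero : pair P y = 0

theorem IsGauged.add {y z : Mat m} (hy : IsGauged P y) (hz : IsGauged P z) :
    IsGauged P (y + z) where
  isHermitian := hy.isHermitian.add hz.isHermitian
  mulVec_eq_zero v hv := by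
    rw [Matrix.add_mulVec, hy.mulVec_eq_zero v hv, hz.mulVec_eq_zero v hv, add_zero]
  pair_eq_zero := by rw [pair_add_right, hy.pair_eq_zero, hz.pair_eq_zero, add_zero]

theorem IsGauged.smul {y : Mat m} (hy : IsGauged P y) (r : ℝ) : IsGauged P (r • y) where
  isHermitian := by
    rw [Matrix.IsHermitian, Matrix.conjTranspose_smul, hy.isHermitian.eq, star_trivial]
  mulVec_eq_zero v hv := by rw [Matrix.smul_mulVec, hy.mulVec_eq_zero v hv, smul_zero]
  pair_eq_zero := by rw [pair_smul_right, hy.pair_eq_zero, mul_zero]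

theorem isGauged_zero (P : Mat m) : IsGauged P 0 where
  isHermitian := Matrix.isHermitian_zero
  mulVec_eq_zero _ _ := Matrix.zero_mulVec _
  pair_eq_zero := by simp [pair]

theorem IsGauged.sub {y z : Mat m} (hy : IsGauged P y) (hz : IsGauged P z) :
    IsGauged P (y - z) := by
  have h := hy.add (hz.smul (-1))
  rwa [neg_one_smul, ← sub_eq_add_neg] at h

theorem trace_eq_of_isHermitian {A : Mat m} (hA : A.IsHermitian) : A.trace = (pair 1 A : ℂ) := by
  rw [pair_one_left]
  refine (Complex.conj_eq_iff_re.1 ?_).symm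
  rw [← Complex.star_def, ← Matrix.trace_conjTranspose, hA.eq]

/-- Since `P` is in the relative interior of its face, the affine function represented by a gauged
matrix takes values on the face that are comparable to the norm of the matrix. -/
theorem exists_forall_isGauged_pair_eq (hP : P ∈ densities m) :
    ∃ μ > 0, ∀ w, IsGauged P w → w ≠ 0 → ∃ Z ∈ face P, pair w Z = μ * ‖w‖ := by
  obtain ⟨μ, hμ, hadd⟩ := exists_forall_posSemidef_add hP.1
  refine ⟨μ / (1 + ‖(1 : Mat m)‖), by positivity, fun w hw hw0 => ?_⟩
  have hwn : 0 < ‖w‖ := norm_pos_iff.2 hw0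
  set t : ℝ := μ / (1 + ‖(1 : Mat m)‖) / ‖w‖ with ht
  have ht0 : 0 ≤ t := by positivity
  set W : Mat m := t • (w - pair 1 w • P) with hW
  have hWh : W.IsHermitian := by
    have h1 : (w - pair 1 w • P).IsHermitian := by
      refine hw.isHermitian.sub ?_
      rw [Matrix.IsHermitian, Matrix.conjTranspose_smul, hP.1.isHermitian.eq, star_trivial]
    rw [Matrix.IsHermitian, hW, Matrix.conjTranspose_smul, h1.eq, star_trivial]
  have hWk : ∀ v, P.mulVec v = 0 → W.mulVec v = 0 := fun v hv => by
    rw [hW, Matrix.smul_mulVec, Matrix.sub_mulVec, Matrix.smul_mulVec, hw.mulVec_eq_zero v hv, hv,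
      smul_zero, sub_zero, smul_zero]
  have hWn : ‖W‖ ≤ μ := by
    have h1 : ‖w - pair 1 w • P‖ ≤ (1 + ‖(1 : Mat m)‖) * ‖w‖ := by
      refine (norm_sub_le _ _).trans ?_
      rw [norm_smul, Real.norm_eq_abs, add_mul, one_mul]
      have h2 := mul_le_mul (abs_pair_le 1 w) (norm_le_one_of_mem_densities hP) (norm_nonneg _)
        (by positivity)
      linarith
    rw [hW, norm_smul, Real.norm_of_nonneg ht0]
    refine (mul_le_mul_of_nonneg_left h1 ht0).trans (le_of_eq ?_)
    rw [ht]
    field_simp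
  have hWt : W.trace = 0 := by
    rw [hW, Matrix.trace_smul, Matrix.trace_sub, Matrix.trace_smul, hP.2,
      trace_eq_of_isHermitian hw.isHermitian]
    simp
  refine ⟨P + W, ⟨⟨hadd W hWh hWk hWn, ?_⟩, fun v hv => ?_⟩, ?_⟩
  · rw [Matrix.trace_add, hP.2, hWt, add_zero]
  · rw [Matrix.add_mulVec, hv, hWk v hv, add_zero]
  · rw [pair_add_right, hW, pair_smul_right, pair_sub_right, pair_smul_right, pair_comm w P,
      hw.pair_eq_zero, ← norm_sq_of_isHermitian hw.isHermitian, ht]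
    field_simp
    ring

theorem IsGauged.eq_zero_of_pair_eq {w : Mat m} (hP : P ∈ densities m) (hw : IsGauged P w) {k : ℝ}
    (h : ∀ Z ∈ face P, pair w Z = k) : w = 0 := by
  obtain ⟨μ, hμ, hZ⟩ := exists_forall_isGauged_pair_eq hP
  by_contra hne
  obtain ⟨Z, hZf, hZe⟩ := hZ w hw hne
  have h1 := h P (self_mem_face hP)
  rw [pair_comm, hw.pair_eq_zero] at h1
  rw [h Z hZf, ← h1] at hZe
  have := mul_pos hμ (norm_pos_iff.2 hne)
  linarith

/-- The gauged matrix that represents the same affine function on the face of `P` as the Hermitian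
part of `A`, up to a constant: compress to the range of `P`, and subtract a multiple of the
projection onto it. -/
noncomputable def gaugeProj (P : Mat m) : Mat m →ₗ[ℝ] Mat m where
  toFun A := suppProj P * hermPart A * suppProj P - pair P (hermPart A) • suppProj P
  map_add' A B := by
    have h : hermPart (A + B) = hermPart A + hermPart B := by
      rw [hermPart, hermPart, hermPart, Matrix.conjTranspose_add, ← smul_add]
      congr 1
      abel
    rw [h, mul_add, add_mul, pair_add_right, add_smul]
    abel
  map_smul' r A := by
    have h : hermPart (r • A) = r • hermPart A := by
      rw [hermPart, hermPart, Matrix.conjTranspose_smul, star_trivial, ← smul_add, smul_comm]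
    rw [h, pair_smul_right, mul_smul_comm, smul_mul_assoc, RingHom.id_apply, smul_sub, smul_smul]

theorem pair_gaugeProj (hP : P ∈ densities m) {A Z : Mat m} (hA : A.IsHermitian)
    (hZ : Z ∈ face P) : pair (gaugeProj P A) Z = pair A Z - pair P A := by
  change pair (suppProj P * hermPart A * suppProj P - pair P (hermPart A) • suppProj P) Z = _
  have h1 : suppProj P * Z = Z := suppProj_mul hP.1.isHermitian hZ.1.1.isHermitian hZ.2
  have h2 : Z * suppProj P = Z := mul_suppProj hP.1.isHermitian hZ.2
  have h3 : pair (suppProj P) Z = 1 := by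
    rw [pair, h1, hZ.1.2, Complex.one_re]
  have h4 : pair (suppProj P * A * suppProj P) Z = pair A Z := by
    rw [pair, mul_assoc, h1, mul_assoc, Matrix.trace_mul_comm, mul_assoc, h2, pair]
  rw [hermPart_eq hA, pair_sub_left, pair_smul_left, h3, h4, mul_one]

theorem isGauged_gaugeProj (hP : P ∈ densities m) (A : Mat m) : IsGauged P (gaugeProj P A) where
  isHermitian := by
    have hS := suppProj_isHermitian hP.1.isHermitian
    refine Matrix.IsHermitian.sub ?_ ?_
    · have h := Matrix.isHermitian_conjTranspose_mul_mul (suppProj P) (isHermitian_hermPart A)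
      rwa [hS.eq] at h
    · rw [Matrix.IsHermitian, Matrix.conjTranspose_smul, hS.eq, star_trivial]
  mulVec_eq_zero v hv := by
    change (suppProj P * hermPart A * suppProj P - pair P (hermPart A) • suppProj P).mulVec v = 0
    rw [Matrix.sub_mulVec, ← Matrix.mulVec_mulVec, Matrix.smul_mulVec,
      (suppProj_mulVec_eq_zero_iff hP.1.isHermitian v).2 hv, Matrix.mulVec_zero, smul_zero,
      sub_zero]
  pair_eq_zero := by
    have h : gaugeProj P A = gaugeProj P (hermPart A) := by
      change suppProj P * hermPart A * suppProj P - pair P (hermPart A) • suppProj P =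
        suppProj P * hermPart (hermPart A) * suppProj P -
          pair P (hermPart (hermPart A)) • suppProj P
      rw [hermPart_eq (isHermitian_hermPart A)]
    rw [pair_comm, h, pair_gaugeProj hP (isHermitian_hermPart A) (self_mem_face hP), pair_comm P,
      sub_self]

/-- If only zero is gauged, the face of `P` is a point, so `P` is pure. -/
theorem rank_eq_one_of_isGauged_eq_zero (hP : P ∈ densities m) (h : ∀ w, IsGauged P w → w = 0) :
    P.rank = 1 := by
  obtain ⟨e, he, hef⟩ := exists_rankOne_mem_face hP
  have hD := face_sub_isHermitian hef (self_mem_face hP)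
  have h1 := h _ (isGauged_gaugeProj hP (rankOne e - P))
  have h2 := pair_gaugeProj hP hD hef
  have h3 := pair_gaugeProj hP hD (self_mem_face hP)
  rw [h1] at h2 h3
  have h4 : pair (rankOne e - P) (rankOne e - P) = 0 := by
    rw [pair_sub_right]
    have h5 : pair (0 : Mat m) (rankOne e) = pair (0 : Mat m) P := by simp [pair]
    linarith
  rw [← norm_sq_of_isHermitian hD] at h4
  have h5 : rankOne e = P := by
    rw [← sub_eq_zero, ← norm_eq_zero]
    exact pow_eq_zero_iff two_ne_zero |>.1 h4
  rw [← h5]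
  refine le_antisymm (Matrix.rank_vecMulVec_le _ _) (Nat.one_le_iff_ne_zero.2 fun h0 => ?_)
  rw [Matrix.rank, Submodule.finrank_eq_zero, LinearMap.range_eq_bot] at h0
  have h6 : (rankOne e).mulVec e = 0 := LinearMap.congr_fun h0 e
  rw [rankOne_mulVec, he, one_smul] at h6
  rw [h6, dotProduct_zero] at he
  exact zero_ne_one he

/-- Payoff matrices with a best response close to `P` are bounded, once gauged. -/
theorem Kernel.exists_norm_le_of_isBestResponse (θ : Kernel) (hP : P ∈ densities m) :
    ∃ s > 0, ∃ B ≥ 0, ∀ w X, IsGauged P w → θ.IsBestResponse (face P) w X → ‖X - P‖ ≤ s →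
      ‖w‖ ≤ B := by
  obtain ⟨μ, hμ, hZ⟩ := exists_forall_isGauged_pair_eq hP
  obtain ⟨M, hM0, hM⟩ := θ.exists_reg_bound m
  refine ⟨μ / 2, by positivity, 4 * M / μ, by positivity, fun w X hw hX hXP => ?_⟩
  rcases eq_or_ne w 0 with rfl | hne
  · rw [norm_zero]; positivity
  obtain ⟨Z, hZf, hZe⟩ := hZ w hw hne
  rw [Kernel.isBestResponse_iff] at hX
  have h1 := hX.2 Z hZf
  have h2 := abs_le.1 (hM Z hZf.1)
  have h3 := abs_le.1 (hM X hX.1.1)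
  have h4 : pair w X ≤ ‖w‖ * (μ / 2) := by
    have h5 : pair w X = pair w (X - P) := by
      rw [pair_sub_right, pair_comm w P, hw.pair_eq_zero, sub_zero]
    rw [h5]
    exact ((le_abs_self _).trans (abs_pair_le _ _)).trans
      (mul_le_mul_of_nonneg_left hXP (norm_nonneg _))
  rw [le_div_iff₀ hμ]
  linarith [h2.2, h3.1]

end Gauge

section GaugeSpace

variable {ι : Type*} [Fintype ι] [DecidableEq ι] {d : ι → ℕ} {Ω : Type*} [Fintype Ω]
  {G : QuantumGame ι d Ω} {θ : ι → Kernel} {P : Profile d}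

theorem exists_norm_map_le {E F : Type*} [NormedAddCommGroup E] [NormedSpace ℝ E]
    [FiniteDimensional ℝ E] [NormedAddCommGroup F] [NormedSpace ℝ F] (f : E →ₗ[ℝ] F) :
    ∃ C : NNReal, ∀ x, ‖f x‖ ≤ C * ‖x‖ :=
  ⟨‖f.toContinuousLinearMap‖₊, f.toContinuousLinearMap.le_opNorm⟩

/-- The space of profiles of gauged payoff matrices. -/
def gaugeSpace (P : Profile d) : Submodule ℝ (Profile d) where
  carrier := {y | ∀ i, IsGauged (P i) (y i)}
  add_mem' hy hz i := (hy i).add (hz i)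
  zero_mem' i := isGauged_zero (P i)
  smul_mem' r _ hy i := (hy i).smul r

/-- Gauging, player by player. -/
noncomputable def gaugeMap (hP : P ∈ states d) : Profile d →ₗ[ℝ] gaugeSpace P :=
  LinearMap.codRestrict _ (LinearMap.pi fun i => (gaugeProj (P i)).comp (LinearMap.proj i))
    fun A i => isGauged_gaugeProj (hP i) (A i)

theorem gaugeMap_apply (hP : P ∈ states d) (A : Profile d) (i : ι) :
    (gaugeMap hP A : Profile d) i = gaugeProj (P i) (A i) := rfl

theorem isBestResponse_bestResponses (hθ : ∀ i, (θ i).Steep) (hP : P ∈ states d)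
    (y : gaugeSpace P) (i : ι) :
    (θ i).IsBestResponse (face (P i)) ((y : Profile d) i) (bestResponses θ P y i) := by
  have h := (hθ i).isBestResponse_bestResponse (hP i) ((y : Profile d) i)
  rwa [hermPart_eq (y.2 i).isHermitian] at h

theorem bestResponses_mem_face (hθ : ∀ i, (θ i).Steep) (hP : P ∈ states d)
    (y : gaugeSpace P) (i : ι) :
    bestResponses θ P y i ∈ face (P i) ∧ P i ∈ face (bestResponses θ P y i) := by
  obtain ⟨h1, h2, -⟩ := (isBestResponse_bestResponses hθ hP y i).firstOrder (hθ i) (hP i)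
    (y.2 i).isHermitian
  exact ⟨h1, h2⟩

theorem gaugeSpace_eq_of_pair_eq (hP : P ∈ states d) {y z : gaugeSpace P}
    (h : ∀ i, ∃ k : ℝ, ∀ Z ∈ face (P i),
      pair ((y : Profile d) i) Z = pair ((z : Profile d) i) Z + k) :
    y = z := by
  refine Subtype.ext (funext fun i => sub_eq_zero.1 ?_)
  obtain ⟨k, hk⟩ := h i
  refine ((y.2 i).sub (z.2 i)).eq_zero_of_pair_eq (hP i) (k := k) fun Z hZ => ?_
  rw [pair_sub_left, hk Z hZ]
  ring

theorem bestResponses_injective (hθ : ∀ i, (θ i).Steep) (hP : P ∈ states d) :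
    Function.Injective fun y : gaugeSpace P => bestResponses θ P y := by
  intro y z hyz
  refine gaugeSpace_eq_of_pair_eq hP fun i => ?_
  obtain ⟨-, -, k, hk⟩ := (isBestResponse_bestResponses hθ hP y i).firstOrder (hθ i) (hP i)
    (y.2 i).isHermitian
  obtain ⟨-, -, k', hk'⟩ := (isBestResponse_bestResponses hθ hP z i).firstOrder (hθ i) (hP i)
    (z.2 i).isHermitian
  have hyz' : bestResponses θ P y = bestResponses θ P z := hyz
  refine ⟨k - k', fun Z hZ => ?_⟩
  rw [hk Z hZ, hk' Z hZ, hyz']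
  ring

/-- Best responses determine gauged payoff matrices continuously: if the responses converge, the
matrices are bounded, and each of their cluster points is the one that belongs to the limit. -/
theorem tendsto_of_tendsto_bestResponses (hθ : ∀ i, (θ i).Steep) (hP : P ∈ states d)
    {f : ℝ → gaugeSpace P} {p : gaugeSpace P} (hp : bestResponses θ P p = P)
    (h : Tendsto (fun t => bestResponses θ P (f t)) atTop (𝓝 P)) : Tendsto f atTop (𝓝 p) := by
  choose s hs B hB hbound using fun i => (θ i).exists_norm_le_of_isBestResponse (hP i)
  have hev : ∀ᶠ t in atTop, f t ∈ Metric.closedBall (0 : gaugeSpace P) (∑ i, B i) := by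
    have h1 : ∀ i, ∀ᶠ t in atTop, ‖bestResponses θ P (f t) i - P i‖ ≤ s i := by
      intro i
      have h2 : Continuous fun X : Profile d => ‖X i - P i‖ :=
        ((continuous_apply i).sub continuous_const).norm
      have h3 : Tendsto (fun t => ‖bestResponses θ P (f t) i - P i‖) atTop (𝓝 ‖P i - P i‖) :=
        (h2.tendsto P).comp h
      rw [sub_self, norm_zero] at h3
      exact (h3.eventually (gt_mem_nhds (hs i))).mono fun _ ht => ht.le
    filter_upwards [eventually_all.2 h1] with t ht
    rw [mem_closedBall_zero_iff]
    refine (pi_norm_le_iff_of_nonneg (Finset.sum_nonneg fun i _ => hB i)).2 fun i => ?_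
    refine (hbound i _ _ ((f t).2 i) (isBestResponse_bestResponses hθ hP (f t) i) (ht i)).trans ?_
    exact Finset.single_le_sum (f := B) (fun i _ => hB i) (Finset.mem_univ i)
  have hQc : Continuous fun y : gaugeSpace P => bestResponses θ P y :=
    (lipschitzWith_bestResponses hθ hP).continuous.comp continuous_subtype_val
  refine (isCompact_closedBall _ _).tendsto_nhds_of_unique_mapClusterPt hev fun y _ hy => ?_
  have h1 : MapClusterPt (bestResponses θ P y) atTop fun t => bestResponses θ P (f t) :=
    hy.continuousAt_comp (f := fun y : gaugeSpace P => bestResponses θ P y) hQc.continuousAt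
  have h2 : bestResponses θ P y = P := by
    have h3 : ClusterPt (bestResponses θ P y) (𝓝 P) := ClusterPt.mono h1 h
    exact @eq_of_nhds_neBot _ _ _ _ _ h3
  exact bestResponses_injective hθ hP (h2.trans hp.symm)

/-! ### Attracting states are pure -/

/-- The gauged payoff matrices of the orbits in the relative interior of the face of `P` form a flow
that is generated by shear fields, one for each player, since a player's payoff gradient does not
depend on the player's own state. The attraction of a neighborhood of `P` would make this flow
contract a ball to a point, unless there are no gauged matrices but zero. -/
theorem ConsistentlyAttracting.isPure (hθ : ∀ i, (θ i).Steep)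
    {Φ : ℝ → Profile d → Profile d} (hΦ : IsQDFlow G θ Φ) (hP : P ∈ states d)
    (h : ConsistentlyAttracting Φ P) : IsPure P := by
  rcases subsingleton_or_nontrivial (gaugeSpace P) with hsub | hnt
  · refine fun i => rank_eq_one_of_isGauged_eq_zero (hP i) fun w hw => ?_
    have hmem : Function.update (0 : Profile d) i w ∈ gaugeSpace P := by
      intro j
      rcases eq_or_ne j i with rfl | hj
      · rwa [Function.update_self]
      · rw [Function.update_of_ne hj]
        exact isGauged_zero (P j)
    have h1 := congrArg Subtype.val (Subsingleton.elim (⟨_, hmem⟩ : gaugeSpace P) 0)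
    have h2 : Function.update (0 : Profile d) i w i = 0 := congrFun h1 i
    rwa [Function.update_self] at h2
  exfalso
  obtain ⟨U, hU, hattr⟩ := h
  set Q : gaugeSpace P → Profile d := fun y => bestResponses θ P y with hQ
  have hQs : ∀ y, Q y ∈ states d := fun y => bestResponses_mem_states hθ hP y
  have hQc : Continuous Q :=
    (lipschitzWith_bestResponses hθ hP).continuous.comp continuous_subtype_val
  have hface : ∀ y i, face (Q y i) = face (P i) := fun y i =>
    face_eq_of_mem (bestResponses_mem_face hθ hP y i).1 (bestResponses_mem_face hθ hP y i).2
  -- The response to the gauged payoff matrix is the response to the payoff matrix itself.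
  have hgauge : ∀ (A X : Profile d), (∀ i, (A i).IsHermitian) →
      (∀ i, (θ i).IsBestResponse (face (P i)) (A i) (X i)) → Q (gaugeMap hP A) = X := by
    intro A X hA hX
    ext1 i
    refine ((hX i).unique (hθ i) (hP i) ((gaugeMap hP A).2 i).isHermitian
      (isBestResponse_bestResponses hθ hP (gaugeMap hP A) i) (k := pair (P i) (A i))
      fun Z hZ => ?_).symm
    rw [gaugeMap_apply, pair_gaugeProj (hP i) (hA i) hZ]
    ring
  obtain ⟨p, hp⟩ : ∃ p, Q p = P :=
    ⟨gaugeMap hP fun i => cfc (θ i).d1 (P i), hgauge _ _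
      (fun i => cfc_isHermitian _ (states_isHermitian hP i))
      fun i => Kernel.isBestResponse_self (hP i)⟩
  choose Y hY using fun y => (hΦ (Q y) (hQs y)).exists_isLift
  have hbr : ∀ y t i, (θ i).IsBestResponse (face (P i)) (Y y t i) (Φ t (Q y) i) := by
    intro y t i
    have h1 := (hY y).isBestResponse t i
    rwa [hface] at h1
  have hQY : ∀ y t, Q (gaugeMap hP (Y y t)) = Φ t (Q y) := fun y t =>
    hgauge _ _ ((hY y).isHermitian t) (hbr y t)
  -- The field of player `i` points along the component `i` and does not depend on it.
  set F : ι → gaugeSpace P → gaugeSpace P := fun i y =>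
    gaugeMap hP (Pi.single i (leaderField G θ P y i)) with hF
  set W : ι → Submodule ℝ (gaugeSpace P) := fun i =>
    { carrier := {y | ∀ j, j ≠ i → (y : Profile d) j = 0}
      add_mem' := fun hy hz j hj => by
        rw [Submodule.coe_add, Pi.add_apply, hy j hj, hz j hj, add_zero]
      zero_mem' := fun j _ => rfl
      smul_mem' := fun r y hy j hj => by
        rw [Submodule.coe_smul, Pi.smul_apply, hy j hj, smul_zero] } with hW
  obtain ⟨C, hC⟩ := exists_norm_map_le (gaugeMap hP)
  obtain ⟨K, hK⟩ := exists_lipschitzWith_leaderField G hθ hP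
  obtain ⟨L, hL⟩ := G.exists_norm_grad_le
  have hFK : ∀ i, LipschitzWith (C * K) (F i) := fun i =>
    LipschitzWith.of_dist_le_mul fun y z => by
      rw [dist_eq_norm, hF, ← map_sub, ← Pi.single_sub]
      refine (hC _).trans ?_
      rw [Pi.norm_single, NNReal.coe_mul, mul_assoc]
      refine mul_le_mul_of_nonneg_left ?_ C.coe_nonneg
      refine (norm_le_pi_norm (leaderField G θ P y - leaderField G θ P z) i).trans ?_
      rw [← dist_eq_norm]
      exact hK.dist_le_mul _ _
  have hFL : ∀ i y, ‖F i y‖ ≤ (C * L : NNReal) := fun i y => by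
    refine (hC _).trans ?_
    rw [Pi.norm_single, NNReal.coe_mul]
    refine mul_le_mul_of_nonneg_left ?_ C.coe_nonneg
    exact (norm_le_pi_norm (G.grad (Q y)) i).trans (hL _ (hQs y))
  have hFW : ∀ i y, F i y ∈ W i := fun i y j hj => by
    rw [hF, gaugeMap_apply, Pi.single_eq_of_ne hj, map_zero]
  have hFinv : ∀ i y, ∀ w ∈ W i, F i (y + w) = F i y := by
    intro i y w hw
    have h1 : leaderField G θ P (y + w : gaugeSpace P) i = leaderField G θ P y i :=
      G.grad_congr i fun j hj => by
        change (θ j).bestResponse (P j) ((y : Profile d) j + (w : Profile d) j) = _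
        rw [hw j hj, add_zero]
        rfl
    simp only [hF, h1]
  have hφ : ∀ y t, HasDerivAt (fun t => gaugeMap hP (Y y t))
      (∑ i, F i (gaugeMap hP (Y y t))) t := by
    intro y t
    have h1 : ∑ i, F i (gaugeMap hP (Y y t)) = gaugeMap hP (G.grad (Φ t (Q y))) := by
      have h2 : leaderField G θ P (gaugeMap hP (Y y t)) = G.grad (Φ t (Q y)) := by
        rw [← hQY]
        rfl
      simp only [hF, h2]
      rw [← map_sum, Finset.univ_sum_single]
    rw [h1]
    exact (gaugeMap hP).toContinuousLinearMap.hasFDerivAt.comp_hasDerivAt t ((hY y).hasDerivAt t)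
  have h0 : ∀ y, gaugeMap hP (Y y 0) = y := fun y =>
    bestResponses_injective hθ hP ((hQY y 0).trans (hΦ (Q y) (hQs y)).1)
  have hpre : Q ⁻¹' U ∈ 𝓝 p := hQc.continuousAt.preimage_mem_nhds (by rwa [hp])
  obtain ⟨r, hr, hball⟩ := Metric.mem_nhds_iff.1 hpre
  refine not_tendsto_of_shear_fields hFK hFL hFW hFinv (φ := fun y t => gaugeMap hP (Y y t)) h0 hφ
    p hr fun y hy => tendsto_of_tendsto_bestResponses hθ hP hp ?_
  have h1 := hattr (Q y) (hball hy) ⟨hQs y, fun i =>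
    (bestResponses_mem_face hθ hP y i).2.2⟩
  refine h1.congr fun t => ?_
  exact (hQY y t).symm

end GaugeSpace

end QGame

theorem mainTheorem1 {ι : Type*} [Fintype ι] [DecidableEq ι] {d : ι → ℕ} {Ω : Type*} [Fintype Ω]
    (G : QGame.QuantumGame ι d Ω) (θ : ι → QGame.Kernel) (hθ : ∀ i, (θ i).Steep) :
    (∀ X₀ ∈ QGame.states d, ∃! X : ℝ → QGame.Profile d, QGame.IsQDOrbit G θ X₀ X) ∧
    ∀ Φ : ℝ → QGame.Profile d → QGame.Profile d, QGame.IsQDFlow G θ Φ →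
      ∀ Xs ∈ QGame.states d,
        (G.IsNash Xs → QGame.IsRestPoint G θ Φ Xs) ∧
        (∀ Y X : ℝ → QGame.Profile d, QGame.IsFTQL G θ Y X →
          Tendsto X atTop (𝓝 Xs) → G.IsNash Xs) ∧
        (QGame.LyapunovStable Φ Xs → G.IsNash Xs) ∧
        (QGame.ConsistentlyAsymptoticallyStable Φ Xs → QGame.IsPure Xs) ∧
        (G.IsVariationallyStable Xs → QGame.ConsistentlyAsymptoticallyStable Φ Xs) := by
  refine ⟨fun X₀ hX₀ => ?_, fun Φ hΦ Xs hXs => ⟨fun h => h.isRestPoint hθ hΦ hXs,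
    fun Y X h hlim => h.isNash_of_tendsto hlim, fun h => h.isNash hΦ hXs,
    fun h => h.2.isPure hθ hΦ hXs,
    fun h => ⟨h.lyapunovStable hθ hΦ hXs, h.consistentlyAttracting hθ hΦ hXs⟩⟩⟩
  obtain ⟨X, hX⟩ := QGame.exists_isQDOrbit G hθ hX₀
  exact ⟨X, hX, fun X' hX' => hX'.unique hθ hX₀ hX⟩
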